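/- **Programs.** Fix a set $D$ with an element $0$ (data domain; its elements also serve as addresses) and a set of functions $D^n\to D$ (function domain); no finiteness is assumed. A parallel program $P$ consists of finitely many threads. Each thread has local registers, an initial label and a finite sequence of labelled instructions "$\ell$: instr; goto $\ell'$" (labels may be shared), where instr is a load $r\leftarrow\mathrm{mem}[e]$, a store $\mathrm{mem}[e_1]\leftarrow e_2$, a fence, an assignment $r\leftarrow e$, or an assertion $\mathrm{assert}\ e$ (enabled iff $e\neq 0$); expressions apply functions of the function domain to registers of the thread. **Computations.** All registers and addresses initially hold $0$. Under TSO each thread $t$ has a FIFO buffer, initially empty. A store instruction appends its address–value pair to the buffer, action $(t,\mathrm{issue})$; at any time the oldest pair $(a,v)$ in the buffer of $t$ may be written to memory, action $(t,\mathrm{store},a,v)$. A load reads the newest value buffered by its own thread for the address $a$, if there is one (an early read), and otherwise the memory, action $(t,\mathrm{load},a,v)$. Fences (enabled only if the buffer of $t$ is empty), assignments and assertions give the action $(t,\mathrm{loc})$. A TSO computation is a finite sequence of actions leading from the initial state to a state with empty buffers. An SC computation is a finite sequence of actions generated without buffers, where a store instruction yields its issue immediately followed by its store and fences have no effect. **Traces.**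 The trace of a computation is the graph, up to isomorphism, with one node, labelled by its action, for each action (an issue and its store share one node, labelled by the store) and with the program order $\to_{po}$ (order of issuing within each thread), the store order $\to_{st}$ (order of the stores to each address) and the source relation $\to_{src}$ (from a store to the loads that read from it). A load $l$ and a store $s$ satisfy $l\to_{cf}s$ if some store $s'$ has $s'\to_{src}l$ and $s'\to_{st}s$, or if $l$ reads the initial value of the address of $s$. Put $\to_{hb}\ :=\ \to_{po}\cup\to_{st}\cup\to_{src}\cup\to_{cf}$. The program $P$ is *robust* if its set of TSO traces equals its set of SC traces. A thread *delays* a store if some action of the same thread occurs between the issue and the store. **Attacks.** An attack $(t_A,\mathit{stinst},\mathit{ldinst})$ consists of a thread $t_A$ (the attacker), a store instruction and a load instruction of $t_A$. A *TSO witness* for it is a TSO computation $$\tau=\tau_1\cdot \mathrm{issue}_A\cdot\tau_2\cdot \mathrm{load}_A\cdot\tau_3\cdot \mathrm{store}_A\cdot\tau_4,$$ together with transitions producing it, where $\mathrm{issue}_A,\mathrm{load}_A,\mathrm{store}_A$ are actions of $t_A$ and $\mathrm{store}_A$ is the store issued by $\mathrm{issue}_A$, such that: (a) only $t_A$ delays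 stores; (b) $\mathrm{store}_A$ is an instance of $\mathit{stinst}$ and is the first delayed store of $t_A$; $\mathrm{load}_A$ is an instance of $\mathit{ldinst}$ and is the last action of $t_A$ before $\mathrm{store}_A$; $\tau_2$ contains no store actions and no fences of $t_A$; (c) $\mathrm{load}_A\to_{hb}^+x$ in the trace of $\tau$ for every action $x$ in $\mathrm{load}_A\cdot\tau_3\cdot\mathrm{store}_A$ (an issue and its store count as one action); (d) $\tau_4$ consists only of delayed store actions of $t_A$ that were issued before $\mathrm{load}_A$; (e) $\mathrm{store}_A$ and all stores in $\tau_4$ have addresses different from that of $\mathrm{load}_A$ (so $\mathrm{load}_A$ has not read its value early). An attack is *feasible* if it has a TSO witness. **Theorem.** A parallel program $P$ is robust if and only if no attack on $P$ is feasible. -/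

import Mathlib

/-! ### Parallel programs -/

namespace TSORobust

/-- A function on the data domain, with its arity. -/
abbrev DataFun (D : Type*) := Σ n : ℕ, ((Fin n → D) → D)

/-- Expressions `f(r₁, …, rₙ)`, with `f` from the function domain and `rᵢ` registers. -/
structure Expr {D : Type*} (FUN : Set (DataFun D)) (Reg : Type*) where
  fn : DataFun D
  fn_mem : fn ∈ FUN
  args : Fin fn.1 → Reg

/-- The value of an expression under a register valuation. -/
def Expr.eval {D : Type*} {FUN : Set (DataFun D)} {Reg : Type*}
    (e : Expr FUN Reg) (ρ : Reg → D) : D :=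
  e.fn.2 (fun i => ρ (e.args i))

/-- Instructions: `r ← mem[e]`, `mem[e₁] ← e₂`, `mfence`, `r ← e`, `assert e`. -/
inductive Instr {D : Type*} (FUN : Set (DataFun D)) (Reg : Type*) where
  | load (r : Reg) (addr : Expr FUN Reg)
  | store (addr val : Expr FUN Reg)
  | mfence
  | assign (r : Reg) (e : Expr FUN Reg)
  | assertion (e : Expr FUN Reg)

/-- The registers that occur in an instruction. -/
def Instr.regs {D : Type*} {FUN : Set (DataFun D)} {Reg : Type*} : Instr FUN Reg → Set Reg
  | .load r e => insert r (Set.range e.args)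
  | .store e₁ e₂ => Set.range e₁.args ∪ Set.range e₂.args
  | .mfence => ∅
  | .assign r e => insert r (Set.range e.args)
  | .assertion e => Set.range e.args

/-- A labelled instruction `label: instr; goto target`. -/
structure LInstr {D : Type*} (FUN : Set (DataFun D)) (Reg Lab : Type*) where
  label : Lab
  instr : Instr FUN Reg
  target : Lab

/-- A thread: its declared local registers, initial label and source code. -/
structure ThreadCode {D : Type*} (FUN : Set (DataFun D)) (Reg Lab : Type*) where
  regs : List Reg
  init : Lab
  code : List (LInstr FUN Reg Lab)
  regs_declared : ∀ li ∈ code, ∀ r ∈ li.instr.regs, r ∈ regs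

/-- A parallel program with set of thread identifiers `T`. -/
structure Program (T : Type*) {D : Type*} (FUN : Set (DataFun D)) (Reg Lab : Type*) where
  thread : T → ThreadCode FUN Reg Lab

/-! ### Actions and states -/

/-- What an action does: issue, local, load of value `v` from address `a`, store of `v` to `a`. -/
inductive ActKind (D : Type*) where
  | issue
  | loc
  | load (a v : D)
  | store (a v : D)

/-- An action: a thread identifier together with what is done. -/
structure Act (T D : Type*) where
  thread : T
  kind : ActKind D

def Act.IsStore {T D : Type*} (x : Act T D) : Prop := ∃ a v, x.kind = .store a v

/-- A TSO state. Registers are local, hence valued per thread; memory locations are valued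
by `mem`. The head of a buffer is its oldest entry. -/
structure TSOState (T D Reg Lab : Type*) where
  pc : T → Lab
  reg : T → Reg → D
  mem : D → D
  buf : T → List (D × D)

/-- An SC state. -/
structure SCState (T D Reg Lab : Type*) where
  pc : T → Lab
  reg : T → Reg → D
  mem : D → D

/-- An executed transition: its action, and the instruction it executes (`none` if an entry of a
store buffer is written to memory, which does not execute an instruction). -/
structure Event (T : Type*) {D : Type*} (FUN : Set (DataFun D)) (Reg Lab : Type*) where
  act : Act T D
  instr : Option (LInstr FUN Reg Lab)

namespace Program

variable {T D Reg Lab : Type*} {FUN : Set (DataFun D)}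

/-- The instruction `li` is in the code of `t` and is labelled by `l`. -/
def At (P : Program T FUN Reg Lab) (t : T) (l : Lab) (li : LInstr FUN Reg Lab) : Prop :=
  li ∈ (P.thread t).code ∧ li.label = l

/-! ### TSO semantics -/

open Classical in
/-- The TSO transition relation. -/
inductive TSOStep (P : Program T FUN Reg Lab) [Zero D] :
    TSOState T D Reg Lab → Event T FUN Reg Lab → TSOState T D Reg Lab → Prop
  | loadBuffer (s : TSOState T D Reg Lab) (t : T) (l l' : Lab) (r : Reg) (e : Expr FUN Reg)
      (a v : D) (β : List (D × D)) :
      P.At t (s.pc t) ⟨l, .load r e, l'⟩ → a = e.eval (s.reg t) →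
      (s.buf t).filter (fun p => p.1 = a) = β ++ [(a, v)] →
      TSOStep P s ⟨⟨t, .load a v⟩, some ⟨l, .load r e, l'⟩⟩
        { s with pc := Function.update s.pc t l'
                 reg := Function.update s.reg t (Function.update (s.reg t) r v) }
  | loadMemory (s : TSOState T D Reg Lab) (t : T) (l l' : Lab) (r : Reg) (e : Expr FUN Reg)
      (a v : D) :
      P.At t (s.pc t) ⟨l, .load r e, l'⟩ → a = e.eval (s.reg t) →
      (s.buf t).filter (fun p => p.1 = a) = [] → v = s.mem a →
      TSOStep P s ⟨⟨t, .load a v⟩, some ⟨l, .load r e, l'⟩⟩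
        { s with pc := Function.update s.pc t l'
                 reg := Function.update s.reg t (Function.update (s.reg t) r v) }
  | issue (s : TSOState T D Reg Lab) (t : T) (l l' : Lab) (e₁ e₂ : Expr FUN Reg) (a v : D) :
      P.At t (s.pc t) ⟨l, .store e₁ e₂, l'⟩ → a = e₁.eval (s.reg t) → v = e₂.eval (s.reg t) →
      TSOStep P s ⟨⟨t, .issue⟩, some ⟨l, .store e₁ e₂, l'⟩⟩
        { s with pc := Function.update s.pc t l'
                 buf := Function.update s.buf t (s.buf t ++ [(a, v)]) }
  | store (s : TSOState T D Reg Lab) (t : T) (a v : D) (β : List (D × D)) :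
      s.buf t = (a, v) :: β →
      TSOStep P s ⟨⟨t, .store a v⟩, none⟩
        { s with mem := Function.update s.mem a v
                 buf := Function.update s.buf t β }
  | mfence (s : TSOState T D Reg Lab) (t : T) (l l' : Lab) :
      P.At t (s.pc t) ⟨l, .mfence, l'⟩ → s.buf t = [] →
      TSOStep P s ⟨⟨t, .loc⟩, some ⟨l, .mfence, l'⟩⟩
        { s with pc := Function.update s.pc t l' }
  | assign (s : TSOState T D Reg Lab) (t : T) (l l' : Lab) (r : Reg) (e : Expr FUN Reg) :
      P.At t (s.pc t) ⟨l, .assign r e, l'⟩ →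
      TSOStep P s ⟨⟨t, .loc⟩, some ⟨l, .assign r e, l'⟩⟩
        { s with pc := Function.update s.pc t l'
                 reg := Function.update s.reg t
                   (Function.update (s.reg t) r (e.eval (s.reg t))) }
  | assertion (s : TSOState T D Reg Lab) (t : T) (l l' : Lab) (e : Expr FUN Reg) :
      P.At t (s.pc t) ⟨l, .assertion e, l'⟩ → e.eval (s.reg t) ≠ 0 →
      TSOStep P s ⟨⟨t, .loc⟩, some ⟨l, .assertion e, l'⟩⟩
        { s with pc := Function.update s.pc t l' }

/-- Finite sequences of TSO transitions. -/
inductive TSORun (P : Program T FUN Reg Lab) [Zero D] :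
    TSOState T D Reg Lab → List (Event T FUN Reg Lab) → TSOState T D Reg Lab → Prop
  | nil (s : TSOState T D Reg Lab) : TSORun P s [] s
  | cons {s s' s'' : TSOState T D Reg Lab} {e : Event T FUN Reg Lab}
      {es : List (Event T FUN Reg Lab)} :
      P.TSOStep s e s' → TSORun P s' es s'' → TSORun P s (e :: es) s''

/-- The initial TSO state. -/
def tsoInit (P : Program T FUN Reg Lab) [Zero D] : TSOState T D Reg Lab where
  pc := fun t => (P.thread t).init
  reg := fun _ _ => 0
  mem := fun _ => 0
  buf := fun _ => []

/-- The sequence `es` of TSO transitions leads from the initial state to a state with empty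
buffers. -/
def IsTSOExec (P : Program T FUN Reg Lab) [Zero D] (es : List (Event T FUN Reg Lab)) : Prop :=
  ∃ s, P.TSORun P.tsoInit es s ∧ ∀ t, s.buf t = []

/-- The TSO computations of a program. -/
def tsoComp (P : Program T FUN Reg Lab) [Zero D] : Set (List (Act T D)) :=
  {w | ∃ es, P.IsTSOExec es ∧ w = es.map Event.act}

/-! ### SC semantics -/

open Classical in
/-- The SC transition relation. A store instruction yields two actions, its issue directly
followed by the store; every other instruction yields one action. -/
inductive SCStep (P : Program T FUN Reg Lab) [Zero D] :
    SCState T D Reg Lab → List (Act T D) → SCState T D Reg Lab → Prop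
  | load (s : SCState T D Reg Lab) (t : T) (l l' : Lab) (r : Reg) (e : Expr FUN Reg) (a v : D) :
      P.At t (s.pc t) ⟨l, .load r e, l'⟩ → a = e.eval (s.reg t) → v = s.mem a →
      SCStep P s [⟨t, .load a v⟩]
        { s with pc := Function.update s.pc t l'
                 reg := Function.update s.reg t (Function.update (s.reg t) r v) }
  | store (s : SCState T D Reg Lab) (t : T) (l l' : Lab) (e₁ e₂ : Expr FUN Reg) (a v : D) :
      P.At t (s.pc t) ⟨l, .store e₁ e₂, l'⟩ → a = e₁.eval (s.reg t) → v = e₂.eval (s.reg t) →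
      SCStep P s [⟨t, .issue⟩, ⟨t, .store a v⟩]
        { s with pc := Function.update s.pc t l'
                 mem := Function.update s.mem a v }
  | mfence (s : SCState T D Reg Lab) (t : T) (l l' : Lab) :
      P.At t (s.pc t) ⟨l, .mfence, l'⟩ →
      SCStep P s [⟨t, .loc⟩] { s with pc := Function.update s.pc t l' }
  | assign (s : SCState T D Reg Lab) (t : T) (l l' : Lab) (r : Reg) (e : Expr FUN Reg) :
      P.At t (s.pc t) ⟨l, .assign r e, l'⟩ →
      SCStep P s [⟨t, .loc⟩]
        { s with pc := Function.update s.pc t l'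
                 reg := Function.update s.reg t
                   (Function.update (s.reg t) r (e.eval (s.reg t))) }
  | assertion (s : SCState T D Reg Lab) (t : T) (l l' : Lab) (e : Expr FUN Reg) :
      P.At t (s.pc t) ⟨l, .assertion e, l'⟩ → e.eval (s.reg t) ≠ 0 →
      SCStep P s [⟨t, .loc⟩] { s with pc := Function.update s.pc t l' }

/-- Finite sequences of SC transitions, with the word of actions they yield. -/
inductive SCRun (P : Program T FUN Reg Lab) [Zero D] :
    SCState T D Reg Lab → List (Act T D) → SCState T D Reg Lab → Prop
  | nil (s : SCState T D Reg Lab) : SCRun P s [] s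
  | cons {s s' s'' : SCState T D Reg Lab} {w w' : List (Act T D)} :
      P.SCStep s w s' → SCRun P s' w' s'' → SCRun P s (w ++ w') s''

/-- The initial SC state. -/
def scInit (P : Program T FUN Reg Lab) [Zero D] : SCState T D Reg Lab where
  pc := fun t => (P.thread t).init
  reg := fun _ _ => 0
  mem := fun _ => 0

/-- The SC computations of a program. -/
def scComp (P : Program T FUN Reg Lab) [Zero D] : Set (List (Act T D)) :=
  {w | ∃ s, P.SCRun P.scInit w s}

end Program

/-! ### Traces -/

/-- Traces, as node-labelled graphs. The nodes are named canonically: `(t, k)` is the `k`-th node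
of thread `t`. So equality of traces is isomorphism of labelled graphs: the labels determine the
threads, and the program order, which is total on each thread, determines the numbers.
`label n = none` means that `n` is not a node. The fields `po` and `st` hold the edges between
immediate neighbours in the program order and in the store order. -/
@[ext]
structure Trace (T D : Type*) where
  label : T × ℕ → Option (Act T D)
  po : T × ℕ → T × ℕ → Prop
  st : T × ℕ → T × ℕ → Prop
  src : T × ℕ → T × ℕ → Prop

namespace Trace

variable {T D : Type*}

/-- The trace of the empty word. -/
def empty : Trace T D where
  label := fun _ => none
  po := fun _ _ => False
  st := fun _ _ => False
  src := fun _ _ => False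

/-- `n` is the maximal node in the program order of thread `t`. -/
def IsMaxPo (G : Trace T D) (t : T) (n : T × ℕ) : Prop :=
  n.1 = t ∧ G.label n ≠ none ∧ ∀ m, ¬ G.po n m

/-- `n` is the maximal node in the store order of address `a`. -/
def IsMaxSt (G : Trace T D) (a : D) (n : T × ℕ) : Prop :=
  (∃ t v, G.label n = some ⟨t, .store a v⟩) ∧ ∀ m, ¬ G.st n m

/-- `n` is the minimal node in the program order of thread `t` that is labelled by an issue. -/
def IsFirstIssue (G : Trace T D) (t : T) (n : T × ℕ) : Prop :=
  G.label n = some ⟨t, .issue⟩ ∧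
    ∀ m, G.label m = some ⟨t, .issue⟩ → ¬ Relation.TransGen G.po m n

/-- The fresh node for the next action of thread `t`. -/
noncomputable def fresh (G : Trace T D) (t : T) : T × ℕ :=
  (t, sInf {k | G.label (t, k) = none})

/-- `n` is the node that the action `x` belongs to if it is executed after the word with
trace `G`: for a store, the node of the earliest pending issue; otherwise a fresh node. -/
def IsNodeOf (G : Trace T D) (x : Act T D) (n : T × ℕ) : Prop :=
  (x.IsStore ∧ G.IsFirstIssue x.thread n) ∨ (¬ x.IsStore ∧ n = G.fresh x.thread)

/-- `m` is a load with the address and value of the store `x` that follows the node of `x`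
in the program order, so it has read from `x` early. -/
def IsEarlyRead (G : Trace T D) (x : Act T D) (m : T × ℕ) : Prop :=
  ∃ a v, x.kind = .store a v ∧ G.label m = some ⟨x.thread, .load a v⟩ ∧
    ∃ n, G.IsNodeOf x n ∧ Relation.TransGen G.po n m

open Classical in
/-- The trace of `α · x`, given the trace `G` of `α`. -/
noncomputable def extend (G : Trace T D) (x : Act T D) : Trace T D where
  label := fun n => if G.IsNodeOf x n then some x else G.label n
  po := fun m n => G.po m n ∨ (¬ x.IsStore ∧ G.IsMaxPo x.thread m ∧ G.IsNodeOf x n)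
  st := fun m n => G.st m n ∨ ∃ a v, x.kind = .store a v ∧ G.IsMaxSt a m ∧ G.IsNodeOf x n
  src := fun m n =>
    if G.IsEarlyRead x n then G.IsNodeOf x m
    else G.src m n ∨ ∃ a v, x.kind = .load a v ∧ G.IsMaxSt a m ∧ G.IsNodeOf x n

/-- The trace of a word of actions. -/
noncomputable def ofWord (w : List (Act T D)) : Trace T D :=
  w.foldl extend empty

/-- The conflict relation: the store `n` overwrites the value (possibly the initial one) that the
load `m` reads. -/
def cf (G : Trace T D) (m n : T × ℕ) : Prop :=
  (∃ k, G.src k m ∧ G.st k n) ∨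
    ((∀ k, ¬ G.src k m) ∧ ∃ t t' a v v',
      G.label m = some ⟨t, .load a v⟩ ∧ G.label n = some ⟨t', .store a v'⟩)

/-- The happens-before relation of a trace. -/
def hb (G : Trace T D) (m n : T × ℕ) : Prop :=
  G.po m n ∨ G.st m n ∨ G.src m n ∨ G.cf m n

end Trace

/-! ### Positions in a word of actions -/

section Positions

variable {T D : Type*}

/-- `n` is the node of the trace of `w` that the action at position `i` of `w` belongs to. -/
def NodeAt (w : List (Act T D)) (i : ℕ) (n : T × ℕ) : Prop :=
  ∃ x, w[i]? = some x ∧ (Trace.ofWord (w.take i)).IsNodeOf x n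

/-- The actions at positions `i` and `j` of `w` are an issue of thread `t` and the corresponding
store, that is, they yield the same node. -/
def Corresponding (w : List (Act T D)) (t : T) (i j : ℕ) : Prop :=
  w[i]? = some ⟨t, .issue⟩ ∧ (∃ a v, w[j]? = some ⟨t, .store a v⟩) ∧
    ∃ n, NodeAt w i n ∧ NodeAt w j n

/-- Thread `t` delays the store at position `j` that it issues at position `i`: at least one action
of `t` lies between the two. -/
def Delayed (w : List (Act T D)) (t : T) (i j : ℕ) : Prop :=
  Corresponding w t i j ∧ ∃ k x, i < k ∧ k < j ∧ w[k]? = some x ∧ x.thread = t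

/-- The actions at positions `i` and `j` of `w` are related by the transitive closure of the
happens-before relation of the trace of `w`. -/
def HappensBefore (w : List (Act T D)) (i j : ℕ) : Prop :=
  ∃ m n, NodeAt w i m ∧ NodeAt w j n ∧ Relation.TransGen (Trace.ofWord w).hb m n

end Positions

/-! ### Robustness and attacks -/

namespace Program

variable {T D Reg Lab : Type*} {FUN : Set (DataFun D)}

/-- The TSO traces of a program. -/
def tsoTraces (P : Program T FUN Reg Lab) [Zero D] : Set (Trace T D) :=
  Trace.ofWord '' P.tsoComp

/-- The SC traces of a program. -/
def scTraces (P : Program T FUN Reg Lab) [Zero D] : Set (Trace T D) :=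
  Trace.ofWord '' P.scComp

/-- Trace-robustness against TSO. -/
def Robust (P : Program T FUN Reg Lab) [Zero D] : Prop :=
  P.tsoTraces = P.scTraces

/-- An attack: a thread (the attacker), and a store and a load instruction in its code. -/
structure Attack (P : Program T FUN Reg Lab) where
  attacker : T
  stinst : LInstr FUN Reg Lab
  ldinst : LInstr FUN Reg Lab
  stinst_mem : stinst ∈ (P.thread attacker).code
  ldinst_mem : ldinst ∈ (P.thread attacker).code
  stinst_store : ∃ e₁ e₂, stinst.instr = .store e₁ e₂
  ldinst_load : ∃ r e, ldinst.instr = .load r e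

/-- The sequence of transitions `es` is a TSO witness for the attack `A`, where the issue of the
delayed store, the overstepped load and the delayed store are at positions `p < q < r`. So
`τ₁, τ₂, τ₃, τ₄` are the parts of `es` before `p`, between `p` and `q`, between `q` and `r`, and
after `r`. -/
structure IsWitness (P : Program T FUN Reg Lab) [Zero D] (A : P.Attack)
    (es : List (Event T FUN Reg Lab)) (p q r : ℕ) : Prop where
  /-- the actions form a TSO computation -/
  exec : P.IsTSOExec es
  p_lt_q : p < q
  q_lt_r : q < r
  /-- (a) only the attacker delays stores -/
  only_attacker : ∀ t i j, Delayed (es.map Event.act) t i j → t = A.attacker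
  /-- (b) the store of the attack is an instance of the store instruction -/
  store_instance : es[p]? = some ⟨⟨A.attacker, .issue⟩, some A.stinst⟩
  /-- (b) it is delayed -/
  store_delayed : Delayed (es.map Event.act) A.attacker p r
  /-- (b) it is the first store of the attacker that is delayed -/
  store_first : ∀ i j, Delayed (es.map Event.act) A.attacker i j → p ≤ i ∧ r ≤ j
  /-- (b) the load of the attack is an instance of the load instruction -/
  load_instance : ∃ a v, es[q]? = some ⟨⟨A.attacker, .load a v⟩, some A.ldinst⟩
  /-- (b) it is the last action of the attacker that is overstepped by the store -/
  load_last : ∀ k e, q < k → k < r → es[k]? = some e → e.act.thread ≠ A.attacker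
  /-- (b) `τ₂` contains no stores and no fences of the attacker -/
  no_store_fence : ∀ k e, p < k → k < q → es[k]? = some e → e.act.thread = A.attacker →
    ¬ e.act.IsStore ∧ ∀ li, e.instr = some li → li.instr ≠ .mfence
  /-- (c) the load happens before all actions from itself to the store -/
  happens_before : ∀ k, q ≤ k → k ≤ r → HappensBefore (es.map Event.act) q k
  /-- (d) `τ₄` consists of delayed stores of the attacker that were issued before the load -/
  rest : ∀ k, r < k → k < es.length → ∃ i, i < q ∧ Delayed (es.map Event.act) A.attacker i k
  /-- (e) the delayed stores have addresses different from that of the load -/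
  not_early : ∀ k a v b u, r ≤ k → (es.map Event.act)[q]? = some ⟨A.attacker, .load a v⟩ →
    (es.map Event.act)[k]? = some ⟨A.attacker, .store b u⟩ → b ≠ a

/-- An attack is feasible if it has a TSO witness. -/
def Attack.Feasible {P : Program T FUN Reg Lab} [Zero D] (A : P.Attack) : Prop :=
  ∃ es p q r, P.IsWitness A es p q r

end Program

end TSORobust

open TSORobust

/-! A feasible attack destroys robustness because the trace of its witness is cyclic: the load
happens before the delayed store by (c), while the store, issued earlier, precedes the load in
program order. Traces of SC computations are acyclic, since each new node only receives edges from
older ones (`XState.Ranked.insert`, `not_robust_of_feasible`).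

For the converse, assume that no attack is feasible. Strong induction on `cost` shows that every TSO
trace is an SC trace. The cost is the length plus the number of pairs of a non-store action and a
later store of the same thread, so it drops both when an action is deleted and when a store is
executed before a preceding action of its thread. If no store is delayed, each issue can be
postponed until its store, which gives an SC computation (`XRun.exists_scx`). Otherwise let `st` be
the first delayed store and `b` the last action of its thread before it. Actions between the two
that do not depend on `b` are moved before `b` (`XRun.separate`); each remaining one is reached from
`b` by a chain of conflicts and program order steps.

If no remaining action conflicts with `st`, then `st` can be executed before `b`, with the same
trace and smaller cost (`XRun.advance_store`). If one does, then `b` reads the memory and happens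
before `st`, while `st` precedes `b` in program order: the trace is cyclic. If no other thread has
pending stores after `st`, the rest of the computation can be replaced by emptying the buffer of the
attacker, and the result is a witness (`XRun.exists_feasible`), a contradiction. If another thread
`t` has pending stores, there is a cheaper computation with a cyclic trace
(`XRun.false_of_pending`), which contradicts the induction hypothesis. It arises by deleting the
last action of `t` if the cycle does not need it. Otherwise the oldest pending store of `t` is
executed early; and if a conflict prevents this, that store lies on a cycle of its own, which
survives the deletion of `b`.

Everything takes place on a machine whose state contains the trace built so far. Two runs to the
same final state thus have the same trace, and reorderings preserve traces by construction. -/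

namespace TSORobust

/-! ### A machine whose state records the trace -/

section Machine

/-- The content of a memory cell: its value, and the node of the store that wrote it. -/
abbrev Cell (T D : Type*) := D × Option (T × ℕ)

/-- The state of a thread. Buffer entries carry the number of their node. A node is recorded with
the kind of its action, and its source (loads) or its predecessor in the store order (stores). -/
structure Loc (T D Reg Lab : Type*) where
  pc : Lab
  reg : Reg → D
  buf : List (ℕ × D × D)
  cnt : ℕ
  nodes : ℕ → Option (ActKind D × Option (T × ℕ))

/-- The access of an action to the shared memory. -/
inductive Acc (T D : Type*) where
  | silent
  | read (a : D) (c : Cell T D)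
  | write (a : D) (c c' : Cell T D)

/-- A transition, annotated with the number of its node, the number of the next fresh node of its
thread, and its memory access. -/
structure AEvent (T : Type*) {D : Type*} (FUN : Set (DataFun D)) (Reg Lab : Type*) where
  ev : Event T FUN Reg Lab
  node : ℕ
  nxt : ℕ
  acc : Acc T D

/-- States of the machine that records the trace. -/
structure XState (T D Reg Lab : Type*) where
  loc : T → Loc T D Reg Lab
  mem : D → Cell T D

variable {T D Reg Lab : Type*} {FUN : Set (DataFun D)}

/-- The thread of an annotated event. -/
abbrev AEvent.th (x : AEvent T FUN Reg Lab) : T := x.ev.act.thread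

/-- The node of an annotated event. -/
abbrev AEvent.nd (x : AEvent T FUN Reg Lab) : T × ℕ := (x.th, x.node)

/-- The event writes a buffered store to memory. -/
abbrev AEvent.IsStore (x : AEvent T FUN Reg Lab) : Prop := x.ev.act.IsStore

theorem not_isStore_of_issue {x : AEvent T FUN Reg Lab} (h : x.ev.act.kind = .issue) :
    ¬ x.IsStore := by
  rintro ⟨a, v, h'⟩
  rw [h] at h'; cases h'

/-- The record of a node. -/
abbrev XState.node (σ : XState T D Reg Lab) (m : T × ℕ) : Option (ActKind D × Option (T × ℕ)) :=
  (σ.loc m.1).nodes m.2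

/-- All buffers are empty. -/
def XState.Flushed (σ : XState T D Reg Lab) : Prop := ∀ t, (σ.loc t).buf = []

/-- Conflicting memory accesses. -/
def Acc.Conflict : Acc T D → Acc T D → Prop
  | .read a _, .write b _ _ => a = b
  | .write a _ _, .read b _ => a = b
  | .write a _ _, .write b _ _ => a = b
  | _, _ => False

open Classical in
/-- Execution of an instruction that creates a fresh node. -/
noncomputable def Loc.advance (l : Loc T D Reg Lab) (pc : Lab) (reg : Reg → D)
    (buf : List (ℕ × D × D)) (nd : ActKind D × Option (T × ℕ)) : Loc T D Reg Lab :=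
  ⟨pc, reg, buf, l.cnt + 1, Function.update l.nodes l.cnt (some nd)⟩

open Classical in
/-- The effect of fences, assignments and assertions. -/
inductive LocalEffect [Zero D] (buf : List (ℕ × D × D)) (ρ : Reg → D) :
    Instr FUN Reg → (Reg → D) → Prop
  | mfence : buf = [] → LocalEffect buf ρ .mfence ρ
  | assign (r : Reg) (e : Expr FUN Reg) :
      LocalEffect buf ρ (.assign r e) (Function.update ρ r (e.eval ρ))
  | assertion (e : Expr FUN Reg) : e.eval ρ ≠ 0 → LocalEffect buf ρ (.assertion e) ρ

open Classical in
/-- The steps of a thread. -/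
inductive LStep (P : Program T FUN Reg Lab) [Zero D] (t : T) :
    Loc T D Reg Lab → AEvent T FUN Reg Lab → Loc T D Reg Lab → Prop
  | loadBuffer (l : Loc T D Reg Lab) (l' : Lab) (r : Reg) (e : Expr FUN Reg) (a v : D) (k : ℕ)
      (β : List (ℕ × D × D)) :
      P.At t l.pc ⟨l.pc, .load r e, l'⟩ → a = e.eval l.reg →
      l.buf.filter (fun p => p.2.1 = a) = β ++ [(k, a, v)] →
      LStep P t l ⟨⟨⟨t, .load a v⟩, some ⟨l.pc, .load r e, l'⟩⟩, l.cnt, l.cnt, .silent⟩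
        (l.advance l' (Function.update l.reg r v) l.buf (.load a v, some (t, k)))
  -- The cell `c` is arbitrary here and tied to the memory only by `MStep`. A thread thus depends on
  -- the memory through the access annotation alone, so steps of different threads commute as soon
  -- as their accesses do.
  | loadMemory (l : Loc T D Reg Lab) (l' : Lab) (r : Reg) (e : Expr FUN Reg) (a : D)
      (c : Cell T D) :
      P.At t l.pc ⟨l.pc, .load r e, l'⟩ → a = e.eval l.reg →
      l.buf.filter (fun p => p.2.1 = a) = [] →
      LStep P t l ⟨⟨⟨t, .load a c.1⟩, some ⟨l.pc, .load r e, l'⟩⟩, l.cnt, l.cnt, .read a c⟩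
        (l.advance l' (Function.update l.reg r c.1) l.buf (.load a c.1, c.2))
  | issue (l : Loc T D Reg Lab) (l' : Lab) (e₁ e₂ : Expr FUN Reg) (a v : D) :
      P.At t l.pc ⟨l.pc, .store e₁ e₂, l'⟩ → a = e₁.eval l.reg → v = e₂.eval l.reg →
      LStep P t l ⟨⟨⟨t, .issue⟩, some ⟨l.pc, .store e₁ e₂, l'⟩⟩, l.cnt, l.cnt, .silent⟩
        (l.advance l' l.reg (l.buf ++ [(l.cnt, a, v)]) (.issue, none))
  | loc (l : Loc T D Reg Lab) (l' : Lab) (i : Instr FUN Reg) (ρ : Reg → D) :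
      P.At t l.pc ⟨l.pc, i, l'⟩ → LocalEffect l.buf l.reg i ρ →
      LStep P t l ⟨⟨⟨t, .loc⟩, some ⟨l.pc, i, l'⟩⟩, l.cnt, l.cnt, .silent⟩
        (l.advance l' ρ l.buf (.loc, none))
  -- The overwritten cell is part of the access because its node becomes the predecessor in the
  -- store order. The node of the issue is relabelled; no fresh node is used.
  | store (l : Loc T D Reg Lab) (k : ℕ) (a v : D) (β : List (ℕ × D × D)) (c : Cell T D) :
      l.buf = (k, a, v) :: β →
      LStep P t l ⟨⟨⟨t, .store a v⟩, none⟩, k, l.cnt, .write a c (v, some (t, k))⟩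
        { l with buf := β, nodes := Function.update l.nodes k (some (.store a v, c.2)) }

open Classical in
/-- The effect of an access on the memory. -/
inductive MStep : (D → Cell T D) → Acc T D → (D → Cell T D) → Prop
  | silent (m : D → Cell T D) : MStep m .silent m
  | read (m : D → Cell T D) (a : D) : MStep m (.read a (m a)) m
  | write (m : D → Cell T D) (a : D) (c : Cell T D) :
      MStep m (.write a (m a) c) (Function.update m a c)

/-- The steps of the machine. -/
structure XStep (P : Program T FUN Reg Lab) [Zero D] (σ : XState T D Reg Lab)
    (x : AEvent T FUN Reg Lab) (σ' : XState T D Reg Lab) : Prop where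
  local_step : LStep P x.th (σ.loc x.th) x (σ'.loc x.th)
  mem_step : MStep σ.mem x.acc σ'.mem
  other : ∀ t, t ≠ x.th → σ'.loc t = σ.loc t

/-- Finite sequences of steps. -/
inductive XRun (P : Program T FUN Reg Lab) [Zero D] :
    XState T D Reg Lab → List (AEvent T FUN Reg Lab) → XState T D Reg Lab → Prop
  | nil (σ : XState T D Reg Lab) : XRun P σ [] σ
  | cons {σ σ' σ'' : XState T D Reg Lab} {x : AEvent T FUN Reg Lab}
      {l : List (AEvent T FUN Reg Lab)} :
      XStep P σ x σ' → XRun P σ' l σ'' → XRun P σ (x :: l) σ''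

/-- The initial state. -/
def xInit (P : Program T FUN Reg Lab) [Zero D] : XState T D Reg Lab where
  loc := fun t => ⟨(P.thread t).init, fun _ => 0, [], 0, fun _ => none⟩
  mem := fun _ => (0, none)

/-- The recorded trace. -/
def XState.trace (σ : XState T D Reg Lab) : Trace T D where
  label := fun m => (σ.node m).map fun p => ⟨m.1, p.1⟩
  po := fun m n => m.1 = n.1 ∧ n.2 = m.2 + 1 ∧ σ.node n ≠ none
  st := fun m n => ∃ a v, σ.node n = some (.store a v, some m)
  src := fun m n => ∃ a v, σ.node n = some (.load a v, some m)

/-- The invariant of a single thread. -/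
structure Loc.Inv (l : Loc T D Reg Lab) : Prop where
  none_iff : ∀ k, l.nodes k = none ↔ l.cnt ≤ k
  issue_iff : ∀ k, (∃ o, l.nodes k = some (.issue, o)) ↔ ∃ p ∈ l.buf, p.1 = k
  sorted : l.buf.Pairwise (fun p q => p.1 < q.1)

theorem Loc.Inv.lt_cnt {l : Loc T D Reg Lab} (h : l.Inv) {p : ℕ × D × D} (hp : p ∈ l.buf) :
    p.1 < l.cnt := by
  obtain ⟨o, ho⟩ := (h.issue_iff p.1).2 ⟨p, hp, rfl⟩
  by_contra hc
  rw [(h.none_iff p.1).2 (by omega)] at ho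
  cases ho

theorem Loc.Inv.advance {l : Loc T D Reg Lab} (h : l.Inv) (pc : Lab) (reg : Reg → D)
    (nd : ActKind D × Option (T × ℕ)) (hnd : nd.1 ≠ .issue) :
    (l.advance pc reg l.buf nd).Inv := by
  refine ⟨fun k => ?_, fun k => ?_, h.sorted⟩
  · have := h.none_iff k
    simp only [Loc.advance, Function.update_apply]
    split_ifs with hk
    · simp; omega
    · rw [this]; omega
  · have := h.issue_iff k
    simp only [Loc.advance, Function.update_apply]
    split_ifs with hk
    · constructor
      · rintro ⟨o, ho⟩
        simp only [Option.some.injEq] at ho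
        rw [ho] at hnd
        exact absurd rfl hnd
      · rintro ⟨p, hp, rfl⟩
        have := h.lt_cnt hp
        omega
    · exact this

variable [Zero D] {P : Program T FUN Reg Lab}

theorem xRun_append {σ σ'' : XState T D Reg Lab} {l₁ l₂ : List (AEvent T FUN Reg Lab)} :
    XRun P σ (l₁ ++ l₂) σ'' ↔ ∃ σ', XRun P σ l₁ σ' ∧ XRun P σ' l₂ σ'' := by
  induction l₁ generalizing σ with
  | nil =>
    constructor
    · intro h; exact ⟨σ, .nil _, h⟩
    · rintro ⟨σ', h, h'⟩; cases h; exact h'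
  | cons x l ih =>
    constructor
    · intro h
      cases h with
      | cons h1 h2 =>
        obtain ⟨σ', h3, h4⟩ := ih.1 h2
        exact ⟨σ', .cons h1 h3, h4⟩
    · rintro ⟨σ', h, h'⟩
      cases h with
      | cons h1 h2 => exact .cons h1 (ih.2 ⟨_, h2, h'⟩)

theorem xRun_cons {σ σ'' : XState T D Reg Lab} {x : AEvent T FUN Reg Lab}
    {l : List (AEvent T FUN Reg Lab)} :
    XRun P σ (x :: l) σ'' ↔ ∃ σ', XStep P σ x σ' ∧ XRun P σ' l σ'' := by
  constructor
  · intro h; cases h with | cons h1 h2 => exact ⟨_, h1, h2⟩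
  · rintro ⟨σ', h, h'⟩; exact .cons h h'

theorem xRun_nil {σ σ' : XState T D Reg Lab} :
    XRun P σ ([] : List (AEvent T FUN Reg Lab)) σ' ↔ σ = σ' := by
  constructor
  · intro h; cases h; rfl
  · rintro rfl; exact .nil _

theorem xRun_singleton {σ σ' : XState T D Reg Lab} {x : AEvent T FUN Reg Lab} :
    XRun P σ [x] σ' ↔ XStep P σ x σ' := by
  simp [xRun_cons, xRun_nil]

/-! ### Basic properties of steps -/

theorem LStep.node_eq_nxt {t : T} {l l' : Loc T D Reg Lab} {x : AEvent T FUN Reg Lab}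
    (h : LStep P t l x l') (hx : ¬ x.IsStore) : x.node = x.nxt := by
  cases h <;> first | rfl | exact absurd ⟨_, _, rfl⟩ hx

theorem LStep.nxt_eq {t : T} {l l' : Loc T D Reg Lab} {x : AEvent T FUN Reg Lab}
    (h : LStep P t l x l') : x.nxt = l.cnt := by
  cases h <;> rfl

theorem LStep.th_eq {t : T} {l l' : Loc T D Reg Lab} {x : AEvent T FUN Reg Lab}
    (h : LStep P t l x l') : x.th = t := by
  cases h <;> rfl

theorem LStep.cnt_of_not_store {t : T} {l l' : Loc T D Reg Lab} {x : AEvent T FUN Reg Lab}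
    (h : LStep P t l x l') (hx : ¬ x.IsStore) : l'.cnt = l.cnt + 1 := by
  cases h <;> first | rfl | exact absurd ⟨_, _, rfl⟩ hx

theorem LStep.exists_nodes {t : T} {l l' : Loc T D Reg Lab} {x : AEvent T FUN Reg Lab}
    (h : LStep P t l x l') :
    ∃ o, l'.nodes x.node = some (x.ev.act.kind, o) ∧ ∀ k, k ≠ x.node → l'.nodes k = l.nodes k := by
  cases h <;> simp +contextual [Loc.advance, Function.update_of_ne]

theorem LStep.inv {t : T} {l l' : Loc T D Reg Lab} {x : AEvent T FUN Reg Lab}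
    (h : LStep P t l x l') (hl : l.Inv) : l'.Inv := by
  cases h with
  | loadBuffer => exact hl.advance _ _ _ (by simp)
  | loadMemory => exact hl.advance _ _ _ (by simp)
  | loc => exact hl.advance _ _ _ (by simp)
  | issue =>
    refine ⟨fun k => ?_, fun k => ?_, ?_⟩
    · have := hl.none_iff k
      simp only [Loc.advance, Function.update_apply]
      split_ifs with hk
      · simp; omega
      · rw [this]; omega
    · have := hl.issue_iff k
      simp only [Loc.advance, Function.update_apply]
      split_ifs with hk
      · simp [hk]
      · rw [this]
        simp only [List.mem_append, List.mem_singleton]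
        constructor
        · rintro ⟨p, hp, rfl⟩; exact ⟨p, .inl hp, rfl⟩
        · rintro ⟨p, hp | rfl, rfl⟩
          · exact ⟨p, hp, rfl⟩
          · exact absurd rfl hk
    · simp only [Loc.advance, List.pairwise_append, List.pairwise_singleton, List.mem_singleton]
      refine ⟨hl.sorted, trivial, ?_⟩
      rintro p hp _ rfl
      exact hl.lt_cnt hp
  | store k a v β c hb =>
    have hs := hl.sorted
    rw [hb, List.pairwise_cons] at hs
    have hlt : k < l.cnt := hl.lt_cnt (p := (k, a, v)) (by simp [hb])
    refine ⟨fun j => ?_, fun j => ?_, hs.2⟩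
    · have := hl.none_iff j
      simp only [Function.update_apply]
      split_ifs with hk
      · simp; omega
      · exact this
    · have := hl.issue_iff j
      simp only [Function.update_apply]
      split_ifs with hk
      · simp only [Option.some.injEq, Prod.mk.injEq, reduceCtorEq, false_and, exists_false,
          false_iff]
        rintro ⟨p, hp, rfl⟩
        have := hs.1 p hp
        omega
      · rw [this, hb]
        simp only [List.mem_cons]
        constructor
        · rintro ⟨p, rfl | hp, rfl⟩
          · exact absurd rfl hk
          · exact ⟨p, hp, rfl⟩
        · rintro ⟨p, hp, rfl⟩; exact ⟨p, .inr hp, rfl⟩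

theorem xInit_inv (t : T) : ((xInit P).loc t).Inv :=
  ⟨by simp [xInit], by simp [xInit], by simp [xInit]⟩

theorem XStep.inv {σ σ' : XState T D Reg Lab} {x : AEvent T FUN Reg Lab} (h : XStep P σ x σ')
    (hσ : ∀ t, (σ.loc t).Inv) (t : T) : (σ'.loc t).Inv := by
  by_cases ht : t = x.th
  · subst ht; exact h.local_step.inv (hσ _)
  · rw [h.other t ht]; exact hσ t

theorem XRun.inv {σ σ' : XState T D Reg Lab} {l : List (AEvent T FUN Reg Lab)}
    (h : XRun P σ l σ') (hσ : ∀ t, (σ.loc t).Inv) (t : T) : (σ'.loc t).Inv := by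
  induction h with
  | nil => exact hσ t
  | cons h1 _ ih => exact ih fun t => h1.inv hσ t

end Machine

end TSORobust

namespace TSORobust

/-! ### Consistency of the recorded nodes with buffers and memory -/

section Recording

variable {T D Reg Lab : Type*} {FUN : Set (DataFun D)}

/-- The invariant that relates the recorded nodes, the buffers and the memory. -/
structure XState.Inv (σ : XState T D Reg Lab) : Prop where
  loc : ∀ t, (σ.loc t).Inv
  cell_some : ∀ a v m, σ.mem a = (v, some m) → ∃ o, σ.node m = some (.store a v, o)
  cell_max : ∀ a v m, σ.mem a = (v, some m) → ∀ n b u, σ.node n ≠ some (.store b u, some m)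
  cell_none : ∀ a v, σ.mem a = (v, none) → ∀ n u o, σ.node n ≠ some (.store a u, o)
  store_cover : ∀ a v m o, σ.node m = some (.store a v, o) →
    (σ.mem a).2 = some m ∨ ∃ n u, σ.node n = some (.store a u, some m)
  store_pred : ∀ a v m n, σ.node n = some (.store a v, some m) →
    ∃ u o, σ.node m = some (.store a u, o)
  load_src : ∀ a v m n, σ.node n = some (.load a v, some m) →
    (∃ o, σ.node m = some (.store a v, o)) ∨
      (m.1 = n.1 ∧ m.2 < n.2 ∧ (m.2, a, v) ∈ (σ.loc n.1).buf)
  -- This identifies the sources of early reads. `Trace.extend` recognises them by address and value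
  -- only, so an older store with the same value may claim a load first; the field says that the
  -- true source is then still buffered.
  early : ∀ t k a u k' v o, (k, a, u) ∈ (σ.loc t).buf → k < k' →
    (σ.loc t).nodes k' = some (.load a v, o) →
    ∃ j, k ≤ j ∧ o = some (t, j) ∧ (j, a, v) ∈ (σ.loc t).buf

/-- Buffers are sorted by node number, so the last matching entry is the newest one. -/
theorem filter_eq_append_singleton {l : List (ℕ × D × D)} {p : ℕ × D × D → Bool}
    {β : List (ℕ × D × D)} {x : ℕ × D × D} (hl : l.Pairwise (fun p q => p.1 < q.1))
    (h : l.filter p = β ++ [x]) :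
    x ∈ l ∧ p x = true ∧ ∀ y ∈ l, p y = true → y.1 ≤ x.1 := by
  have hx : x ∈ l.filter p := by simp [h]
  rw [List.mem_filter] at hx
  refine ⟨hx.1, hx.2, fun y hy hpy => ?_⟩
  have hy' : y ∈ l.filter p := List.mem_filter.2 ⟨hy, hpy⟩
  have hs := hl.filter p
  rw [h, List.pairwise_append] at hs
  rw [h] at hy'
  simp only [List.mem_append, List.mem_singleton] at hy'
  rcases hy' with hy' | rfl
  · exact (hs.2.2 y hy' x (by simp)).le
  · exact le_rfl

variable [Zero D] {P : Program T FUN Reg Lab}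

theorem XStep.node_self {σ σ' : XState T D Reg Lab} {x : AEvent T FUN Reg Lab}
    (h : XStep P σ x σ') : ∃ o, σ'.node x.nd = some (x.ev.act.kind, o) := by
  obtain ⟨o, ho, -⟩ := h.local_step.exists_nodes
  exact ⟨o, ho⟩

theorem XStep.node_of_ne {σ σ' : XState T D Reg Lab} {x : AEvent T FUN Reg Lab}
    (h : XStep P σ x σ') {m : T × ℕ} (hm : m ≠ x.nd) : σ'.node m = σ.node m := by
  obtain ⟨o, -, ho⟩ := h.local_step.exists_nodes
  by_cases ht : m.1 = x.th
  · have : m.2 ≠ x.node := fun hk => hm (Prod.ext ht hk)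
    simp only [XState.node, ht]
    exact ho _ this
  · simp only [XState.node, h.other _ ht]

theorem xInit_xinv : (xInit P).Inv where
  loc := xInit_inv
  cell_some := by simp [xInit]
  cell_max := by simp [xInit]
  cell_none := by simp [xInit, XState.node]
  store_cover := by simp [xInit, XState.node]
  store_pred := by simp [xInit, XState.node]
  load_src := by simp [xInit, XState.node]
  early := by simp [xInit]

/-- The invariant is preserved if a fresh node is added that is not a load. -/
theorem XState.Inv.fresh {σ σ' : XState T D Reg Lab} {x : AEvent T FUN Reg Lab}
    (h : XStep P σ x σ') (hσ : σ.Inv) (hm : σ'.mem = σ.mem) (hx : ¬ x.IsStore)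
    (hb : ∀ p ∈ (σ.loc x.th).buf, p ∈ (σ'.loc x.th).buf)
    (hb' : ∀ p ∈ (σ'.loc x.th).buf, p ∈ (σ.loc x.th).buf ∨ p.1 = (σ.loc x.th).cnt)
    (hl : ∀ a v o, σ'.node x.nd = some (.load a v, o) →
      (∀ m, o = some m → (∃ o', σ.node m = some (.store a v, o')) ∨
        (m.1 = x.th ∧ (m.2, a, v) ∈ (σ.loc x.th).buf)) ∧
      (∀ k u, (k, a, u) ∈ (σ.loc x.th).buf →
        ∃ j, k ≤ j ∧ o = some (x.th, j) ∧ (j, a, v) ∈ (σ.loc x.th).buf)) : σ'.Inv := by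
  have hnode : x.node = (σ.loc x.th).cnt := by
    rw [← h.local_step.nxt_eq, h.local_step.node_eq_nxt hx]
  have hnone : σ.node x.nd = none := ((hσ.loc _).none_iff _).2 hnode.ge
  have hself : ∀ a v o, σ'.node x.nd ≠ some (.store a v, o) := by
    intro a v o ho
    obtain ⟨o', ho'⟩ := h.node_self
    rw [ho'] at ho
    simp only [Option.some.injEq, Prod.mk.injEq] at ho
    exact hx ⟨a, v, ho.1⟩
  have hold : ∀ m r, σ.node m = some r → σ'.node m = some r := by
    intro m r hmr
    rw [h.node_of_ne, hmr]
    rintro rfl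
    rw [hnone] at hmr; cases hmr
  have hst : ∀ m a v o, σ'.node m = some (.store a v, o) ↔ σ.node m = some (.store a v, o) := by
    intro m a v o
    refine ⟨fun hmr => ?_, hold m _⟩
    rw [h.node_of_ne] at hmr
    · exact hmr
    · rintro rfl; exact hself _ _ _ hmr
  have hbuf : ∀ t, ∀ p ∈ (σ.loc t).buf, p ∈ (σ'.loc t).buf := by
    intro t p hp
    by_cases ht : t = x.th
    · subst ht; exact hb p hp
    · rw [h.other t ht]; exact hp
  refine ⟨h.inv hσ.loc, ?_, ?_, ?_, ?_, ?_, ?_, ?_⟩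
  · intro a v m hc
    rw [hm] at hc
    obtain ⟨o, ho⟩ := hσ.cell_some a v m hc
    exact ⟨o, hold _ _ ho⟩
  · intro a v m hc n b u
    rw [hm] at hc
    rw [ne_eq, hst]
    exact hσ.cell_max a v m hc n b u
  · intro a v hc n u o
    rw [hm] at hc
    rw [ne_eq, hst]
    exact hσ.cell_none a v hc n u o
  · intro a v m o hmr
    rw [hst] at hmr
    rw [hm]
    rcases hσ.store_cover a v m o hmr with hc | ⟨n, u, hn⟩
    · exact .inl hc
    · exact .inr ⟨n, u, hold _ _ hn⟩
  · intro a v m n hmn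
    rw [hst] at hmn
    obtain ⟨u, o, hu⟩ := hσ.store_pred a v m n hmn
    exact ⟨u, o, hold _ _ hu⟩
  · intro a v m n hmn
    by_cases hn : n = x.nd
    · subst hn
      rcases (hl a v _ hmn).1 m rfl with ⟨o, ho⟩ | ⟨h1, h2⟩
      · exact .inl ⟨o, hold _ _ ho⟩
      · refine .inr ⟨h1, ?_, hb _ h2⟩
        have := (hσ.loc x.th).lt_cnt h2
        simp only at this ⊢
        omega
    · rw [h.node_of_ne hn] at hmn
      rcases hσ.load_src a v m n hmn with ⟨o, ho⟩ | ⟨h1, h2, h3⟩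
      · exact .inl ⟨o, hold _ _ ho⟩
      · exact .inr ⟨h1, h2, hbuf _ _ h3⟩
  · intro t k a u k' v o hk hlt hk'
    have hk'n : σ'.node (t, k') = some (.load a v, o) := hk'
    by_cases hn : (t, k') = x.nd
    · obtain ⟨rfl, rfl⟩ := Prod.mk.inj hn
      have hk0 : (k, a, u) ∈ (σ.loc x.th).buf := by
        rcases hb' _ hk with h1 | h1
        · exact h1
        · simp only at h1; omega
      obtain ⟨j, h1, h2, h3⟩ := (hl a v o hk').2 k u hk0
      exact ⟨j, h1, h2, hb _ h3⟩
    · rw [h.node_of_ne hn] at hk'n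
      have hk0 : (k, a, u) ∈ (σ.loc t).buf := by
        by_cases ht : t = x.th
        · subst ht
          rcases hb' _ hk with h1 | h1
          · exact h1
          · simp only at h1
            have h2 : (σ.loc x.th).nodes k' = none := ((hσ.loc x.th).none_iff k').2 (by omega)
            rw [XState.node] at hk'n
            simp only at hk'n
            rw [h2] at hk'n; cases hk'n
        · rw [h.other t ht] at hk; exact hk
      obtain ⟨j, h1, h2, h3⟩ := hσ.early t k a u k' v o hk0 hlt hk'n
      exact ⟨j, h1, h2, hbuf _ _ h3⟩

/-- Before the step the node carries the label of an issue, so no cell and no store refers to it. It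
becomes the maximum of the store order of `a`, with the former maximum as predecessor, and the loads
that read it early now have a proper store as source. -/
theorem XStep.xinv_of_store {σ σ' : XState T D Reg Lab} {x : AEvent T FUN Reg Lab}
    (h : XStep P σ x σ') (hσ : σ.Inv) {a v : D} {β : List (ℕ × D × D)}
    (hb : (σ.loc x.th).buf = (x.node, a, v) :: β) (hb' : (σ'.loc x.th).buf = β)
    (hm : ∀ b, b ≠ a → σ'.mem b = σ.mem b) (hma : σ'.mem a = (v, some x.nd))
    (hn : σ'.node x.nd = some (.store a v, (σ.mem a).2)) : σ'.Inv := by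
  have hissue : ∃ o, σ.node x.nd = some (.issue, o) :=
    ((hσ.loc x.th).issue_iff x.node).2 ⟨(x.node, a, v), by simp [hb], rfl⟩
  have hold : ∀ m k o, k ≠ .issue → σ.node m = some (k, o) → σ'.node m = some (k, o) := by
    intro m k o hk hmr
    rw [h.node_of_ne, hmr]
    rintro rfl
    obtain ⟨o', ho'⟩ := hissue
    rw [ho'] at hmr
    simp only [Option.some.injEq, Prod.mk.injEq] at hmr
    exact hk hmr.1.symm
  have hsorted := (hσ.loc x.th).sorted
  rw [hb, List.pairwise_cons] at hsorted
  have hbuf : ∀ t, ∀ p ∈ (σ'.loc t).buf, p ∈ (σ.loc t).buf := by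
    intro t p hp
    by_cases ht : t = x.th
    · subst ht; rw [hb, ← hb']; exact List.mem_cons_of_mem _ hp
    · rw [← h.other t ht]; exact hp
  have hbufne : ∀ t, ∀ p ∈ (σ.loc t).buf, (t, p.1) ≠ x.nd → p ∈ (σ'.loc t).buf := by
    intro t p hp hne
    by_cases ht : t = x.th
    · subst ht
      rw [hb, List.mem_cons] at hp
      rw [hb']
      rcases hp with rfl | hp
      · exact absurd rfl hne
      · exact hp
    · rw [h.other t ht]; exact hp
  refine ⟨h.inv hσ.loc, ?_, ?_, ?_, ?_, ?_, ?_, ?_⟩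
  · intro b u m hc
    by_cases hba : b = a
    · subst hba
      rw [hma] at hc
      simp only [Prod.mk.injEq, Option.some.injEq] at hc
      obtain ⟨rfl, rfl⟩ := hc
      exact ⟨_, hn⟩
    · rw [hm b hba] at hc
      obtain ⟨o, ho⟩ := hσ.cell_some b u m hc
      exact ⟨o, hold _ _ _ (by simp) ho⟩
  · intro b u m hc n b' u' hcon
    by_cases hba : b = a
    · subst hba
      rw [hma] at hc
      simp only [Prod.mk.injEq, Option.some.injEq] at hc
      obtain ⟨rfl, rfl⟩ := hc
      have key : ∀ o, σ.node x.nd ≠ some (.store b' o, none) := by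
        intro o ho; obtain ⟨o', ho'⟩ := hissue; rw [ho'] at ho; simp at ho
      by_cases hnx : n = x.nd
      · subst hnx
        rw [hn] at hcon
        simp only [Option.some.injEq, Prod.mk.injEq] at hcon
        obtain ⟨o, ho⟩ := hσ.cell_some b (σ.mem b).1 x.nd (Prod.ext rfl hcon.2)
        obtain ⟨o', ho'⟩ := hissue; rw [ho'] at ho; simp at ho
      · rw [h.node_of_ne hnx] at hcon
        obtain ⟨_, o, ho⟩ := hσ.store_pred _ _ _ _ hcon
        obtain ⟨o', ho'⟩ := hissue; rw [ho'] at ho; simp at ho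
    · rw [hm b hba] at hc
      by_cases hnx : n = x.nd
      · subst hnx
        rw [hn] at hcon
        simp only [Option.some.injEq, Prod.mk.injEq] at hcon
        obtain ⟨o, ho⟩ := hσ.cell_some a (σ.mem a).1 m (Prod.ext rfl hcon.2)
        obtain ⟨o', ho'⟩ := hσ.cell_some b u m hc
        rw [ho] at ho'
        simp only [Option.some.injEq, Prod.mk.injEq, ActKind.store.injEq] at ho'
        exact hba ho'.1.1.symm
      · rw [h.node_of_ne hnx] at hcon
        exact hσ.cell_max b u m hc n b' u' hcon
  · intro b u hc n u' o hcon
    by_cases hba : b = a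
    · subst hba; rw [hma] at hc; simp at hc
    · rw [hm b hba] at hc
      by_cases hnx : n = x.nd
      · subst hnx
        rw [hn] at hcon
        simp only [Option.some.injEq, Prod.mk.injEq, ActKind.store.injEq] at hcon
        exact hba hcon.1.1.symm
      · rw [h.node_of_ne hnx] at hcon
        exact hσ.cell_none b u hc n u' o hcon
  · intro b u m o hmr
    by_cases hnx : m = x.nd
    · subst hnx
      rw [hn] at hmr
      simp only [Option.some.injEq, Prod.mk.injEq, ActKind.store.injEq] at hmr
      obtain ⟨⟨rfl, rfl⟩, -⟩ := hmr
      exact .inl (by rw [hma])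
    · rw [h.node_of_ne hnx] at hmr
      rcases hσ.store_cover b u m o hmr with hc | ⟨n, u', hn'⟩
      · by_cases hba : b = a
        · subst hba
          exact .inr ⟨x.nd, v, by rw [hn, hc]⟩
        · exact .inl (by rw [hm b hba, hc])
      · exact .inr ⟨n, u', hold _ _ _ (by simp) hn'⟩
  · intro b u m n hmn
    by_cases hnx : n = x.nd
    · subst hnx
      rw [hn] at hmn
      simp only [Option.some.injEq, Prod.mk.injEq, ActKind.store.injEq] at hmn
      obtain ⟨⟨rfl, rfl⟩, hc⟩ := hmn
      obtain ⟨o, ho⟩ := hσ.cell_some a (σ.mem a).1 m (Prod.ext rfl hc)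
      exact ⟨_, o, hold _ _ _ (by simp) ho⟩
    · rw [h.node_of_ne hnx] at hmn
      obtain ⟨u', o, hu⟩ := hσ.store_pred b u m n hmn
      exact ⟨u', o, hold _ _ _ (by simp) hu⟩
  · intro b u m n hmn
    have hnx : n ≠ x.nd := by
      rintro rfl
      rw [hn] at hmn
      simp at hmn
    rw [h.node_of_ne hnx] at hmn
    rcases hσ.load_src b u m n hmn with ⟨o, ho⟩ | ⟨h1, h2, h3⟩
    · exact .inl ⟨o, hold _ _ _ (by simp) ho⟩
    · by_cases hmx : m = x.nd
      · subst hmx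
        simp only at h1
        rw [← h1, hb, List.mem_cons] at h3
        rcases h3 with h3 | h3
        · simp only [Prod.mk.injEq, true_and] at h3
          obtain ⟨rfl, rfl⟩ := h3
          exact .inl ⟨_, hn⟩
        · exact absurd (hsorted.1 _ h3) (by simp)
      · refine .inr ⟨h1, h2, hbufne _ _ h3 ?_⟩
        rw [← h1]; exact hmx
  · intro t k b u k' u' o hk hlt hk'
    have hk'n : σ'.node (t, k') = some (.load b u', o) := hk'
    have hnx : (t, k') ≠ x.nd := by
      intro hnx
      rw [hnx, hn] at hk'n
      simp at hk'n
    rw [h.node_of_ne hnx] at hk'n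
    obtain ⟨j, h1, h2, h3⟩ := hσ.early t k b u k' u' o (hbuf _ _ hk) hlt hk'n
    refine ⟨j, h1, h2, hbufne _ _ h3 ?_⟩
    intro hj
    obtain ⟨rfl, rfl⟩ := Prod.mk.inj hj
    rw [hb'] at hk
    have := hsorted.1 _ hk
    simp only at this
    omega

theorem XStep.xinv {σ σ' : XState T D Reg Lab} {x : AEvent T FUN Reg Lab}
    (h : XStep P σ x σ') (hσ : σ.Inv) : σ'.Inv := by
  obtain ⟨⟨⟨t, kd⟩, i⟩, k, nx, acc⟩ := x
  have hl : LStep P t (σ.loc t) _ (σ'.loc t) := h.local_step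
  have hm := h.mem_step
  generalize hloc : σ.loc t = l at hl
  generalize hloc' : σ'.loc t = l' at hl
  cases hl with
  | loadBuffer l' r e a v k β h1 h2 h3 =>
    have hmem : σ'.mem = σ.mem := by generalize σ'.mem = m' at hm ⊢; cases hm; rfl
    obtain ⟨hx1, hx2, hx3⟩ := filter_eq_append_singleton (by rw [← hloc]; exact (hσ.loc _).sorted) h3
    refine XState.Inv.fresh h hσ hmem (by rintro ⟨_, _, h⟩; cases h) ?_ ?_ ?_
    · rw [hloc, hloc']; exact fun p hp => hp
    · rw [hloc, hloc']; exact fun p hp => .inl hp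
    · intro b u o hn
      rw [XState.node, hloc', hloc] at *
      simp only [Loc.advance, Function.update_self, Option.some.injEq, Prod.mk.injEq,
        ActKind.load.injEq] at hn
      obtain ⟨⟨rfl, rfl⟩, rfl⟩ := hn
      refine ⟨?_, ?_⟩
      · rintro m hm'
        cases hm'
        exact .inr ⟨rfl, hx1⟩
      · intro k' u hk'
        exact ⟨k, hx3 _ hk' (by simp), rfl, hx1⟩
  | loadMemory l' r e a c h1 h2 h3 =>
    have hmem : σ'.mem = σ.mem ∧ c = σ.mem a := by
      generalize σ'.mem = m' at hm ⊢; cases hm; exact ⟨rfl, rfl⟩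
    refine XState.Inv.fresh h hσ hmem.1 (by rintro ⟨_, _, h⟩; cases h) ?_ ?_ ?_
    · rw [hloc, hloc']; exact fun p hp => hp
    · rw [hloc, hloc']; exact fun p hp => .inl hp
    · intro b u o hn
      rw [XState.node, hloc', hloc] at *
      simp only [Loc.advance, Function.update_self, Option.some.injEq, Prod.mk.injEq,
        ActKind.load.injEq] at hn
      obtain ⟨⟨rfl, rfl⟩, rfl⟩ := hn
      refine ⟨?_, ?_⟩
      · intro m hm'
        exact .inl (hσ.cell_some a c.1 m (by rw [← hmem.2, ← hm']))
      · intro k' u hk'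
        rw [List.filter_eq_nil_iff] at h3
        exact absurd (h3 _ hk') (by simp)
  | issue l' e₁ e₂ a v h1 h2 h3 =>
    have hmem : σ'.mem = σ.mem := by generalize σ'.mem = m' at hm ⊢; cases hm; rfl
    refine XState.Inv.fresh h hσ hmem (by rintro ⟨_, _, h⟩; cases h) ?_ ?_ ?_
    · rw [hloc, hloc']; intro p hp; simp [Loc.advance, hp]
    · rw [hloc, hloc']
      intro p hp
      simp only [Loc.advance, List.mem_append, List.mem_singleton] at hp
      rcases hp with hp | rfl
      · exact .inl hp
      · exact .inr rfl
    · intro b u o hn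
      rw [XState.node, hloc', hloc] at *
      simp [Loc.advance] at hn
  | loc l' i ρ h1 h2 =>
    have hmem : σ'.mem = σ.mem := by generalize σ'.mem = m' at hm ⊢; cases hm; rfl
    refine XState.Inv.fresh h hσ hmem (by rintro ⟨_, _, h⟩; cases h) ?_ ?_ ?_
    · rw [hloc, hloc']; exact fun p hp => hp
    · rw [hloc, hloc']; exact fun p hp => .inl hp
    · intro b u o hn
      rw [XState.node, hloc', hloc] at *
      simp [Loc.advance] at hn
  | store k a v β c h1 =>
    have hmem : c = σ.mem a ∧ (∀ b, b ≠ a → σ'.mem b = σ.mem b) ∧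
        σ'.mem a = (v, some (t, k)) := by
      generalize σ'.mem = m' at hm ⊢
      cases hm
      exact ⟨rfl, fun b hb => by simp [hb], by simp⟩
    refine h.xinv_of_store hσ (a := a) (v := v) (β := β) ?_ ?_ hmem.2.1 ?_ ?_
    · rw [hloc, h1]
    · rw [hloc']
    · rw [hmem.2.2]
    · rw [XState.node, hloc', ← hmem.1]
      simp

theorem XRun.xinv {σ σ' : XState T D Reg Lab} {l : List (AEvent T FUN Reg Lab)}
    (h : XRun P σ l σ') (hσ : σ.Inv) : σ'.Inv := by
  induction h with
  | nil => exact hσ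
  | cons h1 _ ih => exact ih (h1.xinv hσ)

end Recording

end TSORobust

namespace TSORobust

/-! ### The recorded trace is the trace of the word of actions -/

section Linking

variable {T D Reg Lab : Type*} {FUN : Set (DataFun D)}

/-- The trace `G` is the recorded trace, except for the sources of early reads from stores that are
still buffered. -/
structure XState.Matches (σ : XState T D Reg Lab) (G : Trace T D) : Prop where
  label : ∀ m, G.label m = (σ.node m).map fun p => ⟨m.1, p.1⟩
  po : ∀ m n, G.po m n ↔ m.1 = n.1 ∧ n.2 = m.2 + 1 ∧ σ.node n ≠ none
  st : ∀ m n, G.st m n ↔ ∃ a v, σ.node n = some (.store a v, some m)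
  src : ∀ a v o n, σ.node n = some (.load a v, o) →
    (∀ m o', o = some m → σ.node m ≠ some (.issue, o')) → ∀ m, G.src m n ↔ o = some m
  src_load : ∀ m n, G.src m n → ∃ a v o, σ.node n = some (.load a v, o)

/-- Edges join consecutive numbers, and the nodes of a thread are numbered without gaps. -/
theorem XState.Matches.transGen_po {σ : XState T D Reg Lab} {G : Trace T D} (h : σ.Matches G)
    (hσ : σ.Inv) {m n : T × ℕ} :
    Relation.TransGen G.po m n ↔ m.1 = n.1 ∧ m.2 < n.2 ∧ σ.node n ≠ none := by
  constructor
  · intro ht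
    induction ht with
    | single h1 => obtain ⟨h2, h3, h4⟩ := (h.po _ _).1 h1; exact ⟨h2, by omega, h4⟩
    | tail _ h1 ih =>
      obtain ⟨h2, h3, h4⟩ := (h.po _ _).1 h1
      exact ⟨ih.1.trans h2, by omega, h4⟩
  · obtain ⟨t, k⟩ := m
    obtain ⟨t', j⟩ := n
    rintro ⟨rfl, hlt, hn⟩
    simp only at hlt
    induction j, hlt using Nat.le_induction with
    | base => exact .single ((h.po _ _).2 ⟨rfl, rfl, hn⟩)
    | succ j hj ih =>
      refine .tail (ih ?_) ((h.po _ _).2 ⟨rfl, rfl, hn⟩)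
      intro h1
      apply hn
      have h2 := ((hσ.loc t).none_iff j).1 h1
      exact ((hσ.loc t).none_iff (j + 1)).2 (by omega)

theorem XState.Matches.fresh {σ : XState T D Reg Lab} {G : Trace T D} (h : σ.Matches G)
    (hσ : σ.Inv) (t : T) : G.fresh t = (t, (σ.loc t).cnt) := by
  have : {k | G.label (t, k) = none} = Set.Ici (σ.loc t).cnt := by
    ext k
    simp [h.label, (hσ.loc t).none_iff]
  rw [Trace.fresh, this, csInf_Ici]

theorem XState.Matches.isMaxSt {σ : XState T D Reg Lab} {G : Trace T D} (h : σ.Matches G)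
    (hσ : σ.Inv) {a : D} {m : T × ℕ} : G.IsMaxSt a m ↔ (σ.mem a).2 = some m := by
  constructor
  · rintro ⟨⟨t, v, h1⟩, h2⟩
    rw [h.label] at h1
    simp only [Option.map_eq_some_iff, Act.mk.injEq] at h1
    obtain ⟨⟨kd, o⟩, h3, -, h4⟩ := h1
    simp only at h4
    subst h4
    rcases hσ.store_cover a v m o h3 with h4 | ⟨n, u, h4⟩
    · exact h4
    · exact absurd ((h.st m n).2 ⟨_, _, h4⟩) (h2 n)
  · intro h1
    have h2 : σ.mem a = ((σ.mem a).1, some m) := Prod.ext rfl h1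
    obtain ⟨o, ho⟩ := hσ.cell_some _ _ _ h2
    refine ⟨⟨m.1, (σ.mem a).1, by simp [h.label, ho]⟩, fun n hn => ?_⟩
    obtain ⟨b, u, hb⟩ := (h.st m n).1 hn
    exact hσ.cell_max _ _ _ h2 n b u hb

theorem XState.Matches.isMaxPo {σ : XState T D Reg Lab} {G : Trace T D} (h : σ.Matches G)
    (hσ : σ.Inv) {t : T} {m : T × ℕ} :
    G.IsMaxPo t m ↔ m.1 = t ∧ m.2 + 1 = (σ.loc t).cnt := by
  obtain ⟨t', k⟩ := m
  constructor
  · rintro ⟨rfl, h1, h2⟩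
    refine ⟨rfl, ?_⟩
    have h3 : ¬ (σ.loc t').cnt ≤ k := by
      rw [← (hσ.loc t').none_iff]
      intro h4
      apply h1
      simp [h.label, h4]
    have h4 : (σ.loc t').cnt ≤ k + 1 := by
      rw [← (hσ.loc t').none_iff]
      by_contra h4
      exact h2 (t', k + 1) ((h.po _ _).2 ⟨rfl, rfl, h4⟩)
    simp only
    omega
  · rintro ⟨rfl, h1⟩
    simp only at h1 ⊢
    refine ⟨rfl, ?_, ?_⟩
    · have := (hσ.loc t').none_iff k
      simp only [h.label, ne_eq, Option.map_eq_none_iff]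
      rw [this]; omega
    · rintro ⟨t'', j⟩ h2
      obtain ⟨rfl, rfl, h3⟩ := (h.po _ _).1 h2
      exact h3 (((hσ.loc t').none_iff _).2 h1.ge)

theorem xInit_matches [Zero D] (P : Program T FUN Reg Lab) :
    (xInit P).Matches (Trace.empty : Trace T D) := by
  constructor <;> simp [xInit, Trace.empty, XState.node]

/-- `Matches` leaves open the sources of loads whose recorded source is still an issue; with empty
buffers there are no such loads. -/
theorem XState.Matches.eq_trace {σ : XState T D Reg Lab} {G : Trace T D} (h : σ.Matches G)
    (hσ : σ.Inv) (hf : σ.Flushed) : G = σ.trace := by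
  ext m n
  · rw [h.label]; rfl
  · exact h.po m n
  · exact h.st m n
  · constructor
    · intro h1
      obtain ⟨a, v, o, h2⟩ := h.src_load m n h1
      have h3 := (h.src a v o n h2 ?_ m).1 h1
      · subst h3; exact ⟨a, v, h2⟩
      · intro m' o' _ h3
        obtain ⟨p, hp, -⟩ := ((hσ.loc m'.1).issue_iff m'.2).1 ⟨o', h3⟩
        rw [hf] at hp; cases hp
    · rintro ⟨a, v, h2⟩
      refine (h.src a v _ n h2 ?_ m).2 rfl
      intro m' o' _ h3
      obtain ⟨p, hp, -⟩ := ((hσ.loc m'.1).issue_iff m'.2).1 ⟨o', h3⟩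
      rw [hf] at hp; cases hp

variable [Zero D] {P : Program T FUN Reg Lab}

theorem XStep.of_load {σ σ' : XState T D Reg Lab} {x : AEvent T FUN Reg Lab}
    (h : XStep P σ x σ') {a v : D} (hx : x.ev.act.kind = .load a v) :
    σ'.node x.nd = some (.load a v, (σ.mem a).2) ∨
      ∃ k, σ'.node x.nd = some (.load a v, some (x.th, k)) ∧ (k, a, v) ∈ (σ.loc x.th).buf := by
  obtain ⟨⟨⟨t, kd⟩, i⟩, k, nx, acc⟩ := x
  have hl : LStep P t (σ.loc t) _ (σ'.loc t) := h.local_step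
  have hm := h.mem_step
  generalize hloc : σ.loc t = l at hl
  generalize hloc' : σ'.loc t = l' at hl
  cases hl with
  | loadBuffer l' r e a v k β h1 h2 h3 =>
    cases hx
    refine .inr ⟨k, ?_, ?_⟩
    · simp [XState.node, hloc', Loc.advance]
    · have : (k, a, v) ∈ β ++ [(k, a, v)] := by simp
      rw [← h3] at this
      exact (List.mem_filter.1 this).1
  | loadMemory l' r e a c h1 h2 h3 =>
    cases hx
    refine .inl ?_
    generalize σ'.mem = m' at hm
    cases hm
    simp [XState.node, hloc', Loc.advance]
  | issue => cases hx
  | loc => cases hx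
  | store => cases hx

theorem XStep.of_store {σ σ' : XState T D Reg Lab} {x : AEvent T FUN Reg Lab}
    (h : XStep P σ x σ') {a v : D} (hx : x.ev.act.kind = .store a v) :
    (σ.loc x.th).buf = (x.node, a, v) :: (σ'.loc x.th).buf ∧
      σ'.node x.nd = some (.store a v, (σ.mem a).2) ∧
      x.acc = .write a (σ.mem a) (v, some x.nd) := by
  obtain ⟨⟨⟨t, kd⟩, i⟩, k, nx, acc⟩ := x
  have hl : LStep P t (σ.loc t) _ (σ'.loc t) := h.local_step
  have hm := h.mem_step
  generalize hloc : σ.loc t = l at hl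
  generalize hloc' : σ'.loc t = l' at hl
  cases hl with
  | loadBuffer => cases hx
  | loadMemory => cases hx
  | issue => cases hx
  | loc => cases hx
  | store k a v β c h1 =>
    cases hx
    generalize σ'.mem = m' at hm
    cases hm
    refine ⟨?_, ?_, rfl⟩
    · exact h1
    · simp [XState.node, hloc']

/-- The nodes labelled as issues are exactly the buffered entries, and the buffer is sorted by node
number, so the first issue in program order is the head of the buffer. -/
theorem XState.Matches.isNodeOf {σ σ' : XState T D Reg Lab} {G : Trace T D} (h : σ.Matches G)
    (hσ : σ.Inv) {x : AEvent T FUN Reg Lab} (hs : XStep P σ x σ') {n : T × ℕ} :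
    G.IsNodeOf x.ev.act n ↔ n = x.nd := by
  by_cases hx : x.IsStore
  · have hx' := hx
    obtain ⟨a, v, hk⟩ := hx
    obtain ⟨hb, -⟩ := hs.of_store hk
    have hiss : ∀ m : T × ℕ, G.label m = some ⟨x.th, .issue⟩ ↔
        m.1 = x.th ∧ ∃ p ∈ (σ.loc x.th).buf, p.1 = m.2 := by
      intro m
      rw [h.label]
      simp only [Option.map_eq_some_iff, Act.mk.injEq]
      constructor
      · rintro ⟨⟨kd, o⟩, h1, h2, h3⟩
        simp only at h3
        subst h3
        refine ⟨h2, ?_⟩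
        rw [← (hσ.loc x.th).issue_iff]
        rw [XState.node, h2] at h1
        exact ⟨o, h1⟩
      · rintro ⟨h1, h2⟩
        rw [← (hσ.loc x.th).issue_iff] at h2
        obtain ⟨o, ho⟩ := h2
        exact ⟨_, by rw [XState.node, h1]; exact ho, h1, rfl⟩
    have hsort := (hσ.loc x.th).sorted
    rw [hb, List.pairwise_cons] at hsort
    simp only [Trace.IsNodeOf, hx', true_and, not_true, false_and, or_false, Trace.IsFirstIssue]
    constructor
    · rintro ⟨h1, h2⟩
      obtain ⟨h3, p, hp, h4⟩ := (hiss n).1 h1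
      rw [hb, List.mem_cons] at hp
      rcases hp with rfl | hp
      · exact Prod.ext h3 h4.symm
      · exfalso
        refine h2 x.nd ((hiss _).2 ⟨rfl, _, by rw [hb]; exact List.mem_cons_self, rfl⟩) ?_
        rw [h.transGen_po hσ]
        refine ⟨h3.symm, ?_, ?_⟩
        · have := hsort.1 p hp
          simp only at this ⊢
          omega
        · intro hn
          rw [h.label, hn] at h1; cases h1
    · rintro rfl
      refine ⟨(hiss _).2 ⟨rfl, _, by rw [hb]; exact List.mem_cons_self, rfl⟩, ?_⟩
      intro m hm
      rw [h.transGen_po hσ]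
      rintro ⟨-, hlt, -⟩
      obtain ⟨h3, p, hp, h4⟩ := (hiss m).1 hm
      rw [hb, List.mem_cons] at hp
      rcases hp with rfl | hp
      · simp only at h4 hlt; omega
      · have := hsort.1 p hp
        simp only at this hlt
        omega
  · have hx' : ¬ x.ev.act.IsStore := hx
    simp only [Trace.IsNodeOf, hx', false_and, false_or, not_false_eq_true, true_and, h.fresh hσ]
    rw [AEvent.nd, hs.local_step.node_eq_nxt hx, hs.local_step.nxt_eq]

/-- The delicate point is the source relation under a store. `Trace.extend` redirects to it all
later loads of the thread with its address and value. By `XState.Inv.early` the recorded source of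
such a load is a buffered entry that is not older: either the store itself, or an entry that remains
pending, for which `Matches` claims nothing. -/
theorem XStep.matches {σ σ' : XState T D Reg Lab} {G : Trace T D} {x : AEvent T FUN Reg Lab}
    (hs : XStep P σ x σ') (hσ : σ.Inv) (h : σ.Matches G) : σ'.Matches (G.extend x.ev.act) := by
  obtain ⟨o, hself⟩ := hs.node_self
  have hne : ∀ m, m ≠ x.nd → σ'.node m = σ.node m := fun m hm => hs.node_of_ne hm
  have hnode : ∀ n, G.IsNodeOf x.ev.act n ↔ n = x.nd := fun n => h.isNodeOf hσ hs
  have hlabel : ∀ m, (G.extend x.ev.act).label m = (σ'.node m).map fun p => ⟨m.1, p.1⟩ := by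
    intro m
    simp only [Trace.extend]
    split_ifs with hm
    · rw [hnode] at hm; subst hm; rw [hself]; rfl
    · rw [hnode] at hm; rw [h.label, hne m hm]
  by_cases hx : x.IsStore
  · obtain ⟨a, v, hk⟩ := hx
    have hx : x.ev.act.IsStore := ⟨a, v, hk⟩
    obtain ⟨hb, hn, -⟩ := hs.of_store hk
    have hiss : ∃ o, σ.node x.nd = some (.issue, o) :=
      ((hσ.loc x.th).issue_iff x.node).2 ⟨_, by rw [hb]; exact List.mem_cons_self, rfl⟩
    have hnone : ∀ m, σ'.node m ≠ none ↔ σ.node m ≠ none := by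
      intro m
      by_cases hm : m = x.nd
      · subst hm; obtain ⟨o, ho⟩ := hiss; simp [hself, ho]
      · rw [hne m hm]
    have hload : ∀ b u o m, σ'.node m = some (.load b u, o) ↔ σ.node m = some (.load b u, o) := by
      intro b u o m
      by_cases hm : m = x.nd
      · subst hm; obtain ⟨o, ho⟩ := hiss; simp [hn, ho]
      · rw [hne m hm]
    have hearly : ∀ n, G.IsEarlyRead x.ev.act n ↔
        n.1 = x.th ∧ x.node < n.2 ∧ ∃ o, σ.node n = some (.load a v, o) := by
      intro n
      simp only [Trace.IsEarlyRead, hk, hnode, exists_eq_left, h.transGen_po hσ, h.label,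
        ActKind.store.injEq, Option.map_eq_some_iff, Act.mk.injEq]
      constructor
      · rintro ⟨b, u, ⟨rfl, rfl⟩, ⟨⟨kd, o⟩, h1, h2, h3⟩, -, h4, -⟩
        simp only at h3
        subst h3
        exact ⟨h2, h4, o, h1⟩
      · rintro ⟨h1, h2, o, h3⟩
        exact ⟨a, v, ⟨rfl, rfl⟩, ⟨_, h3, h1, rfl⟩, h1.symm, h2, by simp [h3]⟩
    refine ⟨hlabel, ?_, ?_, ?_, ?_⟩
    · intro m n
      simp only [Trace.extend, hx, not_true, false_and, or_false, h.po, hnone]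
    · intro m n
      simp only [Trace.extend, hk, hnode, h.st, h.isMaxSt hσ, ActKind.store.injEq]
      by_cases hnx : n = x.nd
      · subst hnx
        obtain ⟨o, ho⟩ := hiss
        simp only [ho, hn, Option.some.injEq, Prod.mk.injEq, ActKind.store.injEq, reduceCtorEq,
          false_and, exists_false, false_or, and_true]
        constructor <;> (rintro ⟨_, _, ⟨rfl, rfl⟩, h1⟩; exact ⟨_, _, ⟨rfl, rfl⟩, h1⟩)
      · simp [hnx, hne n hnx]
    · intro b u o n hnl hpend m
      have hnl' := (hload _ _ _ _).1 hnl
      by_cases he : G.IsEarlyRead x.ev.act n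
      · simp only [Trace.extend, he, if_true, hnode]
        obtain ⟨h1, h2, o', h3⟩ := (hearly n).1 he
        rw [hnl'] at h3
        simp only [Option.some.injEq, Prod.mk.injEq, ActKind.load.injEq] at h3
        obtain ⟨⟨rfl, rfl⟩, -⟩ := h3
        obtain ⟨j, hj1, rfl, hj2⟩ := hσ.early x.th x.node b u n.2 u o
          (by rw [hb]; exact List.mem_cons_self) h2 (by rw [XState.node, h1] at hnl'; exact hnl')
        by_cases hj : (x.th, j) = x.nd
        · rw [hj]; simp [eq_comm]
        · exfalso
          obtain ⟨o, ho⟩ := ((hσ.loc x.th).issue_iff j).2 ⟨_, hj2, rfl⟩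
          exact hpend _ o rfl (by rw [hne _ hj]; exact ho)
      · simp only [Trace.extend, he, if_false, hk, reduceCtorEq, false_and, exists_false, or_false]
        refine h.src b u o n hnl' (fun m' o' hm' hp => ?_) m
        -- A load with the executed store as recorded source would have been redirected, so the
        -- source of this load was not pending before the step either.
        by_cases hmx : m' = x.nd
        · subst hmx
          subst hm'
          rcases hσ.load_src b u _ n hnl' with ⟨o', ho'⟩ | ⟨h1, h2, h3⟩
          · rw [hp] at ho'; simp at ho'
          · refine he ((hearly n).2 ⟨h1.symm, h2, some x.nd, ?_⟩)
            rw [hnl']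
            simp only at h1
            rw [← h1, hb, List.mem_cons] at h3
            rcases h3 with h3 | h3
            · simp only [Prod.mk.injEq, true_and] at h3
              obtain ⟨rfl, rfl⟩ := h3
              rfl
            · have hsort := (hσ.loc x.th).sorted
              rw [hb, List.pairwise_cons] at hsort
              exact absurd (hsort.1 _ h3) (by simp)
        · exact hpend m' o' hm' (by rw [hne _ hmx]; exact hp)
    · intro m n hs'
      by_cases he : G.IsEarlyRead x.ev.act n
      · obtain ⟨-, -, o, h3⟩ := (hearly n).1 he
        exact ⟨_, _, _, (hload _ _ _ _).2 h3⟩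
      · simp only [Trace.extend, he, if_false, hk, reduceCtorEq, false_and, exists_false,
          or_false] at hs'
        obtain ⟨b, u, o, h1⟩ := h.src_load m n hs'
        exact ⟨b, u, o, (hload _ _ _ _).2 h1⟩
  · have hx' : ¬ x.ev.act.IsStore := hx
    have hcnt : x.node = (σ.loc x.th).cnt := by
      rw [hs.local_step.node_eq_nxt hx, hs.local_step.nxt_eq]
    have hfresh : σ.node x.nd = none := ((hσ.loc x.th).none_iff x.node).2 hcnt.ge
    have hkst : ∀ a v, x.ev.act.kind ≠ .store a v := fun a v hk => hx ⟨a, v, hk⟩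
    have hearly : ∀ n, ¬ G.IsEarlyRead x.ev.act n := by
      rintro n ⟨a, v, h1, -⟩; exact hx ⟨a, v, h1⟩
    have hold : ∀ m r, σ.node m = some r → σ'.node m = some r := by
      intro m r hmr
      rw [hne, hmr]
      rintro rfl
      rw [hfresh] at hmr; cases hmr
    refine ⟨hlabel, ?_, ?_, ?_, ?_⟩
    · intro m n
      simp only [Trace.extend, hx', not_false_eq_true, true_and, h.po, hnode, h.isMaxPo hσ]
      by_cases hnx : n = x.nd
      · subst hnx
        simp only [hfresh, hself, ne_eq, not_true, and_false, false_or, and_true, reduceCtorEq,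
          not_false_eq_true, hcnt]
        constructor <;> (rintro ⟨h1, h2⟩; exact ⟨h1, h2.symm⟩)
      · simp [hnx, hne n hnx]
    · intro m n
      simp only [Trace.extend, hkst, false_and, exists_false, or_false, h.st]
      by_cases hnx : n = x.nd
      · subst hnx
        rw [hfresh, hself]
        simp [hkst]
      · rw [hne n hnx]
    · intro a v o n hnl hpend m
      simp only [Trace.extend, hearly, if_false, hnode, h.isMaxSt hσ]
      by_cases hnx : n = x.nd
      · subst hnx
        have hk : x.ev.act.kind = .load a v := by
          rw [hself] at hnl
          simp only [Option.some.injEq, Prod.mk.injEq] at hnl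
          exact hnl.1
        have hno : ¬ G.src m x.nd := by
          intro h1
          obtain ⟨b, u, o, h2⟩ := h.src_load _ _ h1
          rw [hfresh] at h2; cases h2
        rcases hs.of_load hk with h1 | ⟨k, h1, h2⟩
        · rw [hnl] at h1
          simp only [Option.some.injEq, Prod.mk.injEq, true_and] at h1
          subst h1
          simp [hk, hno]
        · rw [hnl] at h1
          simp only [Option.some.injEq, Prod.mk.injEq, true_and] at h1
          obtain ⟨o', ho'⟩ := ((hσ.loc x.th).issue_iff k).2 ⟨_, h2, rfl⟩
          exact absurd (hold (x.th, k) _ ho') (hpend _ _ h1)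
      · simp only [hnx, and_false, exists_false, or_false]
        rw [hne n hnx] at hnl
        exact h.src a v o n hnl (fun m' o' hm' hp => hpend m' o' hm' (hold _ _ hp)) m
    · intro m n hs'
      simp only [Trace.extend, hearly, if_false, hnode] at hs'
      rcases hs' with hs' | ⟨a, v, hk, -, rfl⟩
      · obtain ⟨a, v, o, h1⟩ := h.src_load m n hs'
        exact ⟨a, v, o, hold _ _ h1⟩
      · exact ⟨a, v, o, by rw [hself, hk]⟩

theorem XRun.matches {σ σ' : XState T D Reg Lab} {G : Trace T D} {l : List (AEvent T FUN Reg Lab)}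
    (h : XRun P σ l σ') (hσ : σ.Inv) (hG : σ.Matches G) :
    σ'.Matches ((l.map fun x => x.ev.act).foldl Trace.extend G) := by
  induction h generalizing G with
  | nil => exact hG
  | cons h1 _ ih => exact ih (h1.xinv hσ) (h1.matches hσ hG)

theorem XRun.matches_ofWord {σ : XState T D Reg Lab} {l : List (AEvent T FUN Reg Lab)}
    (h : XRun P (xInit P) l σ) : σ.Matches (Trace.ofWord (l.map fun x => x.ev.act)) :=
  h.matches xInit_xinv (xInit_matches P)

theorem XRun.ofWord_eq_trace {σ : XState T D Reg Lab} {l : List (AEvent T FUN Reg Lab)}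
    (h : XRun P (xInit P) l σ) (hf : σ.Flushed) :
    Trace.ofWord (l.map fun x => x.ev.act) = σ.trace :=
  h.matches_ofWord.eq_trace (h.xinv xInit_xinv) hf

/-- This translates the positions in the definition of a witness into the annotations of the run. -/
theorem XRun.nodeAt_iff {σ : XState T D Reg Lab} {l : List (AEvent T FUN Reg Lab)}
    (h : XRun P (xInit P) l σ) {i : ℕ} {n : T × ℕ} :
    NodeAt (l.map fun x => x.ev.act) i n ↔ ∃ x, l[i]? = some x ∧ n = x.nd := by
  have key : ∀ x, l[i]? = some x →
      ((Trace.ofWord ((l.map fun x => x.ev.act).take i)).IsNodeOf x.ev.act n ↔ n = x.nd) := by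
    intro x hx
    obtain ⟨hi, hx⟩ := List.getElem?_eq_some_iff.1 hx
    rw [← List.take_append_drop i l, xRun_append] at h
    obtain ⟨σ₁, h1, h2⟩ := h
    rw [List.drop_eq_getElem_cons hi, hx, xRun_cons] at h2
    obtain ⟨σ₂, h2, -⟩ := h2
    rw [← List.map_take]
    exact h1.matches_ofWord.isNodeOf (h1.xinv xInit_xinv) h2
  constructor
  · rintro ⟨a, ha, hn⟩
    rw [List.getElem?_map, Option.map_eq_some_iff] at ha
    obtain ⟨x, hx, rfl⟩ := ha
    exact ⟨x, hx, (key x hx).1 hn⟩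
  · rintro ⟨x, hx, rfl⟩
    exact ⟨x.ev.act, by simp [hx], (key x hx).2 rfl⟩

end Linking

end TSORobust

namespace TSORobust

/-! ### Simulation of the TSO and SC semantics by the recording machine -/

section Semantics

variable {T D Reg Lab : Type*} {FUN : Set (DataFun D)}

/-- The underlying TSO state. -/
def XState.toTSO (σ : XState T D Reg Lab) : TSOState T D Reg Lab where
  pc := fun t => (σ.loc t).pc
  reg := fun t => (σ.loc t).reg
  mem := fun a => (σ.mem a).1
  buf := fun t => (σ.loc t).buf.map Prod.snd

/-- The underlying SC state. -/
def XState.toSC (σ : XState T D Reg Lab) : SCState T D Reg Lab where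
  pc := fun t => (σ.loc t).pc
  reg := fun t => (σ.loc t).reg
  mem := fun a => (σ.mem a).1

open Classical in
/-- Replacement of the state of a thread. -/
noncomputable def XState.setLoc (σ : XState T D Reg Lab) (t : T) (l : Loc T D Reg Lab) :
    XState T D Reg Lab :=
  ⟨Function.update σ.loc t l, σ.mem⟩

/-- Replacement of the memory. -/
def XState.setMem (σ : XState T D Reg Lab) (m : D → Cell T D) : XState T D Reg Lab := ⟨σ.loc, m⟩

@[simp]
theorem XState.setLoc_self (σ : XState T D Reg Lab) (t : T) (l : Loc T D Reg Lab) :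
    (σ.setLoc t l).loc t = l := by simp [setLoc]

theorem XState.setLoc_of_ne (σ : XState T D Reg Lab) {t t' : T} (l : Loc T D Reg Lab)
    (h : t' ≠ t) : (σ.setLoc t l).loc t' = σ.loc t' := by simp [setLoc, h]

@[simp]
theorem XState.setLoc_mem (σ : XState T D Reg Lab) (t : T) (l : Loc T D Reg Lab) :
    (σ.setLoc t l).mem = σ.mem := rfl

@[simp]
theorem XState.setMem_loc (σ : XState T D Reg Lab) (m : D → Cell T D) : (σ.setMem m).loc = σ.loc :=
  rfl

@[simp]
theorem XState.setMem_mem (σ : XState T D Reg Lab) (m : D → Cell T D) : (σ.setMem m).mem = m := rfl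

theorem XState.ext_loc {σ σ' : XState T D Reg Lab} (t : T) (ht : σ.loc t = σ'.loc t)
    (h : ∀ t', t' ≠ t → σ.loc t' = σ'.loc t') (hm : σ.mem = σ'.mem) : σ = σ' := by
  obtain ⟨l, m⟩ := σ
  obtain ⟨l', m'⟩ := σ'
  have : l = l' := by
    funext t'
    by_cases ht' : t' = t
    · subst ht'; exact ht
    · exact h t' ht'
  simp only at hm
  rw [this, hm]

open Classical in
theorem XState.toTSO_setLoc (σ : XState T D Reg Lab) (t : T) (l : Loc T D Reg Lab)
    (m : D → Cell T D) : ((σ.setLoc t l).setMem m).toTSO =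
      ⟨Function.update σ.toTSO.pc t l.pc, Function.update σ.toTSO.reg t l.reg, fun a => (m a).1,
        Function.update σ.toTSO.buf t (l.buf.map Prod.snd)⟩ := by
  simp only [toTSO, setLoc, setMem, TSOState.mk.injEq, true_and]
  refine ⟨?_, ?_, ?_⟩ <;>
  · funext t'
    by_cases h : t' = t
    · subst h; simp
    · simp [h]

open Classical in
theorem XState.toSC_setLoc (σ : XState T D Reg Lab) (t : T) (l : Loc T D Reg Lab)
    (m : D → Cell T D) : ((σ.setLoc t l).setMem m).toSC =
      ⟨Function.update σ.toSC.pc t l.pc, Function.update σ.toSC.reg t l.reg, fun a => (m a).1⟩ := by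
  simp only [toSC, setLoc, setMem, SCState.mk.injEq, and_true]
  refine ⟨?_, ?_⟩ <;>
  · funext t'
    by_cases h : t' = t
    · subst h; simp
    · simp [h]

theorem XState.eq_setLoc {σ σ' : XState T D Reg Lab} {t : T}
    (h : ∀ t', t' ≠ t → σ'.loc t' = σ.loc t') :
    σ' = (σ.setLoc t (σ'.loc t)).setMem σ'.mem :=
  XState.ext_loc t (by simp) (fun t' ht' => by rw [setMem_loc, setLoc_of_ne _ _ ht', h t' ht']) rfl

open Classical in
theorem filter_map_snd (l : List (ℕ × D × D)) (a : D) :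
    (l.map Prod.snd).filter (fun p => p.1 = a) = (l.filter fun p => p.2.1 = a).map Prod.snd := by
  rw [List.filter_map]; rfl

variable [Zero D] {P : Program T FUN Reg Lab}

/-- SC computations of the machine: every issue is directly followed by the store. -/
inductive SCX (P : Program T FUN Reg Lab) :
    XState T D Reg Lab → List (AEvent T FUN Reg Lab) → XState T D Reg Lab → Prop
  | nil (σ : XState T D Reg Lab) : SCX P σ [] σ
  | single {σ σ' σ'' : XState T D Reg Lab} {x : AEvent T FUN Reg Lab}
      {l : List (AEvent T FUN Reg Lab)} :
      XStep P σ x σ' → ¬ x.IsStore → x.ev.act.kind ≠ .issue → SCX P σ' l σ'' →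
      SCX P σ (x :: l) σ''
  | pair {σ σ₁ σ' σ'' : XState T D Reg Lab} {x y : AEvent T FUN Reg Lab}
      {l : List (AEvent T FUN Reg Lab)} :
      XStep P σ x σ₁ → x.ev.act.kind = .issue → XStep P σ₁ y σ' → y.IsStore → y.th = x.th →
      SCX P σ' l σ'' → SCX P σ (x :: y :: l) σ''

theorem SCX.xRun {σ σ' : XState T D Reg Lab} {l : List (AEvent T FUN Reg Lab)}
    (h : SCX P σ l σ') : XRun P σ l σ' := by
  induction h with
  | nil => exact .nil _
  | single h1 _ _ _ ih => exact .cons h1 ih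
  | pair h1 _ h2 _ _ _ ih => exact .cons h1 (.cons h2 ih)

theorem LStep.xStep {σ : XState T D Reg Lab} {x : AEvent T FUN Reg Lab} {t : T}
    {l' : Loc T D Reg Lab} {m' : D → Cell T D} (h : LStep P t (σ.loc t) x l')
    (hm : MStep σ.mem x.acc m') : XStep P σ x ((σ.setLoc t l').setMem m') := by
  obtain rfl := h.th_eq
  exact ⟨by simpa using h, hm, fun t' ht' => σ.setLoc_of_ne _ ht'⟩

/-- The annotations restrict nothing: cells are read off the memory, node numbers off the buffer and
the counter. -/
theorem exists_xStep_of_tsoStep {s s' : TSOState T D Reg Lab} {e : Event T FUN Reg Lab}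
    (h : P.TSOStep s e s') {σ : XState T D Reg Lab} (hσ : s = σ.toTSO) :
    ∃ x σ', x.ev = e ∧ XStep P σ x σ' ∧ s' = σ'.toTSO := by
  classical
  cases h with
  | loadBuffer t l l' r e a v β h1 h2 h3 =>
    subst hσ
    rw [show σ.toTSO.buf t = (σ.loc t).buf.map Prod.snd from rfl, filter_map_snd,
      List.map_eq_append_iff] at h3
    obtain ⟨β', γ, h3, -, h4⟩ := h3
    obtain ⟨⟨k, p⟩, rfl, rfl⟩ := List.map_eq_singleton_iff.1 h4
    obtain rfl : l = (σ.loc t).pc := h1.2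
    refine ⟨_, _, ?_, (LStep.loadBuffer (t := t) (σ.loc t) l' r e a v k β' h1 h2 h3).xStep
      (.silent _), ?_⟩
    · rfl
    · rw [XState.toTSO_setLoc]
      simp [Loc.advance, XState.toTSO]
  | loadMemory t l l' r e a v h1 h2 h3 h4 =>
    subst hσ
    rw [show σ.toTSO.buf t = (σ.loc t).buf.map Prod.snd from rfl, filter_map_snd,
      List.map_eq_nil_iff] at h3
    obtain rfl : l = (σ.loc t).pc := h1.2
    subst h4
    refine ⟨_, _, ?_, (LStep.loadMemory (t := t) (σ.loc t) l' r e a (σ.mem a) h1 h2 h3).xStep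
      (.read _ _), ?_⟩
    · rfl
    · rw [XState.toTSO_setLoc]
      simp [Loc.advance, XState.toTSO]
  | issue t l l' e₁ e₂ a v h1 h2 h3 =>
    subst hσ
    obtain rfl : l = (σ.loc t).pc := h1.2
    refine ⟨_, _, ?_, (LStep.issue (t := t) (σ.loc t) l' e₁ e₂ a v h1 h2 h3).xStep
      (.silent _), ?_⟩
    · rfl
    · rw [XState.toTSO_setLoc]
      simp [Loc.advance, XState.toTSO]
  | store t a v β h1 =>
    subst hσ
    rw [show σ.toTSO.buf t = (σ.loc t).buf.map Prod.snd from rfl, List.map_eq_cons_iff] at h1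
    obtain ⟨⟨k, p⟩, β', h2, rfl, rfl⟩ := h1
    refine ⟨_, _, ?_, (LStep.store (t := t) (σ.loc t) k a v β' (σ.mem a) h2).xStep
      (.write _ _ _), ?_⟩
    · rfl
    · rw [XState.toTSO_setLoc]
      simp only [XState.toTSO, TSOState.mk.injEq]
      refine ⟨?_, ?_, ?_, ?_⟩
      · simp
      · simp
      · funext b
        by_cases hb : b = a
        · subst hb; simp
        · simp [hb]
      · trivial
  | mfence t l l' h1 h2 =>
    subst hσ
    obtain rfl : l = (σ.loc t).pc := h1.2
    rw [show σ.toTSO.buf t = (σ.loc t).buf.map Prod.snd from rfl, List.map_eq_nil_iff] at h2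
    refine ⟨_, _, ?_, (LStep.loc (t := t) (σ.loc t) l' _ _ h1 (.mfence h2)).xStep
      (.silent _), ?_⟩
    · rfl
    · rw [XState.toTSO_setLoc]
      simp [Loc.advance, XState.toTSO]
  | assign t l l' r e h1 =>
    subst hσ
    obtain rfl : l = (σ.loc t).pc := h1.2
    refine ⟨_, _, ?_, (LStep.loc (t := t) (σ.loc t) l' _ _ h1 (.assign r e)).xStep
      (.silent _), ?_⟩
    · rfl
    · rw [XState.toTSO_setLoc]
      simp [Loc.advance, XState.toTSO]
  | assertion t l l' e h1 h2 =>
    subst hσ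
    obtain rfl : l = (σ.loc t).pc := h1.2
    refine ⟨_, _, ?_, (LStep.loc (t := t) (σ.loc t) l' _ _ h1 (.assertion e h2)).xStep
      (.silent _), ?_⟩
    · rfl
    · rw [XState.toTSO_setLoc]
      simp [Loc.advance, XState.toTSO]

theorem tsoStep_congr {s s' s'' : TSOState T D Reg Lab} {e e' : Event T FUN Reg Lab}
    (h : P.TSOStep s e s') (he : e = e') (hpc : s'.pc = s''.pc) (hreg : s'.reg = s''.reg)
    (hmem : s'.mem = s''.mem) (hbuf : s'.buf = s''.buf) : P.TSOStep s e' s'' := by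
  obtain ⟨_, _, _, _⟩ := s'
  obtain ⟨_, _, _, _⟩ := s''
  simp only at hpc hreg hmem hbuf
  subst he hpc hreg hmem hbuf
  exact h

theorem scStep_congr {s s' s'' : SCState T D Reg Lab} {w w' : List (Act T D)}
    (h : P.SCStep s w s') (hw : w = w') (hpc : s'.pc = s''.pc) (hreg : s'.reg = s''.reg)
    (hmem : s'.mem = s''.mem) : P.SCStep s w' s'' := by
  obtain ⟨_, _, _⟩ := s'
  obtain ⟨_, _, _⟩ := s''
  simp only at hpc hreg hmem
  subst hw hpc hreg hmem
  exact h

theorem XStep.tsoStep {σ σ' : XState T D Reg Lab} {x : AEvent T FUN Reg Lab}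
    (h : XStep P σ x σ') : P.TSOStep σ.toTSO x.ev σ'.toTSO := by
  classical
  obtain ⟨⟨⟨t, kd⟩, i⟩, k, nx, acc⟩ := x
  have hl : LStep P t (σ.loc t) _ (σ'.loc t) := h.local_step
  have hm := h.mem_step
  rw [XState.eq_setLoc h.other, XState.toTSO_setLoc]
  clear h
  simp only at hm
  generalize σ'.mem = m' at hm
  simp only
  generalize σ'.loc t = l' at hl
  generalize hloc : σ.loc t = l at hl
  have hbuf : σ.toTSO.buf t = l.buf.map Prod.snd := by rw [← hloc]; rfl
  have hreg : σ.toTSO.reg t = l.reg := by rw [← hloc]; rfl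
  have hpc : σ.toTSO.pc t = l.pc := by rw [← hloc]; rfl
  cases hl with
  | loadBuffer l' r e a v k β h1 h2 h3 =>
    cases hm
    refine tsoStep_congr (Program.TSOStep.loadBuffer (P := P) σ.toTSO t l.pc l' r e a v (β.map Prod.snd)
      (by rw [hpc]; exact h1) (by rw [hreg]; exact h2) (by rw [hbuf, filter_map_snd, h3]; simp)) ?_ ?_ ?_ ?_ ?_
    all_goals first
      | rfl
      | exact (Function.update_eq_self_iff.2 hreg.symm).symm
      | exact (Function.update_eq_self_iff.2 hbuf.symm).symm
      | (rw [hreg]; rfl)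
  | loadMemory l' r e a c h1 h2 h3 =>
    cases hm
    refine tsoStep_congr (Program.TSOStep.loadMemory (P := P) σ.toTSO t l.pc l' r e a _
      (by rw [hpc]; exact h1) (by rw [hreg]; exact h2) (by rw [hbuf, filter_map_snd, h3]; simp)
      rfl) ?_ ?_ ?_ ?_ ?_
    all_goals first
      | rfl
      | exact (Function.update_eq_self_iff.2 hreg.symm).symm
      | exact (Function.update_eq_self_iff.2 hbuf.symm).symm
      | (rw [hreg]; rfl)
  | issue l' e₁ e₂ a v h1 h2 h3 =>
    cases hm
    refine tsoStep_congr (Program.TSOStep.issue (P := P) σ.toTSO t l.pc l' e₁ e₂ a v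
      (by rw [hpc]; exact h1) (by rw [hreg]; exact h2) (by rw [hreg]; exact h3)) ?_ ?_ ?_ ?_ ?_
    all_goals first
      | rfl
      | exact (Function.update_eq_self_iff.2 hreg.symm).symm
      | exact (Function.update_eq_self_iff.2 hbuf.symm).symm
      | (rw [hbuf]; simp [Loc.advance])
  | loc l' i ρ h1 h2 =>
    cases hm
    cases h2 with
    | mfence h2 =>
      refine tsoStep_congr (Program.TSOStep.mfence (P := P) σ.toTSO t l.pc l'
        (by rw [hpc]; exact h1) (by rw [hbuf, h2]; simp)) ?_ ?_ ?_ ?_ ?_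
      all_goals first
        | rfl
        | exact (Function.update_eq_self_iff.2 hreg.symm).symm
        | exact (Function.update_eq_self_iff.2 hbuf.symm).symm
    | assign r e =>
      refine tsoStep_congr (Program.TSOStep.assign (P := P) σ.toTSO t l.pc l' r e
        (by rw [hpc]; exact h1)) ?_ ?_ ?_ ?_ ?_
      all_goals first
        | rfl
        | exact (Function.update_eq_self_iff.2 hreg.symm).symm
        | exact (Function.update_eq_self_iff.2 hbuf.symm).symm
        | (rw [hreg]; rfl)
    | assertion e h2 =>
      refine tsoStep_congr (Program.TSOStep.assertion (P := P) σ.toTSO t l.pc l' e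
        (by rw [hpc]; exact h1) (by rw [hreg]; exact h2)) ?_ ?_ ?_ ?_ ?_
      all_goals first
        | rfl
        | exact (Function.update_eq_self_iff.2 hreg.symm).symm
        | exact (Function.update_eq_self_iff.2 hbuf.symm).symm
  | store k a v β c h1 =>
    cases hm
    refine tsoStep_congr (Program.TSOStep.store (P := P) σ.toTSO t a v (β.map Prod.snd)
      (by rw [hbuf, h1]; simp)) rfl ?_ ?_ ?_ rfl
    · exact (Function.update_eq_self_iff.2 hpc.symm).symm
    · exact (Function.update_eq_self_iff.2 hreg.symm).symm
    · funext b
      by_cases hb : b = a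
      · subst hb; simp
      · simp [hb, XState.toTSO]

theorem isTSOExec_iff {es : List (Event T FUN Reg Lab)} :
    P.IsTSOExec es ↔ ∃ l σ, l.map AEvent.ev = es ∧ XRun P (xInit P) l σ ∧ σ.Flushed := by
  constructor
  · rintro ⟨s, h, hf⟩
    have key : ∀ {s s' : TSOState T D Reg Lab} {es : List (Event T FUN Reg Lab)},
        P.TSORun s es s' → ∀ σ : XState T D Reg Lab, s = σ.toTSO →
        ∃ l σ', l.map AEvent.ev = es ∧ XRun P σ l σ' ∧ s' = σ'.toTSO := by
      intro s s' es h
      induction h with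
      | nil => intro σ hσ; exact ⟨[], σ, rfl, .nil _, hσ⟩
      | cons h1 _ ih =>
        intro σ hσ
        obtain ⟨x, σ₁, rfl, h3, h4⟩ := exists_xStep_of_tsoStep h1 hσ
        obtain ⟨l, σ', rfl, h6, h7⟩ := ih σ₁ h4
        exact ⟨x :: l, σ', rfl, .cons h3 h6, h7⟩
    obtain ⟨l, σ, h1, h2, rfl⟩ := key h (xInit P) rfl
    exact ⟨l, σ, h1, h2, fun t => List.map_eq_nil_iff.1 (hf t)⟩
  · rintro ⟨l, σ, rfl, h, hf⟩
    refine ⟨σ.toTSO, ?_, fun t => List.map_eq_nil_iff.2 (hf t)⟩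
    have key : ∀ {σ σ' : XState T D Reg Lab} {l : List (AEvent T FUN Reg Lab)}, XRun P σ l σ' →
        P.TSORun σ.toTSO (l.map AEvent.ev) σ'.toTSO := by
      intro σ σ' l h
      induction h with
      | nil => exact .nil _
      | cons h1 _ ih => exact .cons h1.tsoStep ih
    exact key h

theorem tsoTraces_eq : P.tsoTraces =
    {G | ∃ l σ, XRun P (xInit P) l σ ∧ σ.Flushed ∧ σ.trace = G} := by
  ext G
  constructor
  · rintro ⟨w, ⟨es, hes, rfl⟩, rfl⟩
    obtain ⟨l, σ, rfl, h, hf⟩ := isTSOExec_iff.1 hes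
    exact ⟨l, σ, h, hf, by rw [← h.ofWord_eq_trace hf, List.map_map]; rfl⟩
  · rintro ⟨l, σ, h, hf, rfl⟩
    refine ⟨_, ⟨_, isTSOExec_iff.2 ⟨l, σ, rfl, h, hf⟩, rfl⟩, ?_⟩
    rw [← h.ofWord_eq_trace hf, List.map_map]; rfl

/-! ### SC computations -/

theorem LStep.of_issue {t : T} {l l' : Loc T D Reg Lab} {x : AEvent T FUN Reg Lab}
    (h : LStep P t l x l') (hx : x.ev.act.kind = .issue) : ∃ pc e₁ e₂,
      P.At t l.pc ⟨l.pc, .store e₁ e₂, pc⟩ ∧ x.acc = .silent ∧ x.ev.act = ⟨t, .issue⟩ ∧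
      l' = l.advance pc l.reg (l.buf ++ [(l.cnt, e₁.eval l.reg, e₂.eval l.reg)]) (.issue, none) := by
  cases h with
  | issue l' e₁ e₂ a v h1 h2 h3 => subst h2 h3; exact ⟨l', e₁, e₂, h1, rfl, rfl, rfl⟩
  | _ => cases hx

theorem LStep.buf_of_not_store_of_not_issue {t : T} {l l' : Loc T D Reg Lab}
    {x : AEvent T FUN Reg Lab} (h : LStep P t l x l') (hx : ¬ x.IsStore)
    (hi : x.ev.act.kind ≠ .issue) : l'.buf = l.buf := by
  cases h with
  | issue => exact absurd rfl hi
  | store => exact absurd ⟨_, _, rfl⟩ hx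
  | _ => rfl

theorem XStep.flushed {σ σ' : XState T D Reg Lab} {x : AEvent T FUN Reg Lab}
    (h : XStep P σ x σ') (hf : σ.Flushed) (hx : ¬ x.IsStore) (hi : x.ev.act.kind ≠ .issue) :
    σ'.Flushed := by
  intro t
  by_cases ht : t = x.th
  · subst ht; rw [h.local_step.buf_of_not_store_of_not_issue hx hi, hf]
  · rw [h.other t ht, hf]

theorem XStep.flushed_pair {σ σ₁ σ' : XState T D Reg Lab} {x y : AEvent T FUN Reg Lab}
    (h₁ : XStep P σ x σ₁) (h₂ : XStep P σ₁ y σ') (hf : σ.Flushed) (hx : x.ev.act.kind = .issue)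
    (hy : y.IsStore) (hxy : y.th = x.th) : σ'.Flushed := by
  intro t
  obtain ⟨pc, e₁, e₂, -, -, -, hl⟩ := h₁.local_step.of_issue hx
  obtain ⟨a, v, hy⟩ := hy
  have hb := (h₂.of_store hy).1
  by_cases ht : t = x.th
  · subst ht
    rw [hxy, hl, Loc.advance, hf] at hb
    simp only [List.nil_append, List.cons.injEq] at hb
    exact hb.2.symm
  · rw [h₂.other t (by rw [hxy]; exact ht), h₁.other t ht, hf]

theorem SCX.flushed {σ σ' : XState T D Reg Lab} {l : List (AEvent T FUN Reg Lab)}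
    (h : SCX P σ l σ') (hf : σ.Flushed) : σ'.Flushed := by
  induction h with
  | nil => exact hf
  | single h1 h2 h3 _ ih => exact ih (h1.flushed hf h2 h3)
  | pair h1 h2 h3 h4 h5 _ ih => exact ih (h1.flushed_pair h3 hf h2 h4 h5)

theorem xInit_flushed : (xInit P).Flushed := fun _ => rfl

/-- Empty buffers exclude early reads; every other step considered here has a direct SC counterpart.
-/
theorem XStep.scStep {σ σ' : XState T D Reg Lab} {x : AEvent T FUN Reg Lab}
    (h : XStep P σ x σ') (hf : σ.Flushed) (hx : ¬ x.IsStore) (hi : x.ev.act.kind ≠ .issue) :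
    P.SCStep σ.toSC [x.ev.act] σ'.toSC := by
  classical
  obtain ⟨⟨⟨t, kd⟩, i⟩, k, nx, acc⟩ := x
  have hl : LStep P t (σ.loc t) _ (σ'.loc t) := h.local_step
  have hm := h.mem_step
  rw [XState.eq_setLoc h.other, XState.toSC_setLoc]
  clear h
  simp only at hm
  generalize σ'.mem = m' at hm
  simp only
  generalize σ'.loc t = l' at hl
  generalize hloc : σ.loc t = l at hl
  have hbuf : l.buf = [] := by rw [← hloc]; exact hf t
  have hreg : σ.toSC.reg t = l.reg := by rw [← hloc]; rfl
  have hpc : σ.toSC.pc t = l.pc := by rw [← hloc]; rfl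
  cases hl with
  | loadBuffer l' r e a v k β h1 h2 h3 => rw [hbuf] at h3; simp at h3
  | loadMemory l' r e a c h1 h2 h3 =>
    cases hm
    refine scStep_congr (Program.SCStep.load (P := P) σ.toSC t l.pc l' r e a _
      (by rw [hpc]; exact h1) (by rw [hreg]; exact h2) rfl) ?_ ?_ ?_ ?_
    all_goals first
      | rfl
      | exact (Function.update_eq_self_iff.2 hreg.symm).symm
      | (rw [hreg]; rfl)
  | issue l' e₁ e₂ a v h1 h2 h3 => exact absurd rfl hi
  | loc l' i ρ h1 h2 =>
    cases hm
    cases h2 with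
    | mfence h2 =>
      refine scStep_congr (Program.SCStep.mfence (P := P) σ.toSC t l.pc l' (by rw [hpc]; exact h1)) ?_ ?_ ?_ ?_
      all_goals first
        | rfl
        | exact (Function.update_eq_self_iff.2 hreg.symm).symm
    | assign r e =>
      refine scStep_congr (Program.SCStep.assign (P := P) σ.toSC t l.pc l' r e (by rw [hpc]; exact h1)) ?_ ?_ ?_ ?_
      all_goals first
        | rfl
        | exact (Function.update_eq_self_iff.2 hreg.symm).symm
        | (rw [hreg]; rfl)
    | assertion e h2 =>
      refine scStep_congr (Program.SCStep.assertion (P := P) σ.toSC t l.pc l' e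
        (by rw [hpc]; exact h1) (by rw [hreg]; exact h2)) ?_ ?_ ?_ ?_
      all_goals first
        | rfl
        | exact (Function.update_eq_self_iff.2 hreg.symm).symm
  | store => exact absurd ⟨_, _, rfl⟩ hx

theorem XStep.scStep_pair {σ σ₁ σ' : XState T D Reg Lab} {x y : AEvent T FUN Reg Lab}
    (h₁ : XStep P σ x σ₁) (h₂ : XStep P σ₁ y σ') (hf : σ.Flushed) (hx : x.ev.act.kind = .issue)
    (hy : y.IsStore) (hxy : y.th = x.th) :
    P.SCStep σ.toSC [x.ev.act, y.ev.act] σ'.toSC := by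
  classical
  obtain ⟨pc, e₁, e₂, h3, hacc, hact, hl⟩ := h₁.local_step.of_issue hx
  have hm₁ : σ₁.mem = σ.mem := by
    have := h₁.mem_step
    rw [hacc] at this
    generalize σ₁.mem = m at this
    cases this; rfl
  have hσ' := XState.eq_setLoc (σ := σ) (σ' := σ') (t := x.th)
    (fun t' ht' => by rw [h₂.other t' (by rw [hxy]; exact ht'), h₁.other t' ht'])
  rw [hσ', XState.toSC_setLoc]
  clear hσ'
  have hl₂ : LStep P x.th (σ₁.loc x.th) y (σ'.loc x.th) := by
    have := h₂.local_step; rw [hxy] at this; exact this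
  have hm₂ := h₂.mem_step
  rw [hl] at hl₂
  rw [hm₁] at hm₂
  generalize σ'.mem = m' at hm₂
  clear h₂ h₁ hl hm₁ hxy
  generalize σ'.loc x.th = l' at hl₂
  generalize x.th = t at *
  rw [hact]
  clear hact
  have hbuf : (σ.loc t).buf = [] := hf t
  cases hl₂ with
  | store k a v β c h4 =>
    simp only [Loc.advance, hbuf, List.nil_append, List.cons.injEq, Prod.mk.injEq] at h4
    obtain ⟨⟨-, rfl, rfl⟩, -⟩ := h4
    cases hm₂
    refine scStep_congr (Program.SCStep.store (P := P) σ.toSC t (σ.loc t).pc pc e₁ e₂ _ _ h3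
      rfl rfl) rfl rfl ?_ ?_
    · exact (Function.update_eq_self_iff.2 rfl).symm
    · funext b
      by_cases hb : b = e₁.eval (σ.loc t).reg
      · subst hb; simp [XState.toSC]
      · simp [hb, XState.toSC]
  | loadBuffer => obtain ⟨_, _, h⟩ := hy; cases h
  | loadMemory => obtain ⟨_, _, h⟩ := hy; cases h
  | issue => obtain ⟨_, _, h⟩ := hy; cases h
  | loc => obtain ⟨_, _, h⟩ := hy; cases h

theorem SCX.scRun {σ σ' : XState T D Reg Lab} {l : List (AEvent T FUN Reg Lab)}
    (h : SCX P σ l σ') (hf : σ.Flushed) : P.SCRun σ.toSC (l.map fun x => x.ev.act) σ'.toSC := by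
  induction h with
  | nil => exact .nil _
  | single h1 h2 h3 _ ih => exact .cons (h1.scStep hf h2 h3) (ih (h1.flushed hf h2 h3))
  | pair h1 h2 h3 h4 h5 _ ih =>
    exact .cons (h1.scStep_pair h3 hf h2 h4 h5) (ih (h1.flushed_pair h3 hf h2 h4 h5))

theorem exists_scx_of_scStep {s s' : SCState T D Reg Lab} {w : List (Act T D)}
    (h : P.SCStep s w s') {σ : XState T D Reg Lab} (hf : σ.Flushed) (hσ : s = σ.toSC) :
    ∃ l σ', (l.map fun x => x.ev.act) = w ∧ SCX P σ l σ' ∧ s' = σ'.toSC := by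
  classical
  cases h with
  | load t l l' r e a v h1 h2 h4 =>
    subst hσ
    obtain rfl : l = (σ.loc t).pc := h1.2
    subst h4
    refine ⟨[_], _, ?_, .single ((LStep.loadMemory (t := t) (σ.loc t) l' r e a (σ.mem a) h1 h2
      (by rw [hf]; rfl)).xStep (.read _ _)) (by rintro ⟨_, _, h⟩; cases h) (by simp) (.nil _), ?_⟩
    · rfl
    · rw [XState.toSC_setLoc]
      simp [Loc.advance, XState.toSC]
  | store t l l' e₁ e₂ a v h1 h2 h3 =>
    subst hσ
    obtain rfl : l = (σ.loc t).pc := h1.2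
    have hs := (LStep.issue (t := t) (σ.loc t) l' e₁ e₂ a v h1 h2 h3).xStep (.silent _)
    refine ⟨[_, _], _, ?_, .pair hs rfl ((LStep.store (t := t) _ (σ.loc t).cnt a v []
      (σ.mem a) ?_).xStep (.write _ _ _)) ⟨_, _, rfl⟩ rfl (.nil _), ?_⟩
    · rfl
    · simp [Loc.advance, hf t]
    · rw [XState.toSC_setLoc]
      simp only [XState.toSC, SCState.mk.injEq]
      refine ⟨?_, ?_, ?_⟩
      · funext t'
        by_cases h : t' = t
        · subst h; simp [Loc.advance]
        · simp [h, XState.setLoc]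
      · funext t'
        by_cases h : t' = t
        · subst h; simp [Loc.advance]
        · simp [h, XState.setLoc]
      · funext b
        by_cases hb : b = a
        · subst hb; simp
        · simp [hb]
  | mfence t l l' h1 =>
    subst hσ
    obtain rfl : l = (σ.loc t).pc := h1.2
    refine ⟨[_], _, ?_, .single ((LStep.loc (t := t) (σ.loc t) l' _ _ h1
      (.mfence (hf t))).xStep (.silent _)) (by rintro ⟨_, _, h⟩; cases h) (by simp) (.nil _), ?_⟩
    · rfl
    · rw [XState.toSC_setLoc]
      simp [Loc.advance, XState.toSC]
  | assign t l l' r e h1 =>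
    subst hσ
    obtain rfl : l = (σ.loc t).pc := h1.2
    refine ⟨[_], _, ?_, .single ((LStep.loc (t := t) (σ.loc t) l' _ _ h1
      (.assign r e)).xStep (.silent _)) (by rintro ⟨_, _, h⟩; cases h) (by simp) (.nil _), ?_⟩
    · rfl
    · rw [XState.toSC_setLoc]
      simp [Loc.advance, XState.toSC]
  | assertion t l l' e h1 h2 =>
    subst hσ
    obtain rfl : l = (σ.loc t).pc := h1.2
    refine ⟨[_], _, ?_, .single ((LStep.loc (t := t) (σ.loc t) l' _ _ h1
      (.assertion e h2)).xStep (.silent _)) (by rintro ⟨_, _, h⟩; cases h) (by simp) (.nil _), ?_⟩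
    · rfl
    · rw [XState.toSC_setLoc]
      simp [Loc.advance, XState.toSC]

theorem SCX.append {σ σ' σ'' : XState T D Reg Lab} {l l' : List (AEvent T FUN Reg Lab)}
    (h : SCX P σ l σ') (h' : SCX P σ' l' σ'') : SCX P σ (l ++ l') σ'' := by
  induction h with
  | nil => exact h'
  | single h1 h2 h3 _ ih => exact .single h1 h2 h3 (ih h')
  | pair h1 h2 h3 h4 h5 _ ih => exact .pair h1 h2 h3 h4 h5 (ih h')

theorem scTraces_eq : P.scTraces = {G | ∃ l σ, SCX P (xInit P) l σ ∧ σ.trace = G} := by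
  ext G
  constructor
  · rintro ⟨w, ⟨s, h⟩, rfl⟩
    have key : ∀ {s s' : SCState T D Reg Lab} {w : List (Act T D)}, P.SCRun s w s' →
        ∀ σ : XState T D Reg Lab, σ.Flushed → s = σ.toSC →
        ∃ l σ', (l.map fun x => x.ev.act) = w ∧ SCX P σ l σ' := by
      intro s s' w h
      induction h with
      | nil => intro σ hf hσ; exact ⟨[], σ, rfl, .nil _⟩
      | cons h1 _ ih =>
        intro σ hf hσ
        obtain ⟨l₁, σ₁, rfl, h3, h4⟩ := exists_scx_of_scStep h1 hf hσ
        obtain ⟨l, σ', rfl, h6⟩ := ih σ₁ (h3.flushed hf) h4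
        exact ⟨l₁ ++ l, σ', by simp, h3.append h6⟩
    obtain ⟨l, σ, rfl, h2⟩ := key h (xInit P) xInit_flushed rfl
    exact ⟨l, σ, h2, (h2.xRun.ofWord_eq_trace (h2.flushed xInit_flushed)).symm⟩
  · rintro ⟨l, σ, h, rfl⟩
    exact ⟨_, ⟨_, h.scRun xInit_flushed⟩, h.xRun.ofWord_eq_trace (h.flushed xInit_flushed)⟩

theorem scTraces_subset_tsoTraces : P.scTraces ⊆ P.tsoTraces := by
  rw [scTraces_eq, tsoTraces_eq]
  rintro G ⟨l, σ, h, rfl⟩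
  exact ⟨l, σ, h.xRun, h.flushed xInit_flushed, rfl⟩

end Semantics

end TSORobust

namespace TSORobust

/-! ### Acyclicity of SC traces, and computations without delays -/

section SequentialConsistency

variable {T D Reg Lab : Type*} {FUN : Set (DataFun D)}

/-- The happens-before relation is contained in a strict order given by ranks. -/
def XState.Ranked (σ : XState T D Reg Lab) : Prop :=
  ∃ (rk : T × ℕ → ℕ) (N : ℕ), (∀ m, σ.node m ≠ none → rk m < N) ∧
    ∀ m n, σ.trace.hb m n → rk m < rk n

theorem XState.Ranked.not_cycle {σ : XState T D Reg Lab} (h : σ.Ranked) (m : T × ℕ) :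
    ¬ Relation.TransGen σ.trace.hb m m := by
  obtain ⟨rk, N, -, h⟩ := h
  have key : ∀ n, Relation.TransGen σ.trace.hb m n → rk m < rk n := by
    intro n hn
    induction hn with
    | single h1 => exact h _ _ h1
    | tail _ h1 ih => exact ih.trans (h _ _ h1)
  exact fun hm => (key m hm).false

theorem XState.label_eq_iff {σ : XState T D Reg Lab} {m : T × ℕ} {t : T} {k : ActKind D} :
    σ.trace.label m = some ⟨t, k⟩ ↔ m.1 = t ∧ ∃ o, σ.node m = some (k, o) := by
  simp only [XState.trace, Option.map_eq_some_iff, Act.mk.injEq]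
  constructor
  · rintro ⟨⟨k', o⟩, h1, h2, rfl⟩
    exact ⟨h2, o, h1⟩
  · rintro ⟨h1, o, h2⟩
    exact ⟨_, h2, h1, rfl⟩

theorem XState.Inv.hb_left {σ : XState T D Reg Lab} (hσ : σ.Inv) {m n : T × ℕ}
    (h : σ.trace.hb m n) : σ.node m ≠ none := by
  rcases h with h | h | h | h
  · obtain ⟨h1, h2, h3⟩ := h
    intro h4
    apply h3
    rw [XState.node, (hσ.loc _).none_iff] at h4 ⊢
    rw [← h1]; omega
  · obtain ⟨a, v, h1⟩ := h
    obtain ⟨u, o, h2⟩ := hσ.store_pred _ _ _ _ h1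
    simp [h2]
  · obtain ⟨a, v, h1⟩ := h
    rcases hσ.load_src _ _ _ _ h1 with ⟨o, h2⟩ | ⟨h2, -, h3⟩
    · simp [h2]
    · obtain ⟨o, ho⟩ := ((hσ.loc n.1).issue_iff m.2).2 ⟨_, h3, rfl⟩
      rw [XState.node, h2, ho]; simp
  · rcases h with ⟨k, ⟨a, v, h1⟩, -⟩ | ⟨-, t, t', a, v, v', h1, -⟩
    · simp [h1]
    · obtain ⟨-, o, h2⟩ := XState.label_eq_iff.1 h1
      simp [h2]

/-- A new node whose source or store predecessor is given by the current memory can be ranked above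
all others: edges enter it, but none leaves it. -/
theorem XState.Ranked.insert {σ σ' : XState T D Reg Lab} (hσ : σ.Inv) (hσ' : σ'.Inv)
    (hr : σ.Ranked) (n₀ : T × ℕ) (h₀ : σ.node n₀ = none)
    (hne : ∀ m, m ≠ n₀ → σ'.node m = σ.node m)
    (hst : ∀ a v o, σ'.node n₀ = some (.store a v, o) → o = (σ.mem a).2)
    (hld : ∀ a v o, σ'.node n₀ = some (.load a v, o) → o = (σ.mem a).2) : σ'.Ranked := by
  classical
  obtain ⟨rk, N, hN, hrk⟩ := hr
  have hcell : ∀ a, (σ.mem a).2 ≠ some n₀ := by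
    intro a ha
    obtain ⟨o, ho⟩ := hσ.cell_some a (σ.mem a).1 n₀ (Prod.ext rfl ha)
    rw [h₀] at ho; cases ho
  have hirr : ¬ σ'.trace.hb n₀ n₀ := by
    rintro (h | h | h | h)
    · have := h.2.1; omega
    · obtain ⟨a, v, h1⟩ := h
      exact hcell a (hst _ _ _ h1).symm
    · obtain ⟨a, v, h1⟩ := h
      exact hcell a (hld _ _ _ h1).symm
    · rcases h with ⟨k, ⟨a, v, h1⟩, ⟨b, u, h2⟩⟩ | ⟨-, t, t', a, v, v', h1, h2⟩
      · rw [h1] at h2; simp at h2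
      · rw [h1] at h2; simp at h2
  -- Edges to old nodes are old. In particular no conflict edge leaves `n₀`: a new load reads the
  -- current cell, and no recorded store comes after that cell in the store order.
  have hold : ∀ m n, n ≠ n₀ → σ'.trace.hb m n → σ.trace.hb m n := by
    intro m n hn h
    rcases h with h | h | h | h
    · obtain ⟨h1, h2, h3⟩ := h
      exact .inl ⟨h1, h2, by rw [← hne n hn]; exact h3⟩
    · obtain ⟨a, v, h1⟩ := h
      exact .inr (.inl ⟨a, v, by rw [← hne n hn]; exact h1⟩)
    · obtain ⟨a, v, h1⟩ := h
      exact .inr (.inr (.inl ⟨a, v, by rw [← hne n hn]; exact h1⟩))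
    · rcases h with ⟨k, ⟨a, v, h1⟩, ⟨b, u, h2⟩⟩ | ⟨h0, t, t', a, v, v', h1, h2⟩
      · rw [hne n hn] at h2
        by_cases hm : m = n₀
        · subst hm
          have h3 := hld _ _ _ h1
          exact absurd h2 (hσ.cell_max a (σ.mem a).1 k (Prod.ext rfl h3.symm) n b u)
        · rw [hne m hm] at h1
          exact .inr (.inr (.inr (.inl ⟨k, ⟨a, v, h1⟩, ⟨b, u, h2⟩⟩)))
      · obtain ⟨h3, o, h4⟩ := XState.label_eq_iff.1 h1
        obtain ⟨h5, o', h6⟩ := XState.label_eq_iff.1 h2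
        rw [hne n hn] at h6
        by_cases hm : m = n₀
        · subst hm
          have h7 := hld _ _ _ h4
          cases o with
          | some k => exact absurd ⟨a, v, h4⟩ (h0 k)
          | none =>
            exact absurd h6 (hσ.cell_none a (σ.mem a).1 (Prod.ext rfl h7.symm) n v' o')
        · refine .inr (.inr (.inr (.inr ⟨?_, t, t', a, v, v', ?_, ?_⟩)))
          · rintro k ⟨b, u, hk⟩
            exact h0 k ⟨b, u, by rw [hne m hm]; exact hk⟩
          · rw [hne m hm] at h4
            exact XState.label_eq_iff.2 ⟨h3, o, h4⟩
          · exact XState.label_eq_iff.2 ⟨h5, o', h6⟩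
  -- `N` bounds all existing ranks strictly, so it can serve as the rank of the new node.
  refine ⟨Function.update rk n₀ N, N + 1, ?_, ?_⟩
  · intro m hm
    by_cases hm0 : m = n₀
    · subst hm0; simp
    · rw [hne m hm0] at hm
      have := hN m hm
      simp only [ne_eq, hm0, not_false_eq_true, Function.update_of_ne]
      omega
  · intro m n h
    by_cases hn : n = n₀
    · subst hn
      have hm : m ≠ n := by rintro rfl; exact hirr h
      have h1 := hσ'.hb_left h
      rw [hne m hm] at h1
      simpa [hm] using hN m h1
    · have h1 := hold m n hn h
      have hm : m ≠ n₀ := by rintro rfl; exact hσ.hb_left h1 h₀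
      simpa [hm, hn] using hrk m n h1

variable [Zero D] {P : Program T FUN Reg Lab}

theorem XStep.node_fresh {σ σ' : XState T D Reg Lab} {x : AEvent T FUN Reg Lab}
    (h : XStep P σ x σ') (hσ : ∀ t, (σ.loc t).Inv) (hx : ¬ x.IsStore) : σ.node x.nd = none := by
  refine ((hσ x.th).none_iff x.node).2 ?_
  rw [h.local_step.node_eq_nxt hx, h.local_step.nxt_eq]

theorem SCX.ranked {σ σ' : XState T D Reg Lab} {l : List (AEvent T FUN Reg Lab)}
    (h : SCX P σ l σ') (hσ : σ.Inv) (hf : σ.Flushed) (hr : σ.Ranked) : σ'.Ranked := by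
  induction h with
  | nil => exact hr
  | @single σ σ' σ'' x l h1 h2 h3 _ ih =>
    refine ih (h1.xinv hσ) (h1.flushed hf h2 h3) ?_
    obtain ⟨o, ho⟩ := h1.node_self
    refine hr.insert hσ (h1.xinv hσ) x.nd (h1.node_fresh hσ.loc h2) (fun m hm => h1.node_of_ne hm)
      ?_ ?_
    · intro a v o' ho'
      rw [ho] at ho'
      simp only [Option.some.injEq, Prod.mk.injEq] at ho'
      exact absurd ⟨a, v, ho'.1⟩ h2
    · intro a v o' ho'
      have hk : x.ev.act.kind = .load a v := by
        rw [ho] at ho'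
        simp only [Option.some.injEq, Prod.mk.injEq] at ho'
        exact ho'.1
      rcases h1.of_load hk with h4 | ⟨k, -, h4⟩
      · rw [ho'] at h4
        simp only [Option.some.injEq, Prod.mk.injEq, true_and] at h4
        exact h4
      · rw [hf] at h4; cases h4
  -- Issue and store are treated as one insertion: they share a node, and the issue leaves the
  -- memory unchanged, so the predecessor of the store is the cell in `σ`.
  | @pair σ σ₁ σ' σ'' x y l h1 h2 h3 h4 h5 _ ih =>
    refine ih (h3.xinv (h1.xinv hσ)) (h1.flushed_pair h3 hf h2 h4 h5) ?_
    have hx : ¬ x.IsStore := by rintro ⟨a, v, h⟩; rw [h2] at h; cases h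
    obtain ⟨pc, e₁, e₂, -, hacc, -, hl⟩ := h1.local_step.of_issue h2
    have hm : σ₁.mem = σ.mem := by
      have := h1.mem_step
      rw [hacc] at this
      generalize σ₁.mem = m at this
      cases this; rfl
    obtain ⟨a, v, h4⟩ := h4
    obtain ⟨h6, h7, -⟩ := h3.of_store h4
    have hyx : y.nd = x.nd := by
      rw [h5, hl, Loc.advance, hf] at h6
      simp only [List.nil_append, List.cons.injEq, Prod.mk.injEq] at h6
      refine Prod.ext h5 ?_
      change y.node = x.node
      rw [← h6.1.1, h1.local_step.node_eq_nxt hx, h1.local_step.nxt_eq]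
    rw [hyx, hm] at h7
    refine hr.insert hσ (h3.xinv (h1.xinv hσ)) x.nd (h1.node_fresh hσ.loc hx) ?_ ?_ ?_
    · intro m hmx
      rw [h3.node_of_ne (by rw [hyx]; exact hmx), h1.node_of_ne hmx]
    · intro b u o' ho'
      rw [h7] at ho'
      simp only [Option.some.injEq, Prod.mk.injEq, ActKind.store.injEq] at ho'
      obtain ⟨⟨rfl, rfl⟩, rfl⟩ := ho'
      rfl
    · intro b u o' ho'
      rw [h7] at ho'
      simp at ho'

theorem xInit_ranked : (xInit P).Ranked := by
  refine ⟨fun _ => 0, 0, by simp [xInit], ?_⟩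
  intro m n h
  exact absurd rfl (xInit_xinv.hb_left h)

theorem not_cycle_of_mem_scTraces {G : Trace T D} (h : G ∈ P.scTraces) (m : T × ℕ) :
    ¬ Relation.TransGen G.hb m m := by
  rw [scTraces_eq] at h
  obtain ⟨l, σ, h, rfl⟩ := h
  exact (h.ranked xInit_xinv xInit_flushed xInit_ranked).not_cycle m

/-! ### Computations without delays -/

/-- No action of the thread lies between the issue and the store. -/
abbrev AEvent.Immediate (x : AEvent T FUN Reg Lab) : Prop := x.node + 1 = x.nxt

theorem LStep.mem_buf_of_not_store {t : T} {l l' : Loc T D Reg Lab} {x : AEvent T FUN Reg Lab}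
    (h : LStep P t l x l') (hx : ¬ x.IsStore) {p : ℕ × D × D} (hp : p ∈ l.buf) : p ∈ l'.buf := by
  cases h with
  | store => exact absurd ⟨_, _, rfl⟩ hx
  | issue => simp [Loc.advance, hp]
  | _ => exact hp

/-- A buffered entry must belong to the latest node of its thread: counters never decrease, so any
later node would make its store non-immediate. -/
theorem XRun.succ_eq_cnt {σ σ' : XState T D Reg Lab} {l : List (AEvent T FUN Reg Lab)}
    (h : XRun P σ l σ') (hσ : ∀ t, (σ.loc t).Inv) (hf : σ'.Flushed)
    (hl : ∀ x ∈ l, x.IsStore → x.Immediate) (t : T) (p : ℕ × D × D) (hp : p ∈ (σ.loc t).buf) :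
    p.1 + 1 = (σ.loc t).cnt := by
  induction h with
  | nil => rw [hf] at hp; cases hp
  | @cons σ σ₁ σ₂ x l h1 h2 ih =>
    have ih' := ih (fun t => h1.inv hσ t) hf (fun x hx => hl x (List.mem_cons_of_mem _ hx))
    by_cases ht : t = x.th
    · subst ht
      by_cases hx : x.IsStore
      · have hx' := hx
        obtain ⟨a, v, hk⟩ := hx'
        have h3 := (h1.of_store hk).1
        have him := hl x (by simp) hx
        rw [AEvent.Immediate, h1.local_step.nxt_eq] at him
        rw [h3, List.mem_cons] at hp
        rcases hp with rfl | hp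
        · exact him
        · have hs := (hσ x.th).sorted
          rw [h3, List.pairwise_cons] at hs
          have h4 := hs.1 p hp
          have h5 := (hσ x.th).lt_cnt (p := p) (by rw [h3]; exact List.mem_cons_of_mem _ hp)
          simp only at h4
          omega
      · have h3 := ih' (h1.local_step.mem_buf_of_not_store hx hp)
        rw [h1.local_step.cnt_of_not_store hx] at h3
        have := (hσ x.th).lt_cnt hp
        omega
    · rw [← h1.other t ht] at hp ⊢
      exact ih' hp

theorem XRun.buf_eq_nil {σ σ₁ σ' : XState T D Reg Lab} {x : AEvent T FUN Reg Lab}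
    {l : List (AEvent T FUN Reg Lab)} (h1 : XStep P σ x σ₁) (h : XRun P σ₁ l σ')
    (hσ : ∀ t, (σ.loc t).Inv) (hf : σ'.Flushed) (hx : ¬ x.IsStore)
    (hl : ∀ x ∈ l, x.IsStore → x.Immediate) : (σ.loc x.th).buf = [] := by
  rw [List.eq_nil_iff_forall_not_mem]
  intro p hp
  have h3 := h.succ_eq_cnt (fun t => h1.inv hσ t) hf hl x.th p
    (h1.local_step.mem_buf_of_not_store hx hp)
  rw [h1.local_step.cnt_of_not_store hx] at h3
  have := (hσ x.th).lt_cnt hp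
  omega

/-- A thread either is in the same state, or has additionally issued a store. -/
def LocSim (P : Program T FUN Reg Lab) (t : T) (l l' : Loc T D Reg Lab) : Prop :=
  (l = l' ∧ l.buf = []) ∨ (l'.buf = [] ∧ ∃ x, LStep P t l' x l ∧ x.ev.act.kind = .issue)

/-- The SC run postpones every issue until its store. In between the thread does nothing, and other
threads cannot see its buffer. The final state, and with it the trace, is the same. -/
theorem XRun.exists_scx {σ σ' : XState T D Reg Lab} {l : List (AEvent T FUN Reg Lab)}
    (h : XRun P σ l σ') (hσ : ∀ t, (σ.loc t).Inv) (hf : σ'.Flushed)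
    (hl : ∀ x ∈ l, x.IsStore → x.Immediate) (τ : XState T D Reg Lab)
    (hm : τ.mem = σ.mem) (hτ : ∀ t, LocSim P t (σ.loc t) (τ.loc t)) : ∃ l', SCX P τ l' σ' := by
  have hlen : ∀ {t : T} {l l' : Loc T D Reg Lab} {x : AEvent T FUN Reg Lab}, l'.buf = [] →
      LStep P t l' x l → x.ev.act.kind = .issue → ∃ p, l.buf = [p] := by
    intro t l l' x h1 h2 h3
    obtain ⟨pc, e₁, e₂, -, -, -, rfl⟩ := h2.of_issue h3
    simp [Loc.advance, h1]
  induction h generalizing τ with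
  | nil σ =>
    have : τ = σ := by
      obtain ⟨τl, τm⟩ := τ
      obtain ⟨σl, σm⟩ := σ
      simp only at hm
      subst hm
      congr 1
      funext t
      rcases hτ t with ⟨h1, -⟩ | ⟨h1, x, h2, h3⟩
      · exact h1.symm
      · obtain ⟨p, hp⟩ := hlen h1 h2 h3
        rw [hf t] at hp; cases hp
    exact ⟨[], this ▸ .nil _⟩
  | @cons σ σ₁ σ₂ x l h1 h2 ih =>
    have ih' := ih (fun t => h1.inv hσ t) hf (fun x hx => hl x (List.mem_cons_of_mem _ hx))
    by_cases hx : x.IsStore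
    · have hx' := hx
      obtain ⟨a, v, hk⟩ := hx'
      have h3 := (h1.of_store hk).1
      rcases hτ x.th with ⟨-, h4⟩ | ⟨h4, y, h5, h6⟩
      · rw [h3] at h4; cases h4
      · obtain ⟨p, hp⟩ := hlen h4 h5 h6
        rw [hp, List.cons.injEq] at h3
        obtain ⟨pc, e₁, e₂, -, h7, -, -⟩ := h5.of_issue h6
        -- The postponed issue is executed now, directly before its store.
        have hs1 : XStep P τ y (τ.setLoc x.th (σ.loc x.th)) :=
          h5.xStep (m' := τ.mem) (by rw [h7]; exact .silent _)
        have hs2 : XStep P (τ.setLoc x.th (σ.loc x.th)) x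
            (((τ.setLoc x.th (σ.loc x.th)).setLoc x.th (σ₁.loc x.th)).setMem σ₁.mem) :=
          LStep.xStep (by simpa using h1.local_step) (by simpa [hm] using h1.mem_step)
        obtain ⟨l', hl'⟩ := ih' (((τ.setLoc x.th (σ.loc x.th)).setLoc x.th (σ₁.loc x.th)).setMem
          σ₁.mem) rfl (by
            intro t
            by_cases ht : t = x.th
            · subst ht
              exact .inl ⟨by simp, h3.2.symm⟩
            · rw [XState.setMem_loc, XState.setLoc_of_ne _ _ ht, XState.setLoc_of_ne _ _ ht,
                h1.other t ht]
              exact hτ t)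
        exact ⟨_, .pair hs1 h6 hs2 hx h5.th_eq.symm hl'⟩
    · have hb := XRun.buf_eq_nil h1 h2 hσ hf hx (fun x hx => hl x (List.mem_cons_of_mem _ hx))
      have hloc : τ.loc x.th = σ.loc x.th := by
        rcases hτ x.th with ⟨h4, -⟩ | ⟨h4, y, h5, h6⟩
        · exact h4.symm
        · obtain ⟨p, hp⟩ := hlen h4 h5 h6
          rw [hb] at hp; cases hp
      by_cases hi : x.ev.act.kind = .issue
      · obtain ⟨pc, e₁, e₂, -, hacc, -, -⟩ := h1.local_step.of_issue hi
        -- The issue is left out for now: `τ` stays where it is, and the thread lags behind by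
        -- exactly this step.
        refine ih' τ ?_ ?_
        · have := h1.mem_step
          rw [hacc] at this
          generalize σ₁.mem = m at this
          cases this; exact hm
        · intro t
          by_cases ht : t = x.th
          · subst ht
            refine .inr ⟨by rw [hloc, hb], x, ?_, hi⟩
            rw [hloc]; exact h1.local_step
          · rw [h1.other t ht]; exact hτ t
      · have hs : XStep P τ x ((τ.setLoc x.th (σ₁.loc x.th)).setMem σ₁.mem) :=
          LStep.xStep (by rw [hloc]; exact h1.local_step) (by rw [hm]; exact h1.mem_step)
        obtain ⟨l', hl'⟩ := ih' ((τ.setLoc x.th (σ₁.loc x.th)).setMem σ₁.mem) rfl (by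
          intro t
          by_cases ht : t = x.th
          · subst ht
            exact .inl ⟨by simp, by rw [h1.local_step.buf_of_not_store_of_not_issue hx hi, hb]⟩
          · rw [XState.setMem_loc, XState.setLoc_of_ne _ _ ht, h1.other t ht]
            exact hτ t)
        exact ⟨_, .single hs hx hi hl'⟩

theorem XRun.trace_mem_scTraces {σ : XState T D Reg Lab} {l : List (AEvent T FUN Reg Lab)}
    (h : XRun P (xInit P) l σ) (hf : σ.Flushed) (hl : ∀ x ∈ l, x.IsStore → x.Immediate) :
    σ.trace ∈ P.scTraces := by
  rw [scTraces_eq]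
  obtain ⟨l', hl'⟩ := h.exists_scx xInit_inv hf hl (xInit P) rfl (fun t => .inl ⟨rfl, rfl⟩)
  exact ⟨l', σ, hl', rfl⟩

end SequentialConsistency

end TSORobust

namespace TSORobust

/-! ### Cost, commutation and reordering of runs -/

section Reordering

variable {T D Reg Lab : Type*} {FUN : Set (DataFun D)}

/-! ### The cost of a word -/

open Classical in
/-- The number of stores of a thread in a word. -/
noncomputable def stores (t : T) (w : List (Act T D)) : ℕ :=
  w.countP fun x => x.IsStore ∧ x.thread = t

open Classical in
/-- The length of a word, plus the number of pairs of an action and a later store of the same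
thread. -/
noncomputable def cost : List (Act T D) → ℕ
  | [] => 0
  | x :: w => cost w + 1 + if x.IsStore then 0 else stores x.thread w

@[simp]
theorem stores_nil (t : T) : stores t ([] : List (Act T D)) = 0 := rfl

open Classical in
theorem stores_cons (t : T) (x : Act T D) (w : List (Act T D)) :
    stores t (x :: w) = stores t w + if x.IsStore ∧ x.thread = t then 1 else 0 := by
  simp [stores, List.countP_cons]

theorem stores_append (t : T) (u w : List (Act T D)) :
    stores t (u ++ w) = stores t u + stores t w := by
  simp [stores]

theorem stores_perm (t : T) {u w : List (Act T D)} (h : u.Perm w) : stores t u = stores t w :=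
  h.countP_eq _

theorem cost_append_le {u v w : List (Act T D)} (hs : ∀ t, stores t v ≤ stores t w)
    (hc : cost v ≤ cost w) : cost (u ++ v) ≤ cost (u ++ w) := by
  induction u with
  | nil => exact hc
  | cons x u ih =>
    have h1 := hs x.thread
    simp only [List.cons_append, cost, stores_append]
    split_ifs <;> omega

theorem cost_append_lt {u v w : List (Act T D)} (hs : ∀ t, stores t v ≤ stores t w)
    (hc : cost v < cost w) : cost (u ++ v) < cost (u ++ w) := by
  induction u with
  | nil => exact hc
  | cons x u ih =>
    have h1 := hs x.thread
    simp only [List.cons_append, cost, stores_append]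
    split_ifs <;> omega

theorem cost_append_congr {u v w : List (Act T D)} (hs : ∀ t, stores t v = stores t w)
    (hc : cost v = cost w) : cost (u ++ v) = cost (u ++ w) :=
  le_antisymm (cost_append_le (fun t => (hs t).le) hc.le)
    (cost_append_le (fun t => (hs t).ge) hc.ge)

/-- Only pairs within one thread are counted, so passing actions of other threads is free. -/
theorem cost_move {u v : List (Act T D)} {x : Act T D} (h : ∀ y ∈ u, y.thread ≠ x.thread) :
    cost (u ++ x :: v) = cost (x :: (u ++ v)) := by
  induction u with
  | nil => rfl
  | cons y u ih =>
    have ih' := ih fun z hz => h z (List.mem_cons_of_mem _ hz)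
    have hy : y.thread ≠ x.thread := h y (by simp)
    simp only [List.cons_append, cost, stores_append, stores_cons, hy.symm, hy, and_false,
      if_false] at ih' ⊢
    rw [ih']
    split_ifs <;> omega

theorem cost_swap_lt {v : List (Act T D)} {x y : Act T D} (hxy : x.thread = y.thread)
    (hx : ¬ x.IsStore) (hy : y.IsStore) : cost (y :: x :: v) < cost (x :: y :: v) := by
  simp only [cost, hx, hy, if_true, if_false, stores_cons, hxy, and_self]
  omega

theorem length_le_cost (w : List (Act T D)) : w.length ≤ cost w := by
  induction w with
  | nil => simp
  | cons x w ih => simp only [List.length_cons, cost]; omega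

theorem cost_eq_length {w : List (Act T D)} (h : ∀ x ∈ w, x.IsStore) : cost w = w.length := by
  induction w with
  | nil => rfl
  | cons x w ih =>
    simp only [cost, h x (by simp), if_true, List.length_cons,
      ih fun y hy => h y (List.mem_cons_of_mem _ hy)]

/-- A word of stores costs only its length, and any word costs at least the number of its stores. -/
theorem cost_le_of_stores_le {u w : List (Act T D)} (h : ∀ x ∈ u, x.IsStore)
    (hs : ∀ t, stores t u ≤ stores t w) : cost u ≤ cost w := by
  classical
  have hcount : ∀ (t : T) (w : List (Act T D)),
      ((w.filter fun x => x.IsStore).map Act.thread).count t = stores t w := by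
    intro t w
    rw [List.count, List.countP_map, List.countP_filter, stores]
    congr 1
    funext x
    rw [Bool.eq_iff_iff]
    simp [and_comm]
  -- The stores are compared as multisets of threads, which turns the bounds per thread into a bound
  -- on the total number.
  have h1 : ((u.filter fun x => x.IsStore).map Act.thread).Subperm
      ((w.filter fun x => x.IsStore).map Act.thread) := by
    rw [List.subperm_ext_iff]
    intro t _
    rw [hcount, hcount]
    exact hs t
  have h2 := h1.length_le
  rw [List.filter_eq_self.2 (by simpa using h)] at h2
  simp only [List.length_map] at h2
  rw [cost_eq_length h]
  exact h2.trans ((List.length_filter_le _ _).trans (length_le_cost w))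

/-- The word of actions of a list of annotated events. -/
abbrev word (l : List (AEvent T FUN Reg Lab)) : List (Act T D) := l.map fun x => x.ev.act

/-! ### Commuting memory accesses -/

/-- The annotated accesses contain the cells they found, so they are replayed unchanged; for this
the two must not touch a common address unless both are reads. -/
theorem MStep.swap {m m₁ m₂ : D → Cell T D} {α β : Acc T D} (h₁ : MStep m α m₁)
    (h₂ : MStep m₁ β m₂) (hc : ¬ α.Conflict β) : ∃ m', MStep m β m' ∧ MStep m' α m₂ := by
  classical
  cases h₁ with
  | silent => exact ⟨m₂, h₂, .silent _⟩
  | read a =>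
    cases h₂ with
    | silent => exact ⟨m, .silent _, .read _ _⟩
    | read b => exact ⟨m, .read _ _, .read _ _⟩
    | write b c =>
      have hab : a ≠ b := hc
      refine ⟨_, .write m b c, ?_⟩
      have := MStep.read (Function.update m b c) a
      rwa [Function.update_of_ne hab] at this
  | write a c =>
    cases h₂ with
    | silent => exact ⟨m, .silent _, .write _ _ _⟩
    | read b =>
      have hab : a ≠ b := hc
      rw [Function.update_of_ne hab.symm]
      exact ⟨m, .read _ _, .write _ _ _⟩
    | write b c' =>
      have hab : a ≠ b := hc
      rw [Function.update_of_ne hab.symm, Function.update_comm hab]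
      refine ⟨_, .write m b c', ?_⟩
      have := MStep.write (Function.update m b c') a c
      rwa [Function.update_of_ne hab] at this

variable [Zero D] {P : Program T FUN Reg Lab}

/-! ### Emptying the buffers -/

theorem XStep.length_buf_of_store {σ σ' : XState T D Reg Lab} {x : AEvent T FUN Reg Lab}
    (h : XStep P σ x σ') (hx : x.IsStore) :
    (σ.loc x.th).buf.length = (σ'.loc x.th).buf.length + 1 := by
  obtain ⟨a, v, hk⟩ := hx
  rw [(h.of_store hk).1, List.length_cons]

theorem LStep.length_buf_le {t : T} {l l' : Loc T D Reg Lab} {x : AEvent T FUN Reg Lab}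
    (h : LStep P t l x l') (hx : ¬ x.IsStore) : l.buf.length ≤ l'.buf.length := by
  cases h with
  | store => exact absurd ⟨_, _, rfl⟩ hx
  | issue => simp [Loc.advance]
  | _ => exact le_rfl

theorem XRun.length_buf_le {σ σ' : XState T D Reg Lab} {l : List (AEvent T FUN Reg Lab)}
    (h : XRun P σ l σ') (t : T) :
    (σ.loc t).buf.length ≤ (σ'.loc t).buf.length + stores t (word l) := by
  induction h with
  | nil => simp
  | @cons σ σ₁ σ₂ x l h1 _ ih =>
    rw [show word (x :: l) = x.ev.act :: word l from rfl, stores_cons]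
    by_cases ht : x.th = t
    · subst ht
      by_cases hx : x.IsStore
      · have hx' : x.ev.act.IsStore := hx
        simp only [hx', and_self, if_true]
        rw [h1.length_buf_of_store hx]
        omega
      · have := h1.local_step.length_buf_le hx
        omega
    · rw [h1.other t (Ne.symm ht)] at ih
      omega

theorem XRun.length_buf_of_stores {σ σ' : XState T D Reg Lab} {l : List (AEvent T FUN Reg Lab)}
    (h : XRun P σ l σ') (hl : ∀ x ∈ l, x.IsStore) (t : T) :
    (σ.loc t).buf.length = (σ'.loc t).buf.length + stores t (word l) := by
  induction h with
  | nil => simp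
  | @cons σ σ₁ σ₂ x l h1 _ ih =>
    have ih' := ih fun y hy => hl y (List.mem_cons_of_mem _ hy)
    have hx := hl x (by simp)
    have hx' : x.ev.act.IsStore := hx
    rw [show word (x :: l) = x.ev.act :: word l from rfl, stores_cons]
    by_cases ht : x.th = t
    · subst ht
      simp only [hx', and_self, if_true]
      rw [h1.length_buf_of_store hx]
      omega
    · rw [h1.other t (Ne.symm ht)] at ih'
      simp only [ht, and_false, if_false]
      omega

theorem exists_store_step {σ : XState T D Reg Lab} {t : T} {k : ℕ} {a v : D}
    {β : List (ℕ × D × D)} (h : (σ.loc t).buf = (k, a, v) :: β) :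
    ∃ x σ', XStep P σ x σ' ∧ x.ev.act = ⟨t, .store a v⟩ ∧ x.node = k ∧ (σ'.loc t).buf = β := by
  classical
  exact ⟨_, _, (LStep.store (P := P) (t := t) (σ.loc t) k a v β (σ.mem a) h).xStep
    (.write _ _ _), rfl, rfl, by simp⟩

/-- The given run supplies the bound for the induction: each of its stores pays for at most one
store of the same thread from `ρ`. -/
theorem XRun.exists_flush {σ σ' : XState T D Reg Lab} {l : List (AEvent T FUN Reg Lab)}
    (h : XRun P σ l σ') (hf : σ'.Flushed) (ρ : XState T D Reg Lab)
    (hρ : ∀ t, (ρ.loc t).buf.length ≤ (σ.loc t).buf.length) :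
    ∃ q ρ', XRun P ρ q ρ' ∧ ρ'.Flushed ∧ ∀ x ∈ q, x.IsStore := by
  induction h generalizing ρ with
  | nil =>
    refine ⟨[], ρ, .nil _, fun t => ?_, by simp⟩
    have := hρ t
    rw [hf t] at this
    exact List.length_eq_zero_iff.1 (by simpa using this)
  | @cons σ σ₁ σ₂ x l h1 _ ih =>
    by_cases hx : x.IsStore
    · have hlen := h1.length_buf_of_store hx
      cases hb : (ρ.loc x.th).buf with
      | nil =>
        refine ih hf ρ fun t => ?_
        by_cases ht : t = x.th
        · subst ht; rw [hb]; simp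
        · rw [h1.other t ht]; exact hρ t
      | cons p β =>
        obtain ⟨y, ρ₁, h2, h3, -, h4⟩ := exists_store_step (P := P) (σ := ρ) (t := x.th)
          (k := p.1) (a := p.2.1) (v := p.2.2) hb
        have hyx : y.th = x.th := by rw [AEvent.th, h3]
        obtain ⟨q, ρ', h5, h6, h7⟩ := ih hf ρ₁ fun t => by
          by_cases ht : t = x.th
          · subst ht
            have := hρ x.th
            rw [hb, List.length_cons] at this
            rw [h4]; omega
          · rw [h1.other t ht, h2.other t (by rw [hyx]; exact ht)]
            exact hρ t
        refine ⟨y :: q, ρ', .cons h2 h5, h6, ?_⟩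
        rintro z hz
        rcases List.mem_cons.1 hz with rfl | hz
        · exact ⟨p.2.1, p.2.2, by rw [h3]⟩
        · exact h7 z hz
    · refine ih hf ρ fun t => ?_
      by_cases ht : t = x.th
      · subst ht; exact (hρ _).trans (h1.local_step.length_buf_le hx)
      · rw [h1.other t ht]; exact hρ t

/-! ### Commuting steps -/

/-- Local states of distinct threads are independent, and a thread sees the memory only through its
access, so it suffices that the accesses commute. -/
theorem XStep.swap {σ σ₁ σ₂ : XState T D Reg Lab} {x y : AEvent T FUN Reg Lab}
    (h₁ : XStep P σ x σ₁) (h₂ : XStep P σ₁ y σ₂) (ht : x.th ≠ y.th)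
    (hc : ¬ x.acc.Conflict y.acc) : ∃ σ', XStep P σ y σ' ∧ XStep P σ' x σ₂ := by
  obtain ⟨m', hm1, hm2⟩ := h₁.mem_step.swap h₂.mem_step hc
  refine ⟨(σ.setLoc y.th (σ₂.loc y.th)).setMem m', ?_, ?_, hm2, ?_⟩
  · refine LStep.xStep ?_ hm1
    rw [← h₁.other _ ht.symm]
    exact h₂.local_step
  · rw [XState.setMem_loc, XState.setLoc_of_ne _ _ ht, h₂.other _ ht]
    exact h₁.local_step
  · intro t hx
    by_cases hy : t = y.th
    · subst hy; simp
    · rw [XState.setMem_loc, XState.setLoc_of_ne _ _ hy, h₂.other _ hy, h₁.other _ hx]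

theorem XRun.move_left {σ σ' : XState T D Reg Lab} {l : List (AEvent T FUN Reg Lab)}
    {y : AEvent T FUN Reg Lab} (h : XRun P σ (l ++ [y]) σ')
    (hl : ∀ x ∈ l, x.th ≠ y.th ∧ ¬ x.acc.Conflict y.acc) : XRun P σ (y :: l) σ' := by
  induction l generalizing σ with
  | nil => exact h
  | cons x l ih =>
    rw [List.cons_append, xRun_cons] at h
    obtain ⟨σ₁, h1, h2⟩ := h
    have h3 := ih h2 fun z hz => hl z (List.mem_cons_of_mem _ hz)
    rw [xRun_cons] at h3
    obtain ⟨σ₂, h3, h4⟩ := h3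
    obtain ⟨hx1, hx2⟩ := hl x (by simp)
    obtain ⟨σ₁', h5, h6⟩ := h1.swap h3 hx1 hx2
    exact .cons h5 (.cons h6 h4)

/-- Other threads cannot see the local state of `t`. This is the tool for deleting the last action
of a thread. -/
theorem XRun.setLoc {σ σ' : XState T D Reg Lab} {l : List (AEvent T FUN Reg Lab)}
    (h : XRun P σ l σ') {t : T} (hl : ∀ x ∈ l, x.th ≠ t) (c : Loc T D Reg Lab) :
    XRun P (σ.setLoc t c) l (σ'.setLoc t c) := by
  induction h with
  | nil => exact .nil _
  | @cons σ σ₁ σ₂ x l h1 _ ih =>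
    have hx : x.th ≠ t := hl x (by simp)
    refine XRun.cons (σ' := σ₁.setLoc t c) ⟨?_, h1.mem_step, ?_⟩ (ih fun y hy => hl y (List.mem_cons_of_mem _ hy))
    · rw [XState.setLoc_of_ne _ _ hx, XState.setLoc_of_ne _ _ hx]
      exact h1.local_step
    · intro t' ht'
      by_cases htt : t' = t
      · subst htt; simp
      · rw [XState.setLoc_of_ne _ _ htt, XState.setLoc_of_ne _ _ htt, h1.other t' ht']

theorem XRun.loc_eq {σ σ' : XState T D Reg Lab} {l : List (AEvent T FUN Reg Lab)}
    (h : XRun P σ l σ') {t : T} (hl : ∀ x ∈ l, x.th ≠ t) : σ'.loc t = σ.loc t := by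
  induction h with
  | nil => rfl
  | cons h1 _ ih =>
    rw [ih fun y hy => hl y (List.mem_cons_of_mem _ hy), h1.other t (hl _ (by simp)).symm]

-- A delayed store at the head of the buffer was there before `b` already, so it can be executed
-- first. A load that read this entry early then reads the same value with the same source from
-- memory, other loads are unaffected, and `b` cannot be a fence. The final local state, with its
-- recorded nodes, and the final memory are unchanged.
open Classical in
theorem LStep.swap_store {t : T} {l₁ l₂ l₃ : Loc T D Reg Lab} {b s : AEvent T FUN Reg Lab}
    {m₁ m₂ m₃ : D → Cell T D} (h₁ : LStep P t l₁ b l₂) (h₂ : LStep P t l₂ s l₃)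
    (hm₁ : MStep m₁ b.acc m₂) (hm₂ : MStep m₂ s.acc m₃) (hb : ¬ b.IsStore) (hs : s.IsStore)
    (hd : ¬ s.Immediate) (hl : l₁.Inv) :
    ∃ s' b' l' m', LStep P t l₁ s' l' ∧ MStep m₁ s'.acc m' ∧ LStep P t l' b' l₃ ∧
      MStep m' b'.acc m₃ ∧ s'.ev = s.ev ∧ b'.ev = b.ev := by
  -- The nodes `k` and `l₁.cnt` differ, so their records may be written in either order.
  have hadv : ∀ {k : ℕ} {a v : D} {β : List (ℕ × D × D)} (_ : l₁.buf = (k, a, v) :: β)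
      (pc : Lab) (ρ : Reg → D) (β' : List (ℕ × D × D)) (nd r : ActKind D × Option (T × ℕ)),
      Loc.advance { l₁ with buf := β, nodes := Function.update l₁.nodes k (some r) } pc ρ β' nd =
      ⟨pc, ρ, β', l₁.cnt + 1, Function.update (Function.update l₁.nodes l₁.cnt (some nd)) k
        (some r)⟩ := by
    intro k a v β hk pc ρ β' nd r
    have hlt : k < l₁.cnt := hl.lt_cnt (p := (k, a, v)) (by simp [hk])
    simp only [Loc.advance]
    rw [Function.update_comm hlt.ne]
  cases h₂ with
  | store k a v β c h3 =>
    simp only at hm₂ hd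
    cases h₁ with
    | loadBuffer l' r e a₀ v₀ k₀ β₀ h4 h5 h6 =>
      cases hm₁
      cases hm₂
      have hbuf : l₁.buf = (k, a, v) :: β := h3
      -- If nothing is left for the address, the load has read the very entry that is moved and
      -- turns into a memory read; otherwise it still reads its entry early.
      by_cases hβ : β.filter (fun p => p.2.1 = a₀) = []
      · have h7 : k = k₀ ∧ a = a₀ ∧ v = v₀ := by
          rw [hbuf, List.filter_cons] at h6
          split_ifs at h6 with h8
          · rw [hβ] at h6
            cases β₀ with
            | nil => simpa using h6
            | cons => simp at h6
          · rw [hβ] at h6; simp at h6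
        obtain ⟨rfl, rfl, rfl⟩ := h7
        have h8 := LStep.loadMemory (P := P) (t := t) { l₁ with
          buf := β, nodes := Function.update l₁.nodes k (some (.store a v, (m₁ a).2)) } l' r e a
          (v, some (t, k)) h4 h5 hβ
        rw [hadv hbuf] at h8
        refine ⟨_, _, _, _, .store l₁ k a v β (m₁ a) hbuf, .write _ _ _, h8, ?_, rfl, rfl⟩
        have := MStep.read (Function.update m₁ a (v, some (t, k))) a
        rwa [Function.update_self] at this
      · have h7 : ∃ β', β.filter (fun p => p.2.1 = a₀) = β' ++ [(k₀, a₀, v₀)] := by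
          rw [hbuf, List.filter_cons] at h6
          split_ifs at h6 with h8
          · cases β₀ with
            | nil =>
              simp only [List.nil_append, List.cons.injEq] at h6
              exact absurd h6.2 hβ
            | cons p β' =>
              simp only [List.cons_append, List.cons.injEq] at h6
              exact ⟨β', h6.2⟩
          · exact ⟨β₀, h6⟩
        obtain ⟨β', h7⟩ := h7
        have h8 := LStep.loadBuffer (P := P) (t := t) { l₁ with
          buf := β, nodes := Function.update l₁.nodes k (some (.store a v, (m₁ a).2)) } l' r e a₀
          v₀ k₀ β' h4 h5 h7
        rw [hadv hbuf] at h8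
        exact ⟨_, _, _, _, .store l₁ k a v β (m₁ a) hbuf, .write _ _ _, h8, .silent _, rfl, rfl⟩
    | loadMemory l' r e a₀ c₀ h4 h5 h6 =>
      cases hm₁
      cases hm₂
      have hbuf : l₁.buf = (k, a, v) :: β := h3
      rw [hbuf, List.filter_cons] at h6
      split_ifs at h6 with h8
      have ha : a₀ ≠ a := by rintro rfl; simp at h8
      have h9 := LStep.loadMemory (P := P) (t := t) { l₁ with
        buf := β, nodes := Function.update l₁.nodes k (some (.store a v, (m₁ a).2)) } l' r e a₀
        (m₁ a₀) h4 h5 h6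
      rw [hadv hbuf] at h9
      refine ⟨_, _, _, _, .store l₁ k a v β (m₁ a) hbuf, .write _ _ _, h9, ?_, rfl, rfl⟩
      have := MStep.read (Function.update m₁ a (v, some (t, k))) a₀
      rwa [Function.update_of_ne ha] at this
    | issue l' e₁ e₂ a₀ v₀ h4 h5 h6 =>
      cases hm₁
      cases hm₂
      simp only [Loc.advance] at h3
      obtain ⟨β', hbuf, rfl⟩ : ∃ β', l₁.buf = (k, a, v) :: β' ∧ β = β' ++ [(l₁.cnt, a₀, v₀)] := by
        cases hb1 : l₁.buf with
        | nil =>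
          rw [hb1] at h3
          simp only [List.nil_append, List.cons.injEq, Prod.mk.injEq] at h3
          -- Here the stored entry would be the one that `b` has just issued, and the store would be
          -- immediate.
          refine absurd ?_ hd
          rw [AEvent.Immediate, ← h3.1.1]; rfl
        | cons p β' =>
          rw [hb1] at h3
          simp only [List.cons_append, List.cons.injEq] at h3
          exact ⟨β', by rw [h3.1], h3.2.symm⟩
      have h8 := LStep.issue (P := P) (t := t) { l₁ with
        buf := β', nodes := Function.update l₁.nodes k (some (.store a v, (m₁ a).2)) } l' e₁ e₂
        a₀ v₀ h4 h5 h6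
      rw [hadv hbuf] at h8
      exact ⟨_, _, _, _, .store l₁ k a v β' (m₁ a) hbuf, .write _ _ _, h8, .silent _, rfl, rfl⟩
    | loc l' i ρ h4 h5 =>
      cases hm₁
      cases hm₂
      have hbuf : l₁.buf = (k, a, v) :: β := h3
      have h6 : LocalEffect (FUN := FUN) β l₁.reg i ρ := by
        cases h5 with
        -- A fence would have required an empty buffer, but the entry of the store was pending.
        | mfence h6 => rw [h6] at hbuf; cases hbuf
        | assign => exact .assign _ _
        | assertion _ h6 => exact .assertion _ h6
      have h8 := LStep.loc (P := P) (t := t) { l₁ with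
        buf := β, nodes := Function.update l₁.nodes k (some (.store a v, (m₁ a).2)) } l' i ρ h4 h6
      rw [hadv hbuf] at h8
      exact ⟨_, _, _, _, .store l₁ k a v β (m₁ a) hbuf, .write _ _ _, h8, .silent _, rfl, rfl⟩
    | store => exact absurd ⟨_, _, rfl⟩ hb
  | _ => obtain ⟨_, _, h⟩ := hs; cases h

theorem XStep.swap_store {σ₁ σ₂ σ₃ : XState T D Reg Lab} {b s : AEvent T FUN Reg Lab}
    (h₁ : XStep P σ₁ b σ₂) (h₂ : XStep P σ₂ s σ₃) (ht : b.th = s.th) (hb : ¬ b.IsStore)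
    (hs : s.IsStore) (hd : ¬ s.Immediate) (hσ : ∀ t, (σ₁.loc t).Inv) :
    ∃ s' b' σ', XStep P σ₁ s' σ' ∧ XStep P σ' b' σ₃ ∧ s'.ev = s.ev ∧ b'.ev = b.ev := by
  have h3 := h₂.local_step
  rw [← ht] at h3
  obtain ⟨s', b', l', m', h4, h5, h6, h7, h8, h9⟩ :=
    h₁.local_step.swap_store h3 h₁.mem_step h₂.mem_step hb hs hd (hσ _)
  have hb' : b'.th = b.th := by rw [AEvent.th, h9]
  refine ⟨s', b', _, h4.xStep h5, ⟨?_, h7, ?_⟩, h8, h9⟩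
  · rw [hb']; simpa using h6
  · intro t h10
    rw [hb'] at h10
    rw [XState.setMem_loc, XState.setLoc_of_ne _ _ h10, h₂.other t (by rw [← ht]; exact h10),
      h₁.other t h10]

/-! ### Dependence -/

/-- The node and the memory access of an event. -/
abbrev AEvent.key (x : AEvent T FUN Reg Lab) : (T × ℕ) × Acc T D := (x.nd, x.acc)

/-- An event depends on an earlier one. -/
def Dep (p q : (T × ℕ) × Acc T D) : Prop :=
  p.2.Conflict q.2 ∨ (p.1.1 = q.1.1 ∧ p.1.2 ≤ q.1.2)

/-- Events that do not depend on `b` can be moved before `b`. -/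
theorem XRun.separate {σ σ' : XState T D Reg Lab} {b : AEvent T FUN Reg Lab}
    {l : List (AEvent T FUN Reg Lab)} (h : XRun P σ (b :: l) σ') (hl : ∀ y ∈ l, y.th ≠ b.th)
    (hn : (b :: l).Pairwise fun x y => x.th = y.th → x.node ≤ y.node) :
    ∃ r s, XRun P σ (r ++ b :: s) σ' ∧ (r ++ b :: s).Perm (b :: l) ∧ r.Sublist l ∧ s.Sublist l ∧
      (∀ v, cost (word (r ++ b :: s) ++ v) = cost (word (b :: l) ++ v)) ∧
      ∀ y ∈ s, ∃ c, (c ++ [y]).Sublist s ∧ ((b :: (c ++ [y])).map AEvent.key).IsChain Dep := by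
  induction l using List.reverseRecOn generalizing σ' with
  | nil => exact ⟨[], [], h, by simp, by simp, by simp, fun v => rfl, by simp⟩
  | append_singleton l y ih =>
    rw [← List.cons_append, xRun_append] at h
    obtain ⟨σ₁, h1, h2⟩ := h
    rw [← List.cons_append, List.pairwise_append] at hn
    have hy : y.th ≠ b.th := hl y (by simp)
    obtain ⟨r, s, hr, hp, hrl, hsl, hc, hch⟩ :=
      ih h1 (fun z hz => hl z (List.mem_append_left _ hz)) hn.1
    -- Execution order agrees with node order here, so a clash within a thread is a dependence in
    -- program order.
    have hyn : ∀ x ∈ b :: s, x.th = y.th → x.node ≤ y.node := by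
      intro x hx
      refine hn.2.2 x ?_ y (by simp)
      rcases List.mem_cons.1 hx with rfl | hx
      · simp
      · exact List.mem_cons_of_mem _ (hsl.subset hx)
    -- An action that cannot pass some kept action `x` is kept too, and the chain to `x` extends to
    -- it; any other action moves in front of `b`.
    by_cases hd : ∃ x ∈ b :: s, x.acc.Conflict y.acc ∨ x.th = y.th
    · refine ⟨r, s ++ [y], ?_, ?_, ?_, ?_, ?_, ?_⟩
      · rw [← List.cons_append, ← List.append_assoc, xRun_append]
        exact ⟨σ₁, hr, h2⟩
      · rw [← List.cons_append, ← List.append_assoc, ← List.cons_append]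
        exact hp.append_right _
      · exact hrl.trans (List.sublist_append_left _ _)
      · exact hsl.append (List.Sublist.refl _)
      · intro v
        have := hc (word [y] ++ v)
        simpa [word] using this
      · intro z hz
        rcases List.mem_append.1 hz with hz | hz
        · obtain ⟨c, h3, h4⟩ := hch z hz
          exact ⟨c, h3.trans (List.sublist_append_left _ _), h4⟩
        · obtain rfl : z = y := by simpa using hz
          obtain ⟨x, hx, hxz⟩ := hd
          have hdep : Dep x.key z.key := by
            rcases hxz with h3 | h3
            · exact .inl h3
            · exact .inr ⟨h3, hyn x hx h3⟩
          rcases List.mem_cons.1 hx with rfl | hx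
          · exact ⟨[], by simp, by simpa using hdep⟩
          · obtain ⟨c, h3, h4⟩ := hch x hx
            refine ⟨c ++ [x], h3.append (List.Sublist.refl _), ?_⟩
            rw [← List.cons_append, List.map_append, List.isChain_append]
            refine ⟨h4, by simp, ?_⟩
            intro p hp q hq
            simp only [List.map_cons, List.map_nil, List.head?_cons, Option.mem_def,
              Option.some.injEq] at hq
            rw [← List.cons_append, List.map_append] at hp
            simp only [List.map_cons, List.map_nil, List.getLast?_append, List.getLast?_singleton,
              Option.some_or, Option.mem_def, Option.some.injEq] at hp
            rw [← hp, ← hq]; exact hdep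
    · push Not at hd
      refine ⟨r ++ [y], s, ?_, ?_, ?_, ?_, ?_, ?_⟩
      · rw [xRun_append] at hr
        obtain ⟨σ₂, h3, h4⟩ := hr
        have h5 : XRun P σ₂ ((b :: s) ++ [y]) σ' := xRun_append.2 ⟨σ₁, h4, h2⟩
        rw [List.append_assoc, xRun_append]
        exact ⟨σ₂, h3, h5.move_left fun x hx => ⟨(hd x hx).2, (hd x hx).1⟩⟩
      · rw [List.append_assoc]
        refine List.Perm.trans ?_ (hp.append_right [y])
        rw [List.append_assoc]
        refine List.Perm.append_left r ?_
        exact (List.perm_append_singleton y (b :: s)).symm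
      · exact hrl.append (List.Sublist.refl _)
      · exact hsl.trans (List.sublist_append_left _ _)
      · intro v
        have h6 := hc (word [y] ++ v)
        have h7 : cost (word ((b :: s) ++ [y]) ++ v) = cost (word (y :: b :: s) ++ v) := by
          rw [word, List.map_append, List.append_assoc]
          refine cost_move ?_
          intro a ha
          obtain ⟨x, hx, rfl⟩ := List.mem_map.1 ha
          exact (hd x hx).2
        have h8 : cost (word r ++ (word ((b :: s) ++ [y]) ++ v)) =
            cost (word r ++ (word (y :: b :: s) ++ v)) := by
          refine cost_append_congr (fun t => ?_) h7
          rw [stores_append, stores_append]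
          congr 1
          exact stores_perm t ((List.perm_append_singleton y (b :: s)).map _)
        simp only [word, List.map_append, List.map_cons, List.map_nil, List.append_assoc,
          List.cons_append, List.nil_append] at h6 h8 ⊢
        rw [← h8, h6]
      · exact hch

end Reordering

end TSORobust

namespace TSORobust

/-! ### Dependences within a run are happens-before paths of its trace -/

section HappensBefore

open Relation

variable {T D Reg Lab : Type*} {FUN : Set (DataFun D)}

theorem XState.matches_trace (σ : XState T D Reg Lab) : σ.Matches σ.trace where
  label := fun _ => rfl
  po := fun _ _ => Iff.rfl
  st := fun _ _ => Iff.rfl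
  src := by
    intro a v o n hn _ m
    constructor
    · rintro ⟨b, u, h⟩
      rw [hn] at h
      simp only [Option.some.injEq, Prod.mk.injEq] at h
      exact h.2
    · rintro rfl; exact ⟨a, v, hn⟩
  src_load := fun _ _ ⟨a, v, h⟩ => ⟨a, v, _, h⟩

theorem XState.Inv.transGen_po {σ : XState T D Reg Lab} (hσ : σ.Inv) {m n : T × ℕ}
    (h : m.1 = n.1) (hlt : m.2 < n.2) (hn : σ.node n ≠ none) : TransGen σ.trace.hb m n :=
  TransGen.mono (fun _ _ h => Or.inl h) _ _ ((σ.matches_trace.transGen_po hσ).2 ⟨h, hlt, hn⟩)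

theorem reflTransGen_of_isChain {α β : Type*} {R : β → β → Prop} {S : α → α → Prop} {f : α → β}
    {p : α} {c : List α} (hp : (p :: c).Pairwise fun x y => S x y → ReflTransGen R (f x) (f y))
    (hc : (p :: c).IsChain S) : ∀ q ∈ c, ReflTransGen R (f p) (f q) := by
  induction c generalizing p with
  | nil => simp
  | cons q c ih =>
    rw [List.isChain_cons_cons] at hc
    have h1 : ReflTransGen R (f p) (f q) := (List.pairwise_cons.1 hp).1 q (by simp) hc.1
    intro r hr
    rcases List.mem_cons.1 hr with rfl | hr
    · exact h1
    · exact h1.trans (ih (List.pairwise_cons.1 hp).2 hc.2 r hr)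

variable [Zero D] {P : Program T FUN Reg Lab}

theorem XStep.node_before {σ σ' : XState T D Reg Lab} {x : AEvent T FUN Reg Lab}
    (h : XStep P σ x σ') (hσ : ∀ t, (σ.loc t).Inv) :
    σ.node x.nd = none ∨ ∃ o, σ.node x.nd = some (.issue, o) := by
  by_cases hx : x.IsStore
  · obtain ⟨a, v, hk⟩ := hx
    refine .inr (((hσ x.th).issue_iff x.node).2 ⟨(x.node, a, v), ?_, rfl⟩)
    rw [(h.of_store hk).1]
    exact List.mem_cons_self
  · exact .inl (h.node_fresh hσ hx)

/-- The record of a node changes at most once, when an issue becomes a store. -/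
theorem XRun.node_persist {σ σ' : XState T D Reg Lab} {l : List (AEvent T FUN Reg Lab)}
    (h : XRun P σ l σ') (hσ : ∀ t, (σ.loc t).Inv) {m : T × ℕ} {k : ActKind D}
    {o : Option (T × ℕ)} (hm : σ.node m = some (k, o)) (hk : k ≠ .issue) :
    σ'.node m = some (k, o) := by
  induction h with
  | nil => exact hm
  | @cons σ σ₁ σ₂ x l h1 _ ih =>
    refine ih (fun t => h1.inv hσ t) ?_
    rw [h1.node_of_ne, hm]
    rintro rfl
    rcases h1.node_before hσ with h | ⟨o', h⟩ <;> rw [hm] at h <;> simp at h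
    exact hk h.1

theorem XRun.node_ne_none {σ σ' : XState T D Reg Lab} {l : List (AEvent T FUN Reg Lab)}
    (h : XRun P σ l σ') {m : T × ℕ} (hm : σ.node m ≠ none) : σ'.node m ≠ none := by
  induction h with
  | nil => exact hm
  | @cons σ σ₁ σ₂ x l h1 _ ih =>
    refine ih ?_
    by_cases hmx : m = x.nd
    · subst hmx
      obtain ⟨o, ho⟩ := h1.node_self
      simp [ho]
    · rwa [h1.node_of_ne hmx]

theorem XStep.mem_of_silent {σ σ' : XState T D Reg Lab} {x : AEvent T FUN Reg Lab}
    (h : XStep P σ x σ') (hx : x.acc = .silent) : σ'.mem = σ.mem := by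
  have := h.mem_step
  rw [hx] at this
  generalize σ'.mem = m at this
  cases this; rfl

theorem XStep.of_read {σ σ' : XState T D Reg Lab} {x : AEvent T FUN Reg Lab}
    (h : XStep P σ x σ') {a : D} {c : Cell T D} (hx : x.acc = .read a c) :
    c = σ.mem a ∧ σ'.mem = σ.mem ∧ σ'.node x.nd = some (.load a c.1, c.2) ∧
      x.ev.act.kind = .load a c.1 ∧ (∀ p ∈ (σ.loc x.th).buf, p.2.1 ≠ a) ∧
      ∃ li ∈ (P.thread x.th).code, x.ev.instr = some li ∧ ∃ r e, li.instr = .load r e := by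
  obtain ⟨⟨⟨t, kd⟩, i⟩, k, nx, acc⟩ := x
  have hl : LStep P t (σ.loc t) _ (σ'.loc t) := h.local_step
  have hm := h.mem_step
  simp only at hx
  subst hx
  generalize hloc : σ.loc t = l at hl
  generalize hloc' : σ'.loc t = l' at hl
  generalize σ'.mem = m' at hm
  cases hl with
  | loadMemory l' r e a c h1 h2 h3 =>
    cases hm
    refine ⟨rfl, rfl, ?_, rfl, ?_, _, h1.1, rfl, r, e, rfl⟩
    · simp [XState.node, hloc', Loc.advance]
    · rw [List.filter_eq_nil_iff] at h3
      intro p hp hpa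
      exact h3 p (hloc ▸ hp) (by simpa using hpa)

theorem XStep.of_write {σ σ' : XState T D Reg Lab} {x : AEvent T FUN Reg Lab}
    (h : XStep P σ x σ') {a : D} {c c' : Cell T D} (hx : x.acc = .write a c c') :
    c = σ.mem a ∧ (∀ b, b ≠ a → σ'.mem b = σ.mem b) ∧ (σ'.mem a).2 = some x.nd ∧
      ∃ v, σ'.node x.nd = some (.store a v, c.2) ∧ x.ev.act.kind = .store a v := by
  obtain ⟨⟨⟨t, kd⟩, i⟩, k, nx, acc⟩ := x
  have hl : LStep P t (σ.loc t) _ (σ'.loc t) := h.local_step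
  have hm := h.mem_step
  simp only at hx
  subst hx
  generalize hloc : σ.loc t = l at hl
  generalize hloc' : σ'.loc t = l' at hl
  generalize σ'.mem = m' at hm
  cases hl with
  | store k a v β c h1 =>
    cases hm
    refine ⟨rfl, fun b hb => by simp [hb], by simp, v, ?_, rfl⟩
    simp [XState.node, hloc']

/-- Following the cell of `a` through the run, every write to `a` adds one edge of the store order,
so a path leads from `n` to the write, or to the source of the read, at `y`. -/
theorem XRun.store_order {σ σ' : XState T D Reg Lab} {l : List (AEvent T FUN Reg Lab)}
    (h : XRun P σ l σ') (hσ : ∀ t, (σ.loc t).Inv) {a : D} {n : T × ℕ} (hn : (σ.mem a).2 = some n)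
    {y : AEvent T FUN Reg Lab} (hy : y ∈ l) :
    (∀ c c', y.acc = .write a c c' →
      ∃ k, σ'.trace.st n k ∧ ReflTransGen σ'.trace.st k y.nd) ∧
    (∀ c, y.acc = .read a c → ∃ k, ReflTransGen σ'.trace.st n k ∧ σ'.trace.src k y.nd) := by
  induction h generalizing n with
  | nil => cases hy
  | @cons σ σ₁ σ₂ x l h1 h2 ih =>
    have hσ₁ := fun t => h1.inv hσ t
    rcases List.mem_cons.1 hy with rfl | hy
    · constructor
      · intro c c' hacc
        obtain ⟨rfl, -, -, v, h3, -⟩ := h1.of_write hacc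
        have h4 := h2.node_persist hσ₁ h3 (by simp)
        exact ⟨y.nd, ⟨a, v, by rw [h4, hn]⟩, .refl⟩
      · intro c hacc
        obtain ⟨rfl, -, h3, -⟩ := h1.of_read hacc
        have h4 := h2.node_persist hσ₁ h3 (by simp)
        exact ⟨n, .refl, a, _, by rw [h4, hn]⟩
    · cases hx : x.acc with
      | silent =>
        exact ih hσ₁ (by rw [h1.mem_of_silent hx, hn]) hy
      | read b c =>
        exact ih hσ₁ (by rw [(h1.of_read hx).2.1, hn]) hy
      | write b c c' =>
        obtain ⟨rfl, h3, h4, v, h5, -⟩ := h1.of_write hx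
        by_cases hb : a = b
        · subst hb
          have h6 := h2.node_persist hσ₁ h5 (by simp)
          have hst : σ₂.trace.st n x.nd := ⟨a, v, by rw [h6, hn]⟩
          obtain ⟨h7, h8⟩ := ih hσ₁ h4 hy
          constructor
          · intro c c' hacc
            obtain ⟨k, h9, h10⟩ := h7 c c' hacc
            exact ⟨x.nd, hst, (ReflTransGen.single h9).trans h10⟩
          · intro c hacc
            obtain ⟨k, h9, h10⟩ := h8 c hacc
            exact ⟨k, (ReflTransGen.single hst).trans h9, h10⟩
        · exact ih hσ₁ (by rw [h3 a hb, hn]) hy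

/-- After a write, the store order leads to the later write, or to the source of the later read.
After a read, a conflict edge leads to the store that overwrites its source, and the store order
leads on from there. -/
theorem XRun.pairwise_conflict {σ σ' : XState T D Reg Lab} {l : List (AEvent T FUN Reg Lab)}
    (h : XRun P σ l σ') (hσ : ∀ t, (σ.loc t).Inv) :
    l.Pairwise fun x y => x.acc.Conflict y.acc → TransGen σ'.trace.hb x.nd y.nd := by
  have hst : ∀ {σ : XState T D Reg Lab} {m n : T × ℕ}, ReflTransGen σ.trace.st m n →
      ReflTransGen σ.trace.hb m n := fun h => ReflTransGen.mono (fun _ _ h => Or.inr (Or.inl h)) _ _ h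
  induction h with
  | nil => exact .nil
  | @cons σ σ₁ σ₂ x l h1 h2 ih =>
    have hσ₁ := fun t => h1.inv hσ t
    refine List.pairwise_cons.2 ⟨fun y hy hc => ?_, ih hσ₁⟩
    cases hx : x.acc with
    | silent => rw [hx] at hc; cases hc
    | write a c c' =>
      obtain ⟨-, -, h4, -⟩ := h1.of_write hx
      obtain ⟨h5, h6⟩ := h2.store_order hσ₁ h4 hy
      cases hacc : y.acc with
      | silent => rw [hx, hacc] at hc; cases hc
      | read b d =>
        rw [hx, hacc] at hc
        obtain rfl : a = b := hc
        obtain ⟨k, h7, h8⟩ := h6 d hacc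
        exact TransGen.tail' (hst h7) (.inr (.inr (.inl h8)))
      | write b d d' =>
        rw [hx, hacc] at hc
        obtain rfl : a = b := hc
        obtain ⟨k, h7, h8⟩ := h5 d d' hacc
        exact TransGen.head' (.inr (.inl h7)) (hst h8)
    | read a c =>
      obtain ⟨h3, h4, h5, h6, -⟩ := h1.of_read hx
      have h7 := h2.node_persist hσ₁ h5 (by simp)
      cases hacc : y.acc with
      | silent => rw [hx, hacc] at hc; cases hc
      | read b d => rw [hx, hacc] at hc; cases hc
      | write b d d' =>
        rw [hx, hacc] at hc
        obtain rfl : a = b := hc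
        cases hc2 : c.2 with
        | some n =>
          obtain ⟨k, h8, h9⟩ := (h2.store_order hσ₁ (n := n) (by rw [h4, ← h3, hc2]) hy).1 d d' hacc
          refine TransGen.head' (.inr (.inr (.inr (.inl ⟨n, ⟨a, c.1, ?_⟩, h8⟩)))) (hst h9)
          rw [h7, hc2]
        -- A read of the initial value conflicts directly with every store to the address, so no
        -- path is needed.
        | none =>
          obtain ⟨u, w, rfl⟩ := List.append_of_mem hy
          rw [xRun_append] at h2
          obtain ⟨σ₃, h8, h9⟩ := h2
          rw [xRun_cons] at h9
          obtain ⟨σ₄, h9, h10⟩ := h9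
          obtain ⟨-, -, -, v, h11, -⟩ := h9.of_write hacc
          have h12 := h10.node_persist (fun t => h9.inv (h8.inv hσ₁) t) h11 (by simp)
          refine .single (.inr (.inr (.inr (.inr ⟨?_, x.th, y.th, a, c.1, v, ?_, ?_⟩))))
          · rintro k ⟨b, u, hk⟩
            rw [h7, hc2] at hk
            simp at hk
          · exact XState.label_eq_iff.2 ⟨rfl, _, h7⟩
          · exact XState.label_eq_iff.2 ⟨rfl, _, h12⟩

theorem XRun.nd_ne_none {σ σ' : XState T D Reg Lab} {l : List (AEvent T FUN Reg Lab)}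
    (h : XRun P σ l σ') {x : AEvent T FUN Reg Lab} (hx : x ∈ l) : σ'.node x.nd ≠ none := by
  obtain ⟨u, w, rfl⟩ := List.append_of_mem hx
  rw [xRun_append] at h
  obtain ⟨σ₁, -, h⟩ := h
  rw [xRun_cons] at h
  obtain ⟨σ₂, h1, h2⟩ := h
  obtain ⟨o, ho⟩ := h1.node_self
  exact h2.node_ne_none (by simp [ho])

/-- The reflexive closure is needed because an issue and its store share a node. -/
theorem XRun.pairwise_dep {σ σ' : XState T D Reg Lab} {l : List (AEvent T FUN Reg Lab)}
    (h : XRun P σ l σ') (hσ : σ.Inv) : (l.map AEvent.key).Pairwise fun p q =>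
      Dep p q → ReflTransGen σ'.trace.hb p.1 q.1 := by
  rw [List.pairwise_map]
  refine (h.pairwise_conflict hσ.loc).imp_of_mem fun {x y} _ hy hxy hd => ?_
  rcases hd with hd | ⟨h1, h2⟩
  · exact (hxy hd).to_reflTransGen
  · rcases h2.lt_or_eq with h2 | h2
    · exact ((h.xinv hσ).transGen_po h1 h2 (h.nd_ne_none hy)).to_reflTransGen
    · have : x.nd = y.nd := Prod.ext h1 h2
      change ReflTransGen _ x.nd y.nd
      rw [this]

/-- A chain of dependences from an action to an earlier store of its thread gives a cycle. -/
theorem XRun.exists_cycle {σ σ' : XState T D Reg Lab} {l : List (AEvent T FUN Reg Lab)}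
    (h : XRun P σ l σ') (hσ : σ.Inv) {b s : AEvent T FUN Reg Lab} (hbs : b.th = s.th)
    (hlt : s.node < b.node) {c : List ((T × ℕ) × Acc T D)}
    (hc : (b.key :: (c ++ [s.key])).Sublist (l.map AEvent.key))
    (hd : (b.key :: (c ++ [s.key])).IsChain Dep) : ∃ m, TransGen σ'.trace.hb m m := by
  have h1 := reflTransGen_of_isChain (f := Prod.fst) ((h.pairwise_dep hσ).sublist hc) hd s.key
    (by simp)
  obtain ⟨b', hb', hk⟩ := List.mem_map.1 (hc.subset (List.mem_cons_self))
  have hnd : b'.nd = b.nd := congrArg Prod.fst hk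
  have h2 : TransGen σ'.trace.hb s.nd b.nd :=
    (h.xinv hσ).transGen_po hbs.symm hlt (by rw [← hnd]; exact h.nd_ne_none hb')
  exact ⟨s.nd, h2.trans_left h1⟩

/-! ### The order of the events of a thread -/

theorem LStep.cnt_le {t : T} {l l' : Loc T D Reg Lab} {x : AEvent T FUN Reg Lab}
    (h : LStep P t l x l') : l.cnt ≤ l'.cnt := by
  cases h with
  | store => exact le_rfl
  | _ => exact Nat.le_succ _

theorem LStep.mem_buf_or {t : T} {l l' : Loc T D Reg Lab} {x : AEvent T FUN Reg Lab}
    (h : LStep P t l x l') {p : ℕ × D × D} (hp : p ∈ l'.buf) :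
    p ∈ l.buf ∨ p.1 = l.cnt ∧ x.ev.act.kind = .issue := by
  cases h with
  | store k a v β c h =>
    left
    rw [h]
    exact List.mem_cons_of_mem _ hp
  | issue =>
    simp only [Loc.advance, List.mem_append, List.mem_singleton] at hp
    rcases hp with hp | rfl
    · exact .inl hp
    · exact .inr ⟨rfl, rfl⟩
  | _ => exact .inl hp

theorem XStep.cnt_le {σ σ' : XState T D Reg Lab} {x : AEvent T FUN Reg Lab}
    (h : XStep P σ x σ') (t : T) : (σ.loc t).cnt ≤ (σ'.loc t).cnt := by
  by_cases ht : t = x.th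
  · subst ht; exact h.local_step.cnt_le
  · rw [h.other t ht]

theorem XRun.cnt_le_nxt {σ σ' : XState T D Reg Lab} {l : List (AEvent T FUN Reg Lab)}
    (h : XRun P σ l σ') {y : AEvent T FUN Reg Lab} (hy : y ∈ l) : (σ.loc y.th).cnt ≤ y.nxt := by
  induction h with
  | nil => cases hy
  | @cons σ σ₁ σ₂ x l h1 _ ih =>
    rcases List.mem_cons.1 hy with rfl | hy
    · rw [h1.local_step.nxt_eq]
    · exact (h1.cnt_le _).trans (ih hy)

/-- An entry that reaches the memory was in the buffer at the start or has been issued during the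
run, in which case its number is at least the initial counter. -/
theorem XRun.store_pending {σ σ' : XState T D Reg Lab} {l : List (AEvent T FUN Reg Lab)}
    (h : XRun P σ l σ') {y : AEvent T FUN Reg Lab} (hy : y ∈ l) {a v : D}
    (hk : y.ev.act.kind = .store a v) :
    (y.node, a, v) ∈ (σ.loc y.th).buf ∨
      (σ.loc y.th).cnt ≤ y.node ∧ ∃ z ∈ l, z.nd = y.nd ∧ z.ev.act.kind = .issue := by
  induction h with
  | nil => cases hy
  | @cons σ σ₁ σ₂ x l h1 _ ih =>
    rcases List.mem_cons.1 hy with rfl | hy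
    · left
      rw [(h1.of_store hk).1]
      exact List.mem_cons_self
    · rcases ih hy with h2 | ⟨h2, z, h3, h4, h5⟩
      · by_cases ht : y.th = x.th
        · rw [ht] at h2 ⊢
          rcases h1.local_step.mem_buf_or h2 with h2 | ⟨h2, hx⟩
          · exact .inl h2
          · refine .inr ⟨h2.ge, x, by simp, Prod.ext ht.symm ?_, hx⟩
            change x.node = y.node
            rw [h1.local_step.node_eq_nxt (not_isStore_of_issue hx), h1.local_step.nxt_eq, ← h2]
        · rw [h1.other _ ht] at h2
          exact .inl h2
      · exact .inr ⟨(h1.cnt_le _).trans h2, z, List.mem_cons_of_mem _ h3, h4, h5⟩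

/-- The order of the events of a thread. -/
def ThreadOrder (x y : AEvent T FUN Reg Lab) : Prop :=
  x.th = y.th → x.nxt ≤ y.nxt ∧ (¬ x.IsStore → x.nxt < y.nxt) ∧
    (x.IsStore → y.IsStore → x.node < y.node)

/-- The counter of a thread never decreases and grows with every action that is not a store; stores
leave a FIFO buffer in the order of their nodes. -/
theorem XRun.pairwise_threadOrder {σ σ' : XState T D Reg Lab} {l : List (AEvent T FUN Reg Lab)}
    (h : XRun P σ l σ') (hσ : ∀ t, (σ.loc t).Inv) : l.Pairwise ThreadOrder := by
  induction h with
  | nil => exact .nil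
  | @cons σ σ₁ σ₂ x l h1 h2 ih =>
    refine List.pairwise_cons.2 ⟨fun y hy hxy => ?_, ih fun t => h1.inv hσ t⟩
    have h3 := h2.cnt_le_nxt hy
    have h4 := h1.cnt_le x.th
    rw [← hxy] at h3
    rw [h1.local_step.nxt_eq]
    refine ⟨h4.trans h3, fun hx => ?_, fun hx hy' => ?_⟩
    · rw [h1.local_step.cnt_of_not_store hx] at h3; omega
    · obtain ⟨a, v, hk⟩ := hx
      obtain ⟨b, u, hk'⟩ := hy'
      have hb := (h1.of_store hk).1
      have hs := (hσ x.th).sorted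
      have hlt := (hσ x.th).lt_cnt (p := (x.node, a, v)) (by rw [hb]; exact List.mem_cons_self)
      rw [hb, List.pairwise_cons] at hs
      rcases h2.store_pending hy hk' with h5 | ⟨h5, -⟩
      · rw [← hxy] at h5
        exact hs.1 _ h5
      · rw [← hxy] at h5
        simp only at hlt
        omega

theorem XRun.node_lt_nxt {σ σ' : XState T D Reg Lab} {l : List (AEvent T FUN Reg Lab)}
    (h : XRun P σ l σ') (hσ : ∀ t, (σ.loc t).Inv) {x : AEvent T FUN Reg Lab} (hx : x ∈ l) :
    (x.IsStore → x.node < x.nxt) ∧ (¬ x.IsStore → x.node = x.nxt) := by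
  obtain ⟨u, w, rfl⟩ := List.append_of_mem hx
  rw [xRun_append] at h
  obtain ⟨σ₁, h1, h2⟩ := h
  rw [xRun_cons] at h2
  obtain ⟨σ₂, h2, -⟩ := h2
  refine ⟨?_, h2.local_step.node_eq_nxt⟩
  rintro ⟨a, v, hk⟩
  rw [h2.local_step.nxt_eq]
  exact (h1.inv hσ x.th).lt_cnt (p := (x.node, a, v))
    (by rw [(h2.of_store hk).1]; exact List.mem_cons_self)

/-- If no store is delayed, then nodes are ordered as their events. -/
theorem XRun.pairwise_node_le {σ σ' : XState T D Reg Lab} {l : List (AEvent T FUN Reg Lab)}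
    (h : XRun P σ l σ') (hσ : ∀ t, (σ.loc t).Inv) (hl : ∀ x ∈ l, x.IsStore → x.Immediate) :
    l.Pairwise fun x y => x.th = y.th → x.node ≤ y.node := by
  refine (h.pairwise_threadOrder hσ).imp_of_mem fun {x y} hx hy hxy ht => ?_
  obtain ⟨h1, h2, -⟩ := hxy ht
  obtain ⟨h3, h4⟩ := h.node_lt_nxt hσ hx
  obtain ⟨h5, h6⟩ := h.node_lt_nxt hσ hy
  by_cases hys : y.IsStore
  · have := hl y hy hys
    rw [AEvent.Immediate] at this
    by_cases hxs : x.IsStore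
    · have := h3 hxs; omega
    · have := h4 hxs; have := h2 hxs; omega
  · have := h6 hys
    by_cases hxs : x.IsStore
    · have := h3 hxs; omega
    · have := h4 hxs; omega

end HappensBefore

end TSORobust

namespace TSORobust

/-! ### From attacks to cyclic traces, and from suitable runs to attacks -/

section Witnesses

open Relation

theorem pairwise_getElem? {α : Type*} {R : α → α → Prop} {l : List α} (h : l.Pairwise R)
    {i j : ℕ} {x y : α} (hij : i < j) (hi : l[i]? = some x) (hj : l[j]? = some y) : R x y := by
  obtain ⟨hi', rfl⟩ := List.getElem?_eq_some_iff.1 hi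
  obtain ⟨hj', rfl⟩ := List.getElem?_eq_some_iff.1 hj
  exact List.pairwise_iff_getElem.1 h i j hi' hj' hij

variable {T D Reg Lab : Type*} {FUN : Set (DataFun D)} [Zero D] {P : Program T FUN Reg Lab}

theorem LStep.of_issue_instr {t : T} {l l' : Loc T D Reg Lab} {x : AEvent T FUN Reg Lab}
    (h : LStep P t l x l') (hx : x.ev.act.kind = .issue) :
    ∃ li ∈ (P.thread t).code, x.ev.instr = some li ∧ ∃ e₁ e₂, li.instr = .store e₁ e₂ := by
  cases h with
  | issue l' e₁ e₂ a v h1 h2 h3 => exact ⟨_, h1.1, rfl, e₁, e₂, rfl⟩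
  | _ => cases hx

theorem LStep.of_mfence {t : T} {l l' : Loc T D Reg Lab} {x : AEvent T FUN Reg Lab}
    (h : LStep P t l x l') {li : LInstr FUN Reg Lab} (hx : x.ev.instr = some li)
    (hi : li.instr = .mfence) : l.buf = [] ∧ l'.buf = [] := by
  cases h with
  | loc l' i ρ h1 h2 =>
    cases hx
    simp only at hi
    subst hi
    cases h2 with
    | mfence h => exact ⟨h, h⟩
  | store => cases hx
  | _ => cases hx; cases hi

/-- A fence leaves the buffer empty, so every store that reaches memory later is issued later. -/
theorem XRun.pairwise_mfence {σ σ' : XState T D Reg Lab} {l : List (AEvent T FUN Reg Lab)}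
    (h : XRun P σ l σ') : l.Pairwise fun x y => ∀ li, x.ev.instr = some li → li.instr = .mfence →
      x.th = y.th → y.IsStore → x.nxt ≤ y.node := by
  induction h with
  | nil => exact .nil
  | @cons σ σ₁ σ₂ x l h1 h2 ih =>
    refine List.pairwise_cons.2 ⟨fun y hy li hli hi hxy hs => ?_, ih⟩
    obtain ⟨a, v, hk⟩ := hs
    rcases h2.store_pending hy hk with h3 | ⟨h3, -⟩
    · rw [← hxy, (h1.local_step.of_mfence hli hi).2] at h3
      cases h3
    · rw [h1.local_step.nxt_eq]
      rw [← hxy] at h3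
      exact (h1.cnt_le _).trans h3

/-- Condition (c) at the position of the store, closed up by the program order from the store to the
load, is a cycle, which no SC trace has. -/
theorem not_robust_of_feasible {A : P.Attack} (hA : A.Feasible) : ¬ P.Robust := by
  obtain ⟨es, p, q, r, hw⟩ := hA
  intro hrob
  obtain ⟨l, σ, rfl, h, hf⟩ := isTSOExec_iff.1 hw.exec
  have hsc : σ.trace ∈ P.scTraces := by
    rw [← hrob, tsoTraces_eq]
    exact ⟨l, σ, h, hf, rfl⟩
  have hword : (l.map AEvent.ev).map Event.act = l.map fun x => x.ev.act := by
    rw [List.map_map]; rfl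
  obtain ⟨m, n, hm, hn, hb⟩ := hw.happens_before r hw.q_lt_r.le le_rfl
  obtain ⟨⟨hp, -, n', hn', hn''⟩, -⟩ := hw.store_delayed
  rw [hword] at hm hn hb hn' hn''
  rw [h.ofWord_eq_trace hf] at hb
  obtain ⟨x, hx, rfl⟩ := h.nodeAt_iff.1 hm
  obtain ⟨y, hy, rfl⟩ := h.nodeAt_iff.1 hn
  obtain ⟨z, hz, rfl⟩ := h.nodeAt_iff.1 hn'
  obtain ⟨y', hy', hzy⟩ := h.nodeAt_iff.1 hn''
  rw [hy] at hy'
  obtain rfl := Option.some.inj hy'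
  obtain ⟨a, v, hq⟩ := hw.load_instance
  rw [List.getElem?_map, hx] at hq
  rw [hword, List.getElem?_map, hz] at hp
  simp only [Option.map_some, Option.some.injEq] at hp hq
  have hx1 : x.th = A.attacker := by rw [AEvent.th, hq]
  have hz1 : z.th = A.attacker := by rw [AEvent.th, hp]
  have hxs : ¬ x.IsStore := by rintro ⟨b, u, hk⟩; rw [hq] at hk; cases hk
  have hzs : ¬ z.IsStore := not_isStore_of_issue (by rw [hp])
  have h1 := (pairwise_getElem? (h.pairwise_threadOrder xInit_inv) hw.p_lt_q hz hx
    (hz1.trans hx1.symm)).2.1 hzs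
  have h2 := (h.node_lt_nxt xInit_inv (List.mem_of_getElem? hx)).2 hxs
  have h3 := (h.node_lt_nxt xInit_inv (List.mem_of_getElem? hz)).2 hzs
  -- The node of the store is that of its issue `z`, which precedes the load in program order.
  have h4 : TransGen σ.trace.hb z.nd x.nd :=
    (h.xinv xInit_xinv).transGen_po (hz1.trans hx1.symm)
      (by change z.node < x.node; omega) (h.nd_ne_none (List.mem_of_getElem? hx))
  rw [hzy] at h4
  exact not_cycle_of_mem_scTraces hsc _ (hb.trans h4)

/-- A run in the form required by the definition of witnesses gives a feasible attack. -/
theorem XRun.exists_feasible {σ : XState T D Reg Lab} {u s q : List (AEvent T FUN Reg Lab)}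
    {b st : AEvent T FUN Reg Lab} (h : XRun P (xInit P) (u ++ b :: (s ++ st :: q)) σ)
    (hf : σ.Flushed) (hu : ∀ x ∈ u, x.IsStore → x.Immediate)
    (hs : ∀ x ∈ s, x.IsStore → x.Immediate) (hst : st.IsStore) (hsti : ¬ st.Immediate)
    (hq : ∀ x ∈ q, x.IsStore ∧ x.th = st.th) (hbt : b.th = st.th) (hsb : ∀ x ∈ s, x.th ≠ b.th)
    {a : D} {c : Cell T D} (hb : b.acc = .read a c)
    (hhb : ∀ y ∈ s ++ [st], TransGen σ.trace.hb b.nd y.nd) : ∃ A : P.Attack, A.Feasible := by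
  set l := u ++ b :: (s ++ st :: q) with hl
  -- the states before and after the load
  have h' := h
  rw [hl, xRun_append] at h'
  obtain ⟨σ₁, hru, h'⟩ := h'
  rw [xRun_cons] at h'
  obtain ⟨σ₂, hrb, hr₂⟩ := h'
  have hinv₁ : ∀ t, (σ₁.loc t).Inv := hru.inv xInit_inv
  obtain ⟨-, -, -, hbk, hearly, ld, hld, hldi, hldl⟩ := hrb.of_read hb
  have hbs : ¬ b.IsStore := by rintro ⟨_, _, hk⟩; rw [hbk] at hk; cases hk
  have hbi : b.ev.act.kind ≠ .issue := by rw [hbk]; simp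
  have hbuf := hrb.local_step.buf_of_not_store_of_not_issue hbs hbi
  -- The thread of `b` issues nothing after `b`, so its later stores are already buffered when `b`
  -- reads the memory. This will give condition (e).
  have hpend : ∀ y ∈ s ++ st :: q, ∀ b' v, y.th = b.th → y.ev.act.kind = .store b' v →
      (y.node, b', v) ∈ (σ₁.loc b.th).buf := by
    intro y hy b' v hyt hk
    rcases hr₂.store_pending hy hk with h1 | ⟨-, z, hz, hzy, hzi⟩
    · rwa [hyt, hbuf] at h1
    · exfalso
      rcases List.mem_append.1 hz with hz | hz
      · exact hsb z hz ((congrArg Prod.fst hzy).trans hyt)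
      · rcases List.mem_cons.1 hz with rfl | hz
        · exact not_isStore_of_issue hzi hst
        · exact not_isStore_of_issue hzi (hq z hz).1
  -- positions
  have hlu : ∀ i, i < u.length → ∀ x, l[i]? = some x → x ∈ u := by
    intro i hi x hx
    rw [hl, List.getElem?_append_left hi] at hx
    exact List.mem_of_getElem? hx
  have hlb : l[u.length]? = some b := by simp [hl]
  have hls : ∀ i, u.length < i → i < u.length + 1 + s.length → ∀ x, l[i]? = some x → x ∈ s := by
    intro i h1 h2 x hx
    obtain ⟨j, rfl⟩ := Nat.exists_eq_add_of_lt h1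
    rw [hl, List.getElem?_append_right (by omega),
      show u.length + j + 1 - u.length = j + 1 by omega, List.getElem?_cons_succ,
      List.getElem?_append_left (by omega)] at hx
    exact List.mem_of_getElem? hx
  have hlst : l[u.length + 1 + s.length]? = some st := by
    rw [hl, List.getElem?_append_right (by omega),
      show u.length + 1 + s.length - u.length = s.length + 1 by omega, List.getElem?_cons_succ,
      List.getElem?_append_right le_rfl]
    simp
  have hlq : ∀ i, u.length + 1 + s.length < i → ∀ x, l[i]? = some x → x ∈ q := by
    intro i h1 x hx
    obtain ⟨j, rfl⟩ := Nat.exists_eq_add_of_lt h1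
    rw [hl, List.getElem?_append_right (by omega),
      show u.length + 1 + s.length + j + 1 - u.length = s.length + j + 1 + 1 by omega,
      List.getElem?_cons_succ, List.getElem?_append_right (by omega),
      show s.length + j + 1 - s.length = j + 1 by omega, List.getElem?_cons_succ] at hx
    exact List.mem_of_getElem? hx
  have himm : ∀ i, i < u.length + 1 + s.length → ∀ x, l[i]? = some x → x.IsStore →
      x.Immediate := by
    intro i hi x hx hxs
    rcases lt_trichotomy i u.length with h1 | h1 | h1
    · exact hu x (hlu i h1 x hx) hxs
    · rw [h1, hlb] at hx
      obtain rfl := Option.some.inj hx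
      exact absurd hxs hbs
    · exact hs x (hls i h1 hi x hx) hxs
  have hlate : ∀ i, u.length + 1 + s.length ≤ i → ∀ x, l[i]? = some x →
      x ∈ s ++ st :: q ∧ x.IsStore ∧ x.th = st.th := by
    intro i hi x hx
    rcases hi.lt_or_eq with h1 | h1
    · have := hlq i h1 x hx
      exact ⟨by simp [this], hq x this⟩
    · rw [← h1, hlst] at hx
      obtain rfl := Option.some.inj hx
      exact ⟨by simp, hst, rfl⟩
  have hord := fun {i j : ℕ} {x y : AEvent T FUN Reg Lab} (hij : i < j) (hi : l[i]? = some x)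
    (hj : l[j]? = some y) => pairwise_getElem? (h.pairwise_threadOrder xInit_inv) hij hi hj
  have hnode := fun {i : ℕ} {x : AEvent T FUN Reg Lab} (hi : l[i]? = some x) =>
    h.node_lt_nxt xInit_inv (List.mem_of_getElem? hi)
  have hword : (l.map AEvent.ev).map Event.act = l.map fun x => x.ev.act := by
    rw [List.map_map]; rfl
  -- delayed stores
  have hcorr : ∀ t i j, Corresponding (l.map fun x => x.ev.act) t i j ↔ ∃ x y, l[i]? = some x ∧
      l[j]? = some y ∧ x.nd = y.nd ∧ x.ev.act.kind = .issue ∧ y.IsStore ∧ x.th = t := by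
    intro t i j
    constructor
    · rintro ⟨h1, ⟨a', v, h2⟩, n, h3, h4⟩
      obtain ⟨x, hx, rfl⟩ := h.nodeAt_iff.1 h3
      obtain ⟨y, hy, hxy⟩ := h.nodeAt_iff.1 h4
      rw [List.getElem?_map, hx] at h1
      rw [List.getElem?_map, hy] at h2
      simp only [Option.map_some, Option.some.injEq] at h1 h2
      exact ⟨x, y, hx, hy, hxy, by rw [h1], ⟨a', v, by rw [h2]⟩, by rw [AEvent.th, h1]⟩
    · rintro ⟨x, y, hx, hy, hxy, hxi, ⟨a', v, hk⟩, rfl⟩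
      have hyt : y.th = x.th := (congrArg Prod.fst hxy).symm
      refine ⟨?_, ⟨a', v, ?_⟩, x.nd, h.nodeAt_iff.2 ⟨x, hx, rfl⟩, h.nodeAt_iff.2 ⟨y, hy, hxy⟩⟩
      · rw [List.getElem?_map, hx, Option.map_some, ← hxi]
      · rw [List.getElem?_map, hy, Option.map_some, ← hk, ← hyt]
  -- An action `z` of the thread between issue and store has a node after the issue, or is itself an
  -- immediate store of an older node; both contradict the immediacy of the store at `j`.
  have hnodelay : ∀ t i j, Delayed (l.map fun x => x.ev.act) t i j →
      u.length + 1 + s.length ≤ j := by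
    rintro t i j ⟨hc, k, e, hik, hkj, hk, hkt⟩
    by_contra hj
    push Not at hj
    obtain ⟨x, y, hx, hy, hxy, hxi, hys, rfl⟩ := (hcorr t i j).1 hc
    rw [List.getElem?_map, Option.map_eq_some_iff] at hk
    obtain ⟨z, hz, rfl⟩ := hk
    have hxs := not_isStore_of_issue hxi
    have h1 := (hord hik hx hz hkt.symm).2.1 hxs
    have h2 := hord hkj hz hy (hkt.trans (congrArg Prod.fst hxy))
    have h3 := himm j hj y hy hys
    have h4 : x.node = y.node := congrArg Prod.snd hxy
    have h5 := (hnode hx).2 hxs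
    rw [AEvent.Immediate] at h3
    by_cases hzs : z.IsStore
    · have h6 := himm k (hkj.trans hj) z hz hzs
      have h7 := h2.2.2 hzs hys
      rw [AEvent.Immediate] at h6
      omega
    · have h7 := h2.2.1 hzs
      omega
  -- From `st` on, every store was issued before `b` by the same thread, so `b` itself shows that it
  -- is delayed.
  have hissued : ∀ j y, u.length + 1 + s.length ≤ j → l[j]? = some y →
      ∃ i, i < u.length ∧ Delayed (l.map fun x => x.ev.act) b.th i j ∧
        ∃ x, l[i]? = some x ∧ x.nd = y.nd ∧ x.ev.act.kind = .issue := by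
    intro j y hj hy
    obtain ⟨-, hys, hyt⟩ := hlate j hj y hy
    have hys' := hys
    obtain ⟨a', v, hk⟩ := hys'
    rcases h.store_pending (List.mem_of_getElem? hy) hk with h1 | ⟨-, z, hz, hzy, hzi⟩
    · cases h1
    · obtain ⟨i, hi⟩ := List.getElem?_of_mem hz
      have hzt : z.th = b.th := (congrArg Prod.fst hzy).trans (hyt.trans hbt.symm)
      have hiu : i < u.length := by
        by_contra hiu
        push Not at hiu
        rcases hiu.lt_or_eq with h1 | h1
        · by_cases h2 : i < u.length + 1 + s.length
          · exact hsb z (hls i h1 h2 z hi) hzt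
          · exact not_isStore_of_issue hzi (hlate i (by omega) z hi).2.1
        · rw [← h1, hlb] at hi
          obtain rfl := Option.some.inj hi
          exact hbi hzi
      exact ⟨i, hiu, ⟨(hcorr _ _ _).2 ⟨z, y, hi, hy, hzy, hzi, hys, hzt⟩, u.length, b.ev.act, hiu,
        by omega, by simp [hlb], rfl⟩, z, hi, hzy, hzi⟩
  obtain ⟨p, hp, hpd, z, hz, hzst, hzi⟩ := hissued _ st le_rfl hlst
  have hzt : z.th = b.th := (congrArg Prod.fst hzst).trans hbt.symm
  have hzs := not_isStore_of_issue hzi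
  have hznode := (hnode hz).2 hzs
  have hzst' : z.node = st.node := congrArg Prod.snd hzst
  obtain ⟨li, hli, hzli, hlist⟩ : ∃ li ∈ (P.thread b.th).code, z.ev.instr = some li ∧
      ∃ e₁ e₂, li.instr = .store e₁ e₂ := by
    have hzu := hlu p hp z hz
    obtain ⟨v, w, rfl⟩ := List.append_of_mem hzu
    rw [xRun_append] at hru
    obtain ⟨_, -, hru⟩ := hru
    rw [xRun_cons] at hru
    obtain ⟨_, hru, -⟩ := hru
    rw [← hzt]
    exact hru.local_step.of_issue_instr hzi
  have hev : ∀ {k : ℕ} {e : Event T FUN Reg Lab}, (l.map AEvent.ev)[k]? = some e →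
      ∃ x, l[k]? = some x ∧ x.ev = e := by
    intro k e hk
    rw [List.getElem?_map, Option.map_eq_some_iff] at hk
    exact hk
  -- The three positions are those of the issue of `st`, of `b`, and of `st`.
  refine ⟨⟨b.th, li, ld, hli, hld, hlist, hldl⟩, l.map AEvent.ev, p, u.length,
    u.length + 1 + s.length, ?_⟩
  constructor
  · exact isTSOExec_iff.2 ⟨l, σ, rfl, h, hf⟩
  · exact hp
  · omega
  · intro t i j hd
    rw [hword] at hd
    obtain ⟨x, y, hx, hy, hxy, -, -, rfl⟩ := (hcorr _ _ _).1 hd.1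
    exact (congrArg Prod.fst hxy : x.th = y.th).trans
      ((hlate j (hnodelay _ _ _ hd) y hy).2.2.trans hbt.symm)
  · change _ = some (⟨⟨b.th, .issue⟩, some li⟩ : Event T FUN Reg Lab)
    rw [List.getElem?_map, hz, Option.map_some, ← hzli, ← hzi, ← hzt]
  · rw [hword]; exact hpd
  · intro i j hd
    rw [hword] at hd
    have hj := hnodelay _ _ _ hd
    refine ⟨?_, hj⟩
    obtain ⟨x, y, hx, hy, hxy, hxi, hys, hxt⟩ := (hcorr _ _ _).1 hd.1
    by_contra hip
    push Not at hip
    have h1 := (hord hip hx hz (hxt.trans hzt.symm)).2.1 (not_isStore_of_issue hxi)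
    have h2 := (hnode hx).2 (not_isStore_of_issue hxi)
    have h3 : x.node = y.node := congrArg Prod.snd hxy
    rcases hj.lt_or_eq with h4 | h4
    · have h5 := (hord h4 hlst hy (hlate j hj y hy).2.2.symm).2.2 hst hys
      omega
    · rw [← h4, hlst] at hy
      obtain rfl := Option.some.inj hy
      omega
  · refine ⟨a, c.1, ?_⟩
    change _ = some (⟨⟨b.th, .load a c.1⟩, some ld⟩ : Event T FUN Reg Lab)
    rw [List.getElem?_map, hlb, Option.map_some, ← hldi, ← hbk]
  · intro k e h1 h2 hk
    obtain ⟨x, hx, rfl⟩ := hev hk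
    exact hsb x (hls k h1 h2 x hx)
  · intro k e h1 h2 hk het
    obtain ⟨x, hx, rfl⟩ := hev hk
    have h3 := (hord h1 hz hx (hzt.trans het.symm)).2.1 hzs
    refine ⟨fun hxs => ?_, fun li' hli' hfence => ?_⟩
    · have h4 := himm k (by omega) x hx hxs
      have h5 := (hord (show k < u.length + 1 + s.length by omega) hx hlst
        (het.trans hbt)).2.2 hxs hst
      rw [AEvent.Immediate] at h4
      omega
    · have h4 := pairwise_getElem? h.pairwise_mfence (show k < u.length + 1 + s.length by omega) hx
        hlst li' hli' hfence (het.trans hbt) hst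
      omega
  · intro k h1 h2
    rw [hword]
    -- Condition (c) also asks that the load happens before itself; this edge closes the cycle.
    have hback : TransGen σ.trace.hb st.nd b.nd := by
      refine (h.xinv xInit_xinv).transGen_po hbt.symm ?_ (h.nd_ne_none (List.mem_of_getElem? hlb))
      have h3 := (hord hp hz hlb hzt).2.1 hzs
      have h4 := (hnode hlb).2 hbs
      change st.node < b.node
      omega
    obtain ⟨y, hy, hby⟩ : ∃ y, l[k]? = some y ∧ TransGen σ.trace.hb b.nd y.nd := by
      rcases h1.lt_or_eq with h3 | h3
      · rcases h2.lt_or_eq with h4 | h4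
        · have hk : k < l.length := by
            have := (List.getElem?_eq_some_iff.1 hlst).1
            omega
          obtain ⟨y, hy⟩ : ∃ y, l[k]? = some y := ⟨_, List.getElem?_eq_getElem hk⟩
          exact ⟨y, hy, hhb y (List.mem_append_left _ (hls k h3 h4 y hy))⟩
        · exact ⟨st, by rw [h4, hlst], hhb st (by simp)⟩
      · exact ⟨b, by rw [← h3, hlb], (hhb st (by simp)).trans hback⟩
    refine ⟨b.nd, y.nd, h.nodeAt_iff.2 ⟨b, hlb, rfl⟩, h.nodeAt_iff.2 ⟨y, hy, rfl⟩, ?_⟩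
    rw [h.ofWord_eq_trace hf]
    exact hby
  · intro k h1 h2
    rw [hword]
    rw [List.length_map] at h2
    obtain ⟨i, hi, hd, -⟩ := hissued k _ h1.le (List.getElem?_eq_getElem h2)
    exact ⟨i, hi, hd⟩
  · intro k a' v b' w h1 h2 h3
    rw [hword] at h2 h3
    rw [List.getElem?_map, hlb, Option.map_some] at h2
    have h4 : b.ev.act.kind = .load a' v := by rw [Option.some.inj h2]
    rw [hbk] at h4
    obtain ⟨rfl, -⟩ := ActKind.load.inj h4
    rw [List.getElem?_map, Option.map_eq_some_iff] at h3
    obtain ⟨y, hy, hya⟩ := h3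
    have hyt : y.th = b.th := by rw [AEvent.th, hya]
    exact hearly _ (hpend y (hlate k h1 y hy).1 b' w hyt (by rw [hya]))

end Witnesses

end TSORobust

namespace TSORobust

/-! ### Pending stores of other threads in a cheapest cyclic computation -/

section Minimal

open Relation

theorem exists_first {α : Type*} {p : α → Prop} {l : List α} (h : ∃ x ∈ l, p x) :
    ∃ u x v, l = u ++ x :: v ∧ p x ∧ ∀ y ∈ u, ¬ p y := by
  induction l with
  | nil => simp at h
  | cons z l ih =>
    by_cases hz : p z
    · exact ⟨[], z, l, rfl, hz, by simp⟩
    · obtain ⟨x, hx, hpx⟩ := h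
      rcases List.mem_cons.1 hx with rfl | hx
      · exact absurd hpx hz
      · obtain ⟨u, y, v, rfl, hy, hu⟩ := ih ⟨x, hx, hpx⟩
        exact ⟨z :: u, y, v, rfl, hy, by simpa [hz] using hu⟩

theorem exists_last {α : Type*} {p : α → Prop} {l : List α} (h : ∃ x ∈ l, p x) :
    ∃ u x v, l = u ++ x :: v ∧ p x ∧ ∀ y ∈ v, ¬ p y := by
  obtain ⟨u, x, v, hl, hx, hu⟩ := exists_first (l := l.reverse) (p := p) (by simpa using h)
  refine ⟨v.reverse, x, u.reverse, ?_, hx, by simpa using hu⟩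
  rw [← List.reverse_reverse l, hl]
  simp

variable {T D Reg Lab : Type*} {FUN : Set (DataFun D)}

theorem word_append (l l' : List (AEvent T FUN Reg Lab)) : word (l ++ l') = word l ++ word l' :=
  List.map_append

theorem word_cons (x : AEvent T FUN Reg Lab) (l : List (AEvent T FUN Reg Lab)) :
    word (x :: l) = x.ev.act :: word l := rfl

theorem stores_ne_zero {x : AEvent T FUN Reg Lab} {l : List (AEvent T FUN Reg Lab)} (hx : x ∈ l)
    (hs : x.IsStore) : stores x.th (word l) ≠ 0 := by
  rw [stores]
  refine (List.countP_pos_iff.2 ⟨x.ev.act, List.mem_map.2 ⟨x, hx, rfl⟩, ?_⟩).ne'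
  simpa using hs

/-- One action disappears, and the rest is replaced by one with no more stores and no higher cost,
so no pair is gained. -/
theorem cost_remove_lt {u w q v : List (AEvent T FUN Reg Lab)} (x : AEvent T FUN Reg Lab)
    (hs : ∀ t, stores t (word q) ≤ stores t (word v)) (hc : cost (word q) ≤ cost (word v)) :
    cost (word (u ++ (w ++ q))) < cost (word (u ++ x :: (w ++ v))) := by
  simp only [word_append, word_cons]
  refine cost_append_lt (fun t => ?_) ?_
  · rw [stores_cons, stores_append, stores_append]
    have := hs t
    omega
  · have := cost_append_le (u := word w) hs hc
    simp only [cost]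
    omega

theorem XState.length_buf_setLoc_le {σ : XState T D Reg Lab} {t : T} {c : Loc T D Reg Lab}
    (h : c.buf.length ≤ (σ.loc t).buf.length) (t' : T) :
    ((σ.setLoc t c).loc t').buf.length ≤ (σ.loc t').buf.length := by
  by_cases ht : t' = t
  · subst ht; rwa [XState.setLoc_self]
  · rw [XState.setLoc_of_ne _ _ ht]

variable [Zero D] {P : Program T FUN Reg Lab}

theorem LStep.acc_of_not_store {t : T} {l l' : Loc T D Reg Lab} {x : AEvent T FUN Reg Lab}
    (h : LStep P t l x l') (hx : ¬ x.IsStore) : x.acc = .silent ∨ ∃ a c, x.acc = .read a c := by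
  cases h with
  | loadMemory l' r e a c => exact .inr ⟨a, c, rfl⟩
  | store => exact absurd ⟨_, _, rfl⟩ hx
  | _ => exact .inl rfl

theorem XStep.mem_of_not_store {σ σ' : XState T D Reg Lab} {x : AEvent T FUN Reg Lab}
    (h : XStep P σ x σ') (hx : ¬ x.IsStore) : σ'.mem = σ.mem := by
  rcases h.local_step.acc_of_not_store hx with h1 | ⟨a, c, h1⟩
  · exact h.mem_of_silent h1
  · exact (h.of_read h1).2.1

theorem XStep.length_buf_le_of_store {σ σ' : XState T D Reg Lab} {x : AEvent T FUN Reg Lab}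
    (h : XStep P σ x σ') (hx : x.IsStore) (t : T) :
    (σ'.loc t).buf.length ≤ (σ.loc t).buf.length := by
  by_cases ht : t = x.th
  · subst ht
    have := h.length_buf_of_store hx
    omega
  · rw [h.other t ht]

theorem XStep.buf_of_read {σ σ' : XState T D Reg Lab} {x : AEvent T FUN Reg Lab}
    (h : XStep P σ x σ') {a : D} {c : Cell T D} (hx : x.acc = .read a c) :
    ¬ x.IsStore ∧ (σ'.loc x.th).buf = (σ.loc x.th).buf := by
  have hk := (h.of_read hx).2.2.2.1
  have hs : ¬ x.IsStore := by rintro ⟨_, _, h'⟩; rw [hk] at h'; cases h'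
  exact ⟨hs, h.local_step.buf_of_not_store_of_not_issue hs (by rw [hk]; simp)⟩

theorem XStep.lt_node_of_read {σ σ' : XState T D Reg Lab} {x : AEvent T FUN Reg Lab}
    (h : XStep P σ x σ') (hσ : ∀ t, (σ.loc t).Inv) {a : D} {c : Cell T D} (hx : x.acc = .read a c)
    {p : ℕ × D × D} (hp : p ∈ (σ'.loc x.th).buf) : p.1 < x.node := by
  obtain ⟨hs, hb⟩ := h.buf_of_read hx
  rw [hb] at hp
  rw [h.local_step.node_eq_nxt hs, h.local_step.nxt_eq]
  exact (hσ _).lt_cnt hp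

/-- The last action of a thread is not a store, if stores are immediate and the buffer is not
empty afterwards. -/
theorem XRun.not_isStore_of_last {σ σ₁ σ' : XState T D Reg Lab} {b : AEvent T FUN Reg Lab}
    {l : List (AEvent T FUN Reg Lab)} (h1 : XStep P σ b σ₁) (h : XRun P σ₁ l σ')
    (hσ : ∀ t, (σ.loc t).Inv) (hl : ∀ y ∈ l, y.th ≠ b.th) (hb : b.IsStore → b.Immediate)
    (hne : (σ'.loc b.th).buf ≠ []) : ¬ b.IsStore := by
  intro hs
  have hi := hb hs
  apply hne
  rw [h.loc_eq hl, List.eq_nil_iff_forall_not_mem]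
  intro p hp
  obtain ⟨a, v, hk⟩ := hs
  have h2 := (h1.of_store hk).1
  have h3 := (hσ b.th).sorted
  rw [h2, List.pairwise_cons] at h3
  -- An entry behind an immediate store would have a number strictly between that of the latest node
  -- and the counter.
  have h4 := h3.1 p hp
  have h5 : p.1 < (σ.loc b.th).cnt := (hσ b.th).lt_cnt (by rw [h2]; exact List.mem_cons_of_mem _ hp)
  rw [AEvent.Immediate, h1.local_step.nxt_eq] at hi
  omega

/-- The action changes only the local state of its thread, which does nothing afterwards; the thread
simply stays in its former state. -/
theorem XRun.remove {σ σ₁ σ' : XState T D Reg Lab} {x : AEvent T FUN Reg Lab}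
    {l : List (AEvent T FUN Reg Lab)} (h1 : XStep P σ x σ₁) (h : XRun P σ₁ l σ')
    (hx : ¬ x.IsStore) (hl : ∀ y ∈ l, y.th ≠ x.th) :
    XRun P σ l (σ'.setLoc x.th (σ.loc x.th)) := by
  have h2 := h.setLoc hl (σ.loc x.th)
  rwa [show σ₁.setLoc x.th (σ.loc x.th) = σ from XState.ext_loc x.th (by simp)
    (fun t ht => by rw [XState.setLoc_of_ne _ _ ht, h1.other t ht])
    (h1.mem_of_not_store hx)] at h2

-- After a load has been deleted, its thread can still execute its store, since this needs only the
-- buffer. The annotation `nxt` may change, but the key does not, so chains of dependences survive.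
open Classical in
theorem XStep.replay {σ σ' : XState T D Reg Lab} {x : AEvent T FUN Reg Lab} (h : XStep P σ x σ')
    (hx : x.IsStore) {c : Loc T D Reg Lab} (hc : c.buf = (σ.loc x.th).buf) :
    ∃ y l, XStep P (σ.setLoc x.th c) y (σ'.setLoc x.th l) ∧ y.key = x.key ∧
      y.ev.act = x.ev.act ∧ l.buf = (σ'.loc x.th).buf := by
  obtain ⟨a, v, hk⟩ := hx
  obtain ⟨h1, -, h2⟩ := h.of_store hk
  rw [← hc] at h1
  have hm := h.mem_step
  rw [h2] at hm
  have h3 := LStep.store (P := P) (t := x.th) c x.node a v _ (σ.mem a) h1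
  have hact : x.ev.act = ⟨x.th, .store a v⟩ := by rw [← hk]
  refine ⟨⟨⟨⟨x.th, .store a v⟩, none⟩, x.node, c.cnt, .write a (σ.mem a) (v, some x.nd)⟩,
    ⟨c.pc, c.reg, (σ'.loc x.th).buf, c.cnt,
      Function.update c.nodes x.node (some (.store a v, (σ.mem a).2))⟩,
    ⟨?_, hm, fun t ht => ?_⟩, ?_, hact.symm, rfl⟩
  · change LStep P x.th ((σ.setLoc x.th c).loc x.th) _ ((σ'.setLoc x.th _).loc x.th)
    rw [XState.setLoc_self, XState.setLoc_self]
    exact h3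
  · change t ≠ x.th at ht
    rw [XState.setLoc_of_ne _ _ ht, XState.setLoc_of_ne _ _ ht, h.other t ht]
  · rw [AEvent.key, AEvent.key, h2]

/-- Stores that lead to empty buffers cost at most as much as any other continuation. -/
theorem XRun.flush_le {σ σ' ρ ρ' : XState T D Reg Lab} {l q : List (AEvent T FUN Reg Lab)}
    (h : XRun P σ l σ') (hf : σ'.Flushed) (hq : XRun P ρ q ρ') (hf' : ρ'.Flushed)
    (hs : ∀ x ∈ q, x.IsStore) (hρ : ∀ t, (ρ.loc t).buf.length ≤ (σ.loc t).buf.length) :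
    (∀ t, stores t (word q) ≤ stores t (word l)) ∧ cost (word q) ≤ cost (word l) := by
  have h1 : ∀ t, stores t (word q) ≤ stores t (word l) := by
    intro t
    have h1 := h.length_buf_le t
    have h2 := hq.length_buf_of_stores hs t
    have h3 := hρ t
    rw [hf t] at h1
    rw [hf' t] at h2
    simp only [List.length_nil] at h1 h2
    omega
  refine ⟨h1, cost_le_of_stores_le ?_ h1⟩
  intro x hx
  obtain ⟨y, hy, rfl⟩ := List.mem_map.1 hx
  exact hs y hy

/-- The store first passes `l`, which contains neither actions of its thread nor conflicts, and then
`b` by `XStep.swap_store`. The final state is unchanged, and the pair of `b` and the store no longer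
counts. -/
theorem XRun.advance_store {σ σ' : XState T D Reg Lab} {b x : AEvent T FUN Reg Lab}
    {l : List (AEvent T FUN Reg Lab)} (h : XRun P σ (b :: (l ++ [x])) σ')
    (hσ : ∀ t, (σ.loc t).Inv) (hl : ∀ y ∈ l, y.th ≠ b.th) (hbx : b.th = x.th) (hb : ¬ b.IsStore)
    (hx : x.IsStore) (hxi : ¬ x.Immediate) (hc : ∀ y ∈ l, ¬ y.acc.Conflict x.acc) :
    ∃ l', XRun P σ l' σ' ∧ (∀ t, stores t (word l') = stores t (word (b :: (l ++ [x])))) ∧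
      ∀ v, cost (word l' ++ v) < cost (word (b :: (l ++ [x])) ++ v) := by
  rw [xRun_cons] at h
  obtain ⟨σ₁, h1, h2⟩ := h
  have h3 := h2.move_left fun y hy => ⟨by rw [← hbx]; exact hl y hy, hc y hy⟩
  rw [xRun_cons] at h3
  obtain ⟨σ₂, h3, h4⟩ := h3
  obtain ⟨x', b', σ₃, h5, h6, h7, h8⟩ := h1.swap_store h3 hbx hb hx hxi hσ
  have hw : word (x' :: b' :: l) = x.ev.act :: b.ev.act :: word l := by
    rw [word_cons, word_cons, h7, h8]
  refine ⟨x' :: b' :: l, .cons h5 (.cons h6 h4), fun t => stores_perm t ?_, fun v => ?_⟩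
  · rw [hw, word_cons, word_append]
    exact (List.Perm.swap _ _ _).trans (List.Perm.cons _ (List.perm_append_singleton _ _).symm)
  · have h9 : cost (word l ++ x.ev.act :: v) = cost (x.ev.act :: (word l ++ v)) := by
      refine cost_move fun y hy => ?_
      obtain ⟨z, hz, rfl⟩ := List.mem_map.1 hy
      rw [← show b.th = x.ev.act.thread from hbx]
      exact hl z hz
    have h10 := cost_append_congr (u := [b.ev.act]) (fun t => stores_perm t
      (List.perm_middle (a := x.ev.act) (l₁ := word l) (l₂ := v))) h9
    have h11 : word (b :: (l ++ [x])) ++ v = [b.ev.act] ++ (word l ++ x.ev.act :: v) := by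
      simp [word]
    rw [h11, h10, hw]
    exact cost_swap_lt hbx hb hx


/-- In a computation of minimal cost with a cyclic trace, no other thread has pending stores when
the first delayed store reaches the memory. -/
theorem XRun.false_of_pending {σ₁ σ₂ σ₃ σ₄ σ : XState T D Reg Lab}
    {u s post c : List (AEvent T FUN Reg Lab)} {b st : AEvent T FUN Reg Lab}
    (hu : XRun P (xInit P) u σ₁) (hb : XStep P σ₁ b σ₂) (hs : XRun P σ₂ s σ₃)
    (hst : XStep P σ₃ st σ₄) (hp : XRun P σ₄ post σ) (hf : σ.Flushed)
    (himm : ∀ x ∈ u ++ b :: s, x.IsStore → x.Immediate) (hsts : st.IsStore)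
    (hbt : b.th = st.th) (hsb : ∀ x ∈ s, x.th ≠ b.th) (hlt : st.node < b.node) {a : D}
    {d : Cell T D} (hbr : b.acc = .read a d) (hc : c.Sublist s)
    (hch : ((b :: (c ++ [st])).map AEvent.key).IsChain Dep)
    (hbad : ∀ l ρ, XRun P (xInit P) l ρ → ρ.Flushed →
      cost (word l) < cost (word (u ++ b :: (s ++ st :: post))) → ∀ m, ¬ TransGen ρ.trace.hb m m)
    {t : T} (ht : t ≠ st.th) (hpend : (σ₄.loc t).buf ≠ []) : False := by
  obtain ⟨hbs, hbb⟩ := hb.buf_of_read hbr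
  have hinv₁ := hu.inv (P := P) xInit_inv
  have hinv₂ := fun t => hb.inv hinv₁ t
  have htb : t ≠ b.th := by rw [hbt]; exact ht
  have hch' : (b.key :: (c.map AEvent.key ++ [st.key])).IsChain Dep := by simpa using hch
  have hpw : (u ++ b :: s).Pairwise fun x y => x.th = y.th → x.node ≤ y.node :=
    (xRun_append.2 ⟨_, hu, .cons hb hs⟩ : XRun P (xInit P) (u ++ b :: s) σ₃).pairwise_node_le
      xInit_inv himm
  -- The cases concern the last action `b'` of `t` before `st`. It is not a store, since `t` still
  -- has a nonempty buffer.
  by_cases hts : ∃ y ∈ s, y.th = t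
  · obtain ⟨s₁, b', s₂, rfl, hb't, hs₂⟩ := exists_last hts
    rw [xRun_append] at hs
    obtain ⟨τ, hs1, hs⟩ := hs
    rw [xRun_cons] at hs
    obtain ⟨τ', hb', hs2⟩ := hs
    have hτ := fun t => hs1.inv (P := P) hinv₂ t
    have hrest : XRun P τ' (s₂ ++ [st]) σ₄ := xRun_append.2 ⟨_, hs2, xRun_singleton.2 hst⟩
    have hrest' : ∀ y ∈ s₂ ++ [st], y.th ≠ b'.th := by
      intro y hy
      rw [hb't]
      rcases List.mem_append.1 hy with hy | hy
      · exact hs₂ y hy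
      · rw [List.mem_singleton.1 hy]; exact ht.symm
    have hb's : ¬ b'.IsStore := hrest.not_isStore_of_last hb' hτ hrest' (himm b' (by simp))
      (by rw [hb't]; exact hpend)
    rcases hb'.local_step.acc_of_not_store hb's with hacc | ⟨a', d', hacc⟩
    · -- the last event of `t` does not access the memory
      -- Nothing depends on `b'`, which is silent and the last action of `t`, whereas every member
      -- of the chain has a successor, at the latest `st`. The chain avoids `b'`.
      have hc' : c.Sublist (s₁ ++ s₂) := by
        obtain ⟨c₁, c₂, rfl, h1, h2⟩ := List.sublist_append_iff.1 hc
        rcases List.sublist_cons_iff.1 h2 with h2 | ⟨c₃, rfl, hc₃⟩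
        · exact h1.append h2
        · exfalso
          have h3 : ((b :: c₁ ++ b' :: (c₃ ++ [st])).map AEvent.key).IsChain Dep := by
            simpa using hch
          rw [List.map_append] at h3
          have h4 := (List.isChain_append.1 h3).2.1
          obtain ⟨z, c₄, hz⟩ : ∃ z c₄, c₃ ++ [st] = z :: c₄ := by
            cases c₃ with
            | nil => exact ⟨_, _, rfl⟩
            | cons z c => exact ⟨z, _, rfl⟩
          have h5 : z ∈ s₂ ++ [st] :=
            (hc₃.append (List.Sublist.refl [st])).subset (by rw [hz]; simp)
          rw [hz, List.map_cons, List.map_cons, List.isChain_cons_cons] at h4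
          rcases h4.1 with h6 | h6
          · simp only [hacc] at h6
            exact h6
          · exact hrest' z h5 h6.1.symm
      have h1 := hrest.remove hb' hb's hrest'
      have hlen := XState.length_buf_setLoc_le (σ := σ₄) (t := b'.th) (c := τ.loc b'.th) (by
        rw [hrest.loc_eq hrest']; exact hb'.local_step.length_buf_le hb's)
      obtain ⟨q, ρ, hq, hqf, hqs⟩ := hp.exists_flush hf _ hlen
      obtain ⟨h2, h3⟩ := hp.flush_le hf hq hqf hqs hlen
      have hrun : XRun P (xInit P) ((u ++ b :: s₁) ++ ((s₂ ++ [st]) ++ q)) ρ :=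
        xRun_append.2 ⟨_, xRun_append.2 ⟨_, hu, .cons hb hs1⟩, xRun_append.2 ⟨_, h1, hq⟩⟩
      have hcost := cost_remove_lt (u := u ++ b :: s₁) (w := s₂ ++ [st]) b' h2 h3
      obtain ⟨m, hm⟩ := hrun.exists_cycle xInit_xinv hbt hlt
        (c := c.map AEvent.key) (by
          have : (b :: (c ++ [st])).Sublist ((u ++ b :: s₁) ++ ((s₂ ++ [st]) ++ q)) := by
            have h4 : ((b :: (c ++ [st])) ++ []).Sublist ((b :: ((s₁ ++ s₂) ++ [st])) ++ q) :=
              ((hc'.append (List.Sublist.refl [st])).cons_cons b).append (List.nil_sublist q)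
            have h5 := h4.trans (List.sublist_append_right u _)
            simpa using h5
          simpa using this.map AEvent.key) hch'
      exact hbad _ _ hrun hqf (by simpa using hcost) m hm
    · -- the last event of `t` reads the memory
      obtain ⟨-, hb'b⟩ := hb'.buf_of_read hacc
      have hbuf : (σ₄.loc b'.th).buf = (τ'.loc b'.th).buf := by rw [hrest.loc_eq hrest']
      rcases hσ₄ : (σ₄.loc t).buf with _ | ⟨⟨k, a₀, v₀⟩, β⟩
      · exact hpend hσ₄
      obtain ⟨st', σ₅, hst', hact, hk, hβ⟩ := exists_store_step (P := P) hσ₄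
      have hst't : st'.th = t := by rw [AEvent.th, hact]
      have hst's : st'.IsStore := ⟨a₀, v₀, by rw [hact]⟩
      have hb'st' : b'.th = st'.th := hb't.trans hst't.symm
      -- The oldest pending store `st'` of `t` was already buffered when `b'` read the memory: the
      -- pair `b'`, `st'` resembles `b`, `st`.
      have hlt' : st'.node < b'.node := by
        rw [hk]
        refine hb'.lt_node_of_read hτ hacc (p := (k, a₀, v₀)) ?_
        rw [← hbuf, hb't, hσ₄]
        exact List.mem_cons_self
      have hst'i : ¬ st'.Immediate := by
        have h1 := hb'.local_step.cnt_of_not_store hb's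
        have h2 := hb'.local_step.node_eq_nxt hb's
        rw [hb'.local_step.nxt_eq] at h2
        rw [AEvent.Immediate, hst'.local_step.nxt_eq, ← hb'st', hrest.loc_eq hrest']
        omega
      have hpw' : (b' :: (s₂ ++ [st])).Pairwise fun x y => x.th = y.th → x.node ≤ y.node := by
        rw [← List.cons_append, List.pairwise_append]
        refine ⟨hpw.sublist ?_, List.pairwise_singleton _ _, fun x hx y hy hxy => ?_⟩
        · exact ((List.sublist_append_right s₁ _).cons b).trans (List.sublist_append_right u _)
        · exfalso
          rw [List.mem_singleton.1 hy, ← hbt] at hxy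
          exact hsb x (by
            rcases List.mem_cons.1 hx with rfl | hx
            · simp
            · simp [hx]) hxy
      obtain ⟨r', s', hsep, hperm, -, hs's, hcost, hch₂⟩ :=
        (XRun.cons hb' hrest).separate hrest' hpw'
      obtain ⟨θ, hr', hsep⟩ := xRun_append.1 hsep
      by_cases hconf : ∃ y ∈ s', y.acc.Conflict st'.acc
      · -- the load `b` can be removed
        obtain ⟨y, hy, hyc⟩ := hconf
        obtain ⟨c', hc's, hc'ch⟩ := hch₂ y hy
        have hs3 : XRun P σ₂ (s₁ ++ b' :: s₂) σ₃ := xRun_append.2 ⟨_, hs1, .cons hb' hs2⟩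
        -- Being a read, `b` leaves the buffer unchanged, so `st` can be executed without it.
        have h1 := hs3.remove hb hbs hsb
        have hbuf₃ : (σ₁.loc b.th).buf = (σ₃.loc st.th).buf := by
          rw [← hbt, hs3.loc_eq hsb, hbb]
        obtain ⟨st₀, l₀, h2, hkey, hact₀, hl₀⟩ := hst.replay hsts (c := σ₁.loc b.th) hbuf₃
        rw [← hbt] at h2
        have h3 : XRun P (σ₄.setLoc b.th l₀) [st'] (σ₅.setLoc b.th l₀) :=
          (xRun_singleton.2 hst').setLoc (by
            intro x hx
            rw [List.mem_singleton.1 hx, hst't]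
            exact htb) l₀
        rw [xRun_singleton] at h3
        have hlen : ∀ t', ((σ₅.setLoc b.th l₀).loc t').buf.length ≤ (σ₄.loc t').buf.length := by
          intro t'
          refine (h3.length_buf_le_of_store hst's t').trans ?_
          refine XState.length_buf_setLoc_le ?_ t'
          rw [hl₀, hbt]
        obtain ⟨q, ρ, hq, hqf, hqs⟩ := hp.exists_flush hf _ hlen
        have hst₀s : st₀.IsStore := by rw [AEvent.IsStore, hact₀]; exact hsts
        have hlen₃ := XState.length_buf_setLoc_le (σ := σ₃) (t := b.th) (c := σ₁.loc b.th)
          (by rw [hbuf₃, hbt])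
        have hq' : XRun P (σ₃.setLoc b.th (σ₁.loc b.th)) (st₀ :: st' :: q) ρ :=
          .cons h2 (.cons h3 hq)
        obtain ⟨h4, h5⟩ := (XRun.cons hst hp).flush_le hf hq' hqf (by
          intro x hx
          rcases List.mem_cons.1 hx with rfl | hx
          · exact hst₀s
          · rcases List.mem_cons.1 hx with rfl | hx
            · exact hst's
            · exact hqs x hx) hlen₃
        have hrun : XRun P (xInit P) (u ++ ((s₁ ++ b' :: s₂) ++ (st₀ :: st' :: q))) ρ :=
          xRun_append.2 ⟨_, hu, xRun_append.2 ⟨_, h1, hq'⟩⟩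
        have hcost := cost_remove_lt (u := u) (w := s₁ ++ b' :: s₂) b h4 h5
        -- The cycle is now that of `t`: from `b'` along the chain to `y`, by conflict to `st'`, and
        -- back to `b'` by program order. If the chain uses `st`, its replay has the same key.
        obtain ⟨m, hm⟩ := hrun.exists_cycle xInit_xinv hb'st' hlt'
          (c := (c' ++ [y]).map AEvent.key) (by
            have h6 : (b' :: ((c' ++ [y]) ++ [st'])).Sublist
                (b' :: ((s₂ ++ [st]) ++ [st'])) :=
              ((hc's.trans hs's).append (List.Sublist.refl _)).cons_cons b'
            have h7 := ((h6.map AEvent.key).append (List.nil_sublist (q.map AEvent.key))).trans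
              (List.sublist_append_right ((u ++ s₁).map AEvent.key) _)
            simpa [hkey] using h7) (by
            have h8 : (((b' :: (c' ++ [y])) ++ [st']).map AEvent.key).IsChain Dep := by
              rw [List.map_append, List.isChain_append]
              refine ⟨hc'ch, by simp, ?_⟩
              intro x hx z hz
              rw [← List.cons_append, List.map_append, List.map_singleton,
                List.getLast?_concat, Option.mem_some_iff] at hx
              rw [List.map_singleton, List.head?_cons, Option.mem_some_iff] at hz
              subst hx hz
              exact .inl hyc
            simpa using h8)
        exact hbad _ _ hrun hqf (by simpa using hcost) m hm
      · -- the store of `t` can be executed earlier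
        push Not at hconf
        have h1 : XRun P θ (b' :: (s' ++ [st'])) σ₅ := by
          rw [← List.cons_append]
          exact xRun_append.2 ⟨_, hsep, xRun_singleton.2 hst'⟩
        obtain ⟨l', h2, h3, h4⟩ := h1.advance_store (hr'.inv hτ)
          (fun y hy => hrest' y (hs's.subset hy)) hb'st' hb's hst's hst'i hconf
        have hlen := fun t' => hst'.length_buf_le_of_store hst's t'
        obtain ⟨q, ρ, hq, hqf, hqs⟩ := hp.exists_flush hf _ hlen
        obtain ⟨h5, h6⟩ := hp.flush_le (q := st' :: q) hf (.cons hst' hq) hqf (by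
          intro x hx
          rcases List.mem_cons.1 hx with rfl | hx
          · exact hst's
          · exact hqs x hx) (fun _ => le_rfl)
        have hrun : XRun P (xInit P) ((u ++ b :: s₁) ++ (r' ++ (l' ++ q))) ρ :=
          xRun_append.2 ⟨_, xRun_append.2 ⟨_, hu, .cons hb hs1⟩,
            xRun_append.2 ⟨_, hr', xRun_append.2 ⟨_, h2, hq⟩⟩⟩
        have hrun' : XRun P (xInit P) ((u ++ b :: s₁) ++ (b' :: (s₂ ++ [st]) ++ st' :: q)) ρ :=
          xRun_append.2 ⟨_, xRun_append.2 ⟨_, hu, .cons hb hs1⟩,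
            xRun_append.2 ⟨_, .cons hb' hrest, .cons hst' hq⟩⟩
        -- The run with the early store ends in the same state `ρ` as `hrun'`, so it has the cycle
        -- through `b` and `st` found there.
        obtain ⟨m, hm⟩ := hrun'.exists_cycle xInit_xinv hbt hlt (c := c.map AEvent.key) (by
          have h7 : (b :: (c ++ [st])).Sublist (b :: ((s₁ ++ b' :: s₂) ++ [st])) :=
            (hc.append (List.Sublist.refl _)).cons_cons b
          have h8 := ((h7.map AEvent.key).append
            (List.nil_sublist ((st' :: q).map AEvent.key))).trans
            (List.sublist_append_right (u.map AEvent.key) _)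
          simpa using h8) hch'
        refine hbad _ _ hrun hqf ?_ m hm
        have h7 : cost (word ((u ++ b :: s₁) ++ (r' ++ (l' ++ q)))) <
            cost (word ((u ++ b :: s₁) ++ (r' ++ (b' :: (s' ++ [st']) ++ q)))) := by
          rw [word_append, word_append (u ++ b :: s₁)]
          refine cost_append_lt (fun t => ?_) ?_
          · simp only [word_append, stores_append, h3, le_refl]
          · rw [word_append, word_append r']
            refine cost_append_lt (fun t => ?_) ?_
            · simp only [word_append, stores_append, h3, le_refl]
            · rw [word_append, word_append _ q]
              exact h4 _
        have h8 : cost (word ((u ++ b :: s₁) ++ (r' ++ (b' :: (s' ++ [st']) ++ q)))) =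
            cost (word ((u ++ b :: s₁) ++ (b' :: (s₂ ++ [st]) ++ st' :: q))) := by
          rw [word_append, word_append (u ++ b :: s₁)]
          have h9 : r' ++ (b' :: (s' ++ [st']) ++ q) = (r' ++ b' :: s') ++ st' :: q := by simp
          rw [h9]
          refine cost_append_congr (fun t => ?_) ?_
          · rw [word_append, word_append _ (st' :: q), stores_append, stores_append,
              stores_perm t (hperm.map _)]
          · rw [word_append, word_append _ (st' :: q)]
            exact hcost _
        have h9 : cost (word ((u ++ b :: s₁) ++ (b' :: (s₂ ++ [st]) ++ st' :: q))) ≤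
            cost (word (u ++ b :: (s₁ ++ b' :: s₂ ++ st :: post))) := by
          have h10 := cost_append_le (u := word ((u ++ b :: s₁) ++ b' :: (s₂ ++ [st]))) h5 h6
          simpa [word] using h10
        omega
  · -- the last event of `t` precedes the load `b`
    push Not at hts
    have hrun : XRun P (xInit P) (u ++ b :: (s ++ [st])) σ₄ :=
      xRun_append.2 ⟨_, hu, .cons hb (xRun_append.2 ⟨_, hs, xRun_singleton.2 hst⟩)⟩
    have htu : ∃ y ∈ u, y.th = t := by
      by_contra htu
      push Not at htu
      rw [hrun.loc_eq (t := t)] at hpend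
      · exact hpend rfl
      · intro x hx
        rcases List.mem_append.1 hx with hx | hx
        · exact htu x hx
        · rcases List.mem_cons.1 hx with rfl | hx
          · exact htb.symm
          · rcases List.mem_append.1 hx with hx | hx
            · exact hts x hx
            · rw [List.mem_singleton.1 hx]; exact ht.symm
    obtain ⟨u₁, b', u₂, rfl, hb't, hu₂⟩ := exists_last htu
    obtain ⟨τ, hu1, hu2⟩ := xRun_append.1 hu
    obtain ⟨τ', hb', hu2⟩ := xRun_cons.1 hu2
    have hrest : XRun P τ' (u₂ ++ b :: (s ++ [st])) σ₄ :=
      xRun_append.2 ⟨_, hu2, .cons hb (xRun_append.2 ⟨_, hs, xRun_singleton.2 hst⟩)⟩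
    have hrest' : ∀ y ∈ u₂ ++ b :: (s ++ [st]), y.th ≠ b'.th := by
      intro x hx
      rw [hb't]
      rcases List.mem_append.1 hx with hx | hx
      · exact hu₂ x hx
      · rcases List.mem_cons.1 hx with rfl | hx
        · exact htb.symm
        · rcases List.mem_append.1 hx with hx | hx
          · exact hts x hx
          · rw [List.mem_singleton.1 hx]; exact ht.symm
    have hb's : ¬ b'.IsStore := hrest.not_isStore_of_last hb' (hu1.inv xInit_inv) hrest'
      (himm b' (by simp)) (by rw [hb't]; exact hpend)
    -- The chain from `b` to `st` lies entirely after `b'`, so the cycle survives the deletion.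
    have h1 := hrest.remove hb' hb's hrest'
    have hlen := XState.length_buf_setLoc_le (σ := σ₄) (t := b'.th) (c := τ.loc b'.th) (by
      rw [hrest.loc_eq hrest']; exact hb'.local_step.length_buf_le hb's)
    obtain ⟨q, ρ, hq, hqf, hqs⟩ := hp.exists_flush hf _ hlen
    obtain ⟨h2, h3⟩ := hp.flush_le hf hq hqf hqs hlen
    have hrun' : XRun P (xInit P) (u₁ ++ ((u₂ ++ b :: (s ++ [st])) ++ q)) ρ :=
      xRun_append.2 ⟨_, hu1, xRun_append.2 ⟨_, h1, hq⟩⟩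
    have hcost := cost_remove_lt (u := u₁) (w := u₂ ++ b :: (s ++ [st])) b' h2 h3
    obtain ⟨m, hm⟩ := hrun'.exists_cycle xInit_xinv hbt hlt (c := c.map AEvent.key) (by
      have h4 : (b :: (c ++ [st])).Sublist (b :: (s ++ [st])) :=
        (hc.append (List.Sublist.refl _)).cons_cons b
      have h5 := ((h4.map AEvent.key).append (List.nil_sublist (q.map AEvent.key))).trans
        (List.sublist_append_right ((u₁ ++ u₂).map AEvent.key) _)
      simpa using h5) hch'
    exact hbad _ _ hrun' hqf (by simpa using hcost) m hm

end Minimal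

end TSORobust

namespace TSORobust

/-! ### Induction on the cost and conclusion -/

section Main

open Relation

variable {T D Reg Lab : Type*} {FUN : Set (DataFun D)} [Zero D] {P : Program T FUN Reg Lab}

/-- Without feasible attacks, all traces are traces of SC computations. -/
theorem XRun.trace_mem_scTraces_of_not_feasible (hno : ∀ A : P.Attack, ¬ A.Feasible)
    {l : List (AEvent T FUN Reg Lab)} {σ : XState T D Reg Lab} (h : XRun P (xInit P) l σ)
    (hf : σ.Flushed) : σ.trace ∈ P.scTraces := by
  induction hn : cost (word l) using Nat.strong_induction_on generalizing l σ with
  | _ n ih =>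
  subst hn
  have ih' : ∀ l' ρ, XRun P (xInit P) l' ρ → ρ.Flushed → cost (word l') < cost (word l) →
      ρ.trace ∈ P.scTraces := fun l' ρ h1 h2 h3 => ih _ h3 h1 h2 rfl
  clear ih
  by_cases hall : ∀ x ∈ l, x.IsStore → x.Immediate
  · exact h.trace_mem_scTraces hf hall
  push Not at hall
  -- `st` is the first delayed store, so all stores before it are immediate.
  obtain ⟨pre, st, post, rfl, ⟨hsts, hsti⟩, hpre⟩ := exists_first hall
  obtain ⟨σ₃, h1, h2⟩ := xRun_append.1 h
  obtain ⟨σ₄, hst, hp⟩ := xRun_cons.1 h2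
  have hbuf : (σ₃.loc st.th).buf ≠ [] := by
    intro h3
    have := hst.length_buf_of_store hsts
    rw [h3] at this
    simp at this
  have himm : ∀ x ∈ pre, x.IsStore → x.Immediate := by
    intro x hx hxs
    by_contra hxi
    exact hpre x hx ⟨hxs, hxi⟩
  have hex : ∃ y ∈ pre, y.th = st.th := by
    by_contra hex
    push Not at hex
    rw [h1.loc_eq hex] at hbuf
    exact hbuf rfl
  -- `b` is the last action of the thread of `st` before `st`; it will be the load of the attack
  -- unless `st` can overtake it.
  obtain ⟨u, b, seg, rfl, hbt, hseg⟩ := exists_last hex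
  rw [← hbt] at hseg
  obtain ⟨σ₀, hu, h3⟩ := xRun_append.1 h1
  have hpw := (h1.pairwise_node_le xInit_inv himm).sublist (List.sublist_append_right u _)
  obtain ⟨r, s, hsep, hperm, -, hss, hcost, hch⟩ := h3.separate hseg hpw
  obtain ⟨σ₁, hr, h4⟩ := xRun_append.1 hsep
  obtain ⟨σ₂, hb, hs⟩ := xRun_cons.1 h4
  have hu' : XRun P (xInit P) (u ++ r) σ₁ := xRun_append.2 ⟨_, hu, hr⟩
  have hinv := hu'.inv (P := P) xInit_inv
  have hsb : ∀ y ∈ s, y.th ≠ b.th := fun y hy => hseg y (hss.subset hy)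
  have himm' : ∀ x ∈ (u ++ r) ++ b :: s, x.IsStore → x.Immediate := by
    intro x hx
    refine himm x ?_
    rw [List.append_assoc] at hx
    rcases List.mem_append.1 hx with hx | hx
    · exact List.mem_append_left _ hx
    · exact List.mem_append_right _ (hperm.subset hx)
  have hbs : ¬ b.IsStore := hs.not_isStore_of_last hb hinv hsb (himm' b (by simp))
    (by rw [hbt]; exact hbuf)
  have hword : ∀ l' : List (AEvent T FUN Reg Lab),
      cost (word ((u ++ r) ++ b :: (s ++ l'))) = cost (word ((u ++ b :: seg) ++ l')) := by
    intro l'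
    have h5 : (u ++ r) ++ b :: (s ++ l') = u ++ ((r ++ b :: s) ++ l') := by simp
    rw [h5, List.append_assoc u (b :: seg), word_append, word_append u, word_append _ l',
      word_append (b :: seg) l']
    refine cost_append_congr (fun t => ?_) (hcost _)
    rw [stores_append, stores_append, stores_perm t (hperm.map _)]
  rw [← hword] at ih'
  -- A conflict completes a chain of dependences from `b` to `st`; without one, `st` can move in
  -- front of `b`.
  by_cases hconf : ∃ y ∈ s, y.acc.Conflict st.acc
  · exfalso
    have hbad : ∀ l' ρ, XRun P (xInit P) l' ρ → ρ.Flushed →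
        cost (word l') < cost (word ((u ++ r) ++ b :: (s ++ st :: post))) →
        ∀ m, ¬ TransGen ρ.trace.hb m m :=
      fun l' ρ h5 h6 h7 => not_cycle_of_mem_scTraces (ih' l' ρ h5 h6 h7)
    obtain ⟨y, hy, hyc⟩ := hconf
    obtain ⟨c, hcs, hcch⟩ := hch y hy
    have hchain : ((b :: ((c ++ [y]) ++ [st])).map AEvent.key).IsChain Dep := by
      rw [← List.cons_append, List.map_append, List.isChain_append]
      refine ⟨hcch, by simp, ?_⟩
      intro p hp q hq
      rw [← List.cons_append, List.map_append, List.map_singleton, List.getLast?_concat,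
        Option.mem_some_iff] at hp
      rw [List.map_singleton, List.head?_cons, Option.mem_some_iff] at hq
      subst hp hq
      exact .inl hyc
    -- A silent `b` could start a chain only through its own thread, which does not act in `s`.
    obtain ⟨a, d, hbr⟩ : ∃ a d, b.acc = .read a d := by
      rcases hb.local_step.acc_of_not_store hbs with hacc | hacc
      · exfalso
        obtain ⟨z, c', hz⟩ : ∃ z c', c ++ [y] = z :: c' := by
          cases c with
          | nil => exact ⟨_, _, rfl⟩
          | cons z c => exact ⟨z, _, rfl⟩
        have hzs : z ∈ s := hcs.subset (by rw [hz]; simp)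
        rw [hz, List.map_cons, List.map_cons, List.isChain_cons_cons] at hcch
        rcases hcch.1 with h6 | h6
        · simp only [hacc] at h6
          exact h6
        · exact hsb z hzs h6.1.symm
      · exact hacc
    have hlt : st.node < b.node := by
      obtain ⟨a', v, hk⟩ := hsts
      refine hb.lt_node_of_read hinv hbr (p := (st.node, a', v)) ?_
      rw [← hs.loc_eq hsb, hbt, (hst.of_store hk).1]
      exact List.mem_cons_self
    by_cases hpend : ∃ t, t ≠ st.th ∧ (σ₄.loc t).buf ≠ []
    · obtain ⟨t, ht, hpend⟩ := hpend
      exact XRun.false_of_pending hu' hb hs hst hp hf himm' hsts hbt hsb hlt hbr hcs hchain hbad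
        ht hpend
    · push Not at hpend
      -- Only the buffer of the attacker may be nonempty, so all stores of this flush are its own,
      -- as condition (d) demands.
      obtain ⟨q, ρ, hq, hqf, hqs⟩ := hp.exists_flush hf σ₄ fun _ => le_rfl
      have hqt : ∀ x ∈ q, x.IsStore ∧ x.th = st.th := by
        refine fun x hx => ⟨hqs x hx, ?_⟩
        by_contra hxt
        have h5 := hq.length_buf_of_stores hqs x.th
        rw [hpend _ hxt, List.length_nil] at h5
        exact stores_ne_zero hx (hqs x hx) (by omega)
      have hrun : XRun P (xInit P) ((u ++ r) ++ b :: (s ++ st :: q)) ρ :=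
        xRun_append.2 ⟨_, hu', .cons hb (xRun_append.2 ⟨_, hs, .cons hst hq⟩)⟩
      -- Dependences give reflexive paths only; condition (c) needs proper ones, which distinct
      -- nodes provide.
      have hpath : ∀ {c : List (AEvent T FUN Reg Lab)} {z : AEvent T FUN Reg Lab}, z ∈ c →
          c.Sublist (s ++ [st]) → ((b :: c).map AEvent.key).IsChain Dep → b.nd ≠ z.nd →
          TransGen ρ.trace.hb b.nd z.nd := by
        intro c z hz hc hcc hne
        have h5 : ((b :: c) ++ []).Sublist ((b :: (s ++ [st])) ++ q) :=
          (hc.cons_cons b).append (List.nil_sublist q)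
        have h6 : (b :: c).Sublist ((u ++ r) ++ b :: (s ++ st :: q)) := by
          have := h5.trans (List.sublist_append_right (u ++ r) _)
          simpa using this
        have h7 := reflTransGen_of_isChain (f := Prod.fst)
          ((hrun.pairwise_dep xInit_xinv).sublist (h6.map AEvent.key)) hcc z.key
          (List.mem_map_of_mem hz)
        rcases reflTransGen_iff_eq_or_transGen.1 h7 with h8 | h8
        · exact absurd h8.symm hne
        · exact h8
      obtain ⟨A, hA⟩ := hrun.exists_feasible hqf
        (fun x hx => himm' x (List.mem_append_left _ hx))
        (fun x hx => himm' x (List.mem_append_right _ (List.mem_cons_of_mem _ hx)))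
        hsts hsti hqt hbt hsb hbr (by
          intro z hz
          rcases List.mem_append.1 hz with hz | hz
          · obtain ⟨c', hc', hcc'⟩ := hch z hz
            exact hpath (by simp) (hc'.trans (List.sublist_append_left _ _)) hcc'
              fun h5 => hsb z hz (congrArg Prod.fst h5).symm
          · obtain rfl := List.mem_singleton.1 hz
            refine hpath (by simp) (hcs.append (List.Sublist.refl _)) hchain fun h5 => ?_
            exact hlt.ne' (congrArg Prod.snd h5))
      exact hno A hA
  · push Not at hconf
    have h5 : XRun P σ₁ (b :: (s ++ [st])) σ₄ :=
      .cons hb (xRun_append.2 ⟨_, hs, xRun_singleton.2 hst⟩)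
    obtain ⟨l', h6, h7, h8⟩ := h5.advance_store hinv hsb hbt hbs hsts hsti hconf
    -- The reordered run ends in the same state `σ`, so the induction hypothesis speaks about the
    -- same trace.
    refine ih' ((u ++ r) ++ (l' ++ post)) σ
      (xRun_append.2 ⟨_, hu', xRun_append.2 ⟨_, h6, hp⟩⟩) hf ?_
    have h9 : b :: (s ++ st :: post) = b :: (s ++ [st]) ++ post := by simp
    rw [h9, word_append, word_append (u ++ r)]
    refine cost_append_lt (fun t => ?_) ?_
    · simp only [word_append, stores_append, h7, le_refl]
    · rw [word_append, word_append _ post]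
      exact h8 _

theorem robust_iff : P.Robust ↔ ∀ A : P.Attack, ¬ A.Feasible := by
  refine ⟨fun h A hA => not_robust_of_feasible hA h, fun hno => ?_⟩
  refine Set.Subset.antisymm (fun G hG => ?_) scTraces_subset_tsoTraces
  rw [tsoTraces_eq] at hG
  obtain ⟨l, σ, h, hf, rfl⟩ := hG
  exact h.trace_mem_scTraces_of_not_feasible hno hf

end Main

end TSORobust

/-- A parallel program is robust against TSO iff no attack is feasible. -/
theorem theorem1 {T D Reg Lab : Type*} [Finite T] [Zero D] {FUN : Set (DataFun D)}
    (P : Program T FUN Reg Lab) :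
    P.Robust ↔ ∀ A : P.Attack, ¬ A.Feasible := by
  exact robust_iff
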